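/- Let $n\ge 1$ and let $\omega:\mathbb{R}^n\to(0,\infty)$ be a weight in the Muckenhoupt class $A_2(\mathbb{R}^n,\mathrm{d}x)$, i.e. $\omega$ is measurable and $\sup_Q \big(\frac1{|Q|}\int_Q\omega\,\mathrm{d}x\big)\big(\frac1{|Q|}\int_Q\omega^{-1}\,\mathrm{d}x\big)<\infty$, the supremum being over all cubes with sides parallel to the axes. Put $\mathrm{d}\omega=\omega(x)\,\mathrm{d}x$ and $L^2_\omega=L^2(\mathbb{R}^n,\mathrm{d}\omega;\mathbb{C})$ with inner product $\langle u,v\rangle_{2,\omega}=\int u\,\overline{v}\,\mathrm{d}\omega$, and let $H^1_\omega$ be the space of $u\in L^2_\omega$ whose distributional gradient $\nabla_x u$ lies in $(L^2_\omega)^n$. Let $A:\mathbb{R}\times\mathbb{R}^n\to M_n(\mathbb{R})$ have measurable real-valued coefficients and satisfy, for some $M,\nu>0$, $$|A(t,x)\xi\cdot\zeta|\le M\,\omega(x)|\xi||\zeta|,\qquad \nu\,|\xi|^2\omega(x)\le \mathrm{Re}\big(A(t,x)\xi\cdot\overline{\xi}\big)$$ for all $\xi,\zeta\in\mathbb{C}^n$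 and $(t,x)\in\mathbb{R}\times\mathbb{R}^n$. Let $\mathcal{H}=\partial_t-\omega^{-1}\mathrm{div}_x(A(t,\cdot)\nabla_x)$, where for $u\in L^1_{\mathrm{loc}}(\mathbb{R};H^1_\omega)$ with $\int_{\mathbb{R}}\|\nabla_x u(t)\|_{2,\omega}^2\,\mathrm{d}t<\infty$ the equation $\mathcal{H}u=g$ means $$\iint \big(-u\,\partial_t\varphi+\omega^{-1}A\nabla_xu\cdot\nabla_x\varphi\big)\,\mathrm{d}\omega\,\mathrm{d}t=\iint g\,\varphi\,\mathrm{d}\omega\,\mathrm{d}t\qquad\text{for all }\varphi\in C_c^\infty(\mathbb{R}\times\mathbb{R}^n).$$ Let $\Gamma=(\Gamma(t,s))_{t,s\in\mathbb{R}}$ be the fundamental solution of $\mathcal{H}$, that is, a family of bounded operators on $L^2_\omega$ such that 1. $\sup_{t,s}\|\Gamma(t,s)\|<\infty$; 2. $\Gamma(t,s)=0$ if $s>t$; 3. $(t,s)\mapsto\langle\Gamma(t,s)\psi,\tilde\psi\rangle_{2,\omega}$ is Borel measurable for all $\psi,\tilde\psi\in C_c^\infty(\mathbb{R}^n)$; 4.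 for all $\phi\in C_c^\infty(\mathbb{R})$ and $\psi\in C_c^\infty(\mathbb{R}^n)$, every $u\in L^1_{\mathrm{loc}}(\mathbb{R};H^1_\omega)$ with $\int_{\mathbb{R}}\|\nabla_xu(t)\|_{2,\omega}^2\,\mathrm{d}t<\infty$ and $\mathcal{H}u=\phi\otimes\psi$ satisfies, for every $\tilde\psi\in C_c^\infty(\mathbb{R}^n)$, $\langle u(t),\tilde\psi\rangle_{2,\omega}=\int_{-\infty}^t\phi(s)\langle\Gamma(t,s)\psi,\tilde\psi\rangle_{2,\omega}\,\mathrm{d}s$ for almost every $t\in\mathbb{R}$; where, since these conditions do not see changes of $\Gamma$ on null sets of pairs $(t,s)$, $\Gamma$ is taken to be the continuous representative: for all $\psi,\tilde\psi\in L^2_\omega$, the function $\langle\Gamma(t,s)\psi,\tilde\psi\rangle_{2,\omega}$ is continuous in $t\in[s,\infty)$ for each fixed $s$ and continuous in $s\in(-\infty,t]$ for each fixed $t$. If $f\in L^2_\omega$ is real-valued and nonnegative (almost everywhere), then $\Gamma(t,s)f$ is real-valued and nonnegative (almost everywhere) for all $t\ge s$. -/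

import Mathlib

open MeasureTheory Set Matrix
open scoped ENNReal

noncomputable section

namespace DegenerateParabolic

/-- The space `ℝⁿ` with its Euclidean norm and Lebesgue measure. -/
abbrev Space (n : ℕ) : Type := EuclideanSpace ℝ (Fin n)

/-- The closed cube with sides parallel to the axes, lower corner `a` and side length `r`. -/
def cube {n : ℕ} (a : Space n) (r : ℝ) : Set (Space n) :=
  {x | ∀ i, x i ∈ Icc (a i) (a i + r)}

/-- The `A₂` characteristic of `ω`: the supremum over all cubes of (mean of `ω`) times
(mean of `1 / ω`), as an extended nonnegative number. -/
def muckenhouptConst {n : ℕ} (ω : Space n → ℝ) : ℝ≥0∞ :=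
  ⨆ (a : Space n) (r : ℝ) (_ : 0 < r),
    (⨍⁻ x in cube a r, ENNReal.ofReal (ω x) ∂volume) *
      (⨍⁻ x in cube a r, ENNReal.ofReal (ω x)⁻¹ ∂volume)

/-- The Muckenhoupt class `A₂(ℝⁿ, dx)`. -/
structure IsMuckenhouptA2 {n : ℕ} (ω : Space n → ℝ) : Prop where
  aemeasurable : AEMeasurable ω volume
  pos : ∀ x, 0 < ω x
  const_lt_top : muckenhouptConst ω < ⊤

/-- The measure `dω = ω(x) dx`. -/
def wMeasure {n : ℕ} (ω : Space n → ℝ) : Measure (Space n) :=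
  volume.withDensity fun x => ENNReal.ofReal (ω x)

/-- The complex Hilbert space `L²_ω(ℝⁿ)`. -/
abbrev L2w {n : ℕ} (ω : Space n → ℝ) : Type := Lp ℂ 2 (wMeasure ω)

/-- The space `L²_ω(ℝⁿ)ⁿ` of square-integrable vector fields with values in `ℂⁿ`. -/
abbrev L2wVec {n : ℕ} (ω : Space n → ℝ) : Type :=
  Lp (EuclideanSpace ℂ (Fin n)) 2 (wMeasure ω)

/-- The inner product `⟨u, v⟩ = ∫ u \overline{v} dω` of `L²_ω(ℝⁿ)`, linear in the first slot
(the inner product of Mathlib is linear in the second one). -/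
def innerw {n : ℕ} {ω : Space n → ℝ} (u v : L2w ω) : ℂ := inner ℂ v u

/-- Test functions: smooth, compactly supported, complex-valued. -/
def IsTestFunction {X : Type*} [NormedAddCommGroup X] [NormedSpace ℝ X] (φ : X → ℂ) : Prop :=
  ContDiff ℝ ((⊤ : ℕ∞) : WithTop ℕ∞) φ ∧ HasCompactSupport φ

/-- The element `ψ` of `L²_ω(ℝⁿ)` is (the class of) a test function. -/
def IsTestClass {n : ℕ} {ω : Space n → ℝ} (ψ : L2w ω) : Prop :=
  ∃ η : Space n → ℂ, IsTestFunction η ∧ ψ =ᵐ[wMeasure ω] η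

/-- `G` is the distributional gradient (with respect to Lebesgue measure) of `u`. Thus
`u ∈ L²_ω(ℝⁿ)` belongs to `H¹_ω(ℝⁿ)` if and only if `IsWeakGradient u G` for some `G`. -/
def IsWeakGradient {n : ℕ} {ω : Space n → ℝ} (u : L2w ω) (G : L2wVec ω) : Prop :=
  ∀ η : Space n → ℂ, IsTestFunction η → ∀ i : Fin n,
    ∫ x, u x * fderiv ℝ η x (EuclideanSpace.single i 1) = -∫ x, G x i * η x

/-- Time derivative `∂ₜ φ (t, x)`. -/
def timeDeriv {n : ℕ} (φ : ℝ × Space n → ℂ) (t : ℝ) (x : Space n) : ℂ :=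
  fderiv ℝ φ (t, x) (1, 0)

/-- Spatial gradient `∇ₓ φ (t, x)`. -/
def spaceGrad {n : ℕ} (φ : ℝ × Space n → ℂ) (t : ℝ) (x : Space n) : Fin n → ℂ :=
  fun i => fderiv ℝ φ (t, x) (0, EuclideanSpace.single i 1)

/-- The coefficients `A(t, x)` are measurable and satisfy the degenerate ellipticity conditions
`|A ξ · ζ| ≤ M ω |ξ| |ζ|` and `ν |ξ|² ω ≤ Re (A ξ · \overline{ξ})`. -/
structure IsDegenerateElliptic {n : ℕ} (ω : Space n → ℝ)
    (A : ℝ → Space n → Matrix (Fin n) (Fin n) ℂ) (M ν : ℝ) : Prop where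
  aemeasurable : ∀ i j, AEMeasurable (fun p : ℝ × Space n => A p.1 p.2 i j) volume
  bounded : ∀ (t : ℝ) (x : Space n) (ξ ζ : EuclideanSpace ℂ (Fin n)),
    ‖(A t x *ᵥ ξ.ofLp) ⬝ᵥ ζ.ofLp‖ ≤ M * ω x * ‖ξ‖ * ‖ζ‖
  coercive : ∀ (t : ℝ) (x : Space n) (ξ : EuclideanSpace ℂ (Fin n)),
    ν * ‖ξ‖ ^ 2 * ω x ≤ ((A t x *ᵥ ξ.ofLp) ⬝ᵥ star ξ.ofLp).re

/-- `u ∈ L¹_loc(ℝ; H¹_ω(ℝⁿ))` with `∫ ‖∇ₓ u(t)‖² dt < ∞`, where `G(t)` is `∇ₓ u(t)`. The local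
integrability of `G` follows from its square integrability. -/
structure IsEnergyFunction {n : ℕ} {ω : Space n → ℝ}
    (u : ℝ → L2w ω) (G : ℝ → L2wVec ω) : Prop where
  locallyIntegrable : LocallyIntegrable u volume
  gradient : ∀ᵐ t : ℝ, IsWeakGradient (u t) (G t)
  memLp_gradient : MemLp G 2 volume

/-- `∂ₜ u - ω⁻¹ divₓ(A ∇ₓ u) = ϕ ⊗ ψ` in `𝒟'(ℝ × ℝⁿ)`, where `G(t) = ∇ₓ u(t)` and all pairings are
taken with respect to `dμ = ω(x) dx dt`. -/
def IsDistributionalSolution {n : ℕ} {ω : Space n → ℝ}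
    (A : ℝ → Space n → Matrix (Fin n) (Fin n) ℂ) (u : ℝ → L2w ω) (G : ℝ → L2wVec ω)
    (ϕ : ℝ → ℂ) (ψ : L2w ω) : Prop :=
  ∀ φ : ℝ × Space n → ℂ, IsTestFunction φ →
    ∫ t : ℝ, ∫ x, (-(u t x * timeDeriv φ t x) +
        ((ω x)⁻¹ : ℂ) * ((A t x *ᵥ (G t x).ofLp) ⬝ᵥ spaceGrad φ t x)) ∂(wMeasure ω) =
      ∫ t : ℝ, ∫ x, ϕ t * ψ x * φ (t, x) ∂(wMeasure ω)

/-- Fundamental solution of `ℋ = ∂ₜ - ω⁻¹ divₓ(A ∇ₓ)`. -/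
structure IsFundamentalSolution {n : ℕ} {ω : Space n → ℝ}
    (A : ℝ → Space n → Matrix (Fin n) (Fin n) ℂ)
    (Γ : ℝ → ℝ → L2w ω →L[ℂ] L2w ω) : Prop where
  bounded : ∃ C : ℝ, ∀ t s, ‖Γ t s‖ ≤ C
  causal : ∀ t s, t < s → Γ t s = 0
  measurable : ∀ ψ ψ' : L2w ω, IsTestClass ψ → IsTestClass ψ' →
    Measurable fun p : ℝ × ℝ => innerw (Γ p.1 p.2 ψ) ψ'
  represents : ∀ (ϕ : ℝ → ℂ) (ψ : L2w ω), IsTestFunction ϕ → IsTestClass ψ →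
    ∀ (u : ℝ → L2w ω) (G : ℝ → L2wVec ω), IsEnergyFunction u G →
      IsDistributionalSolution A u G ϕ ψ →
      ∀ ψ' : L2w ω, IsTestClass ψ' →
        ∀ᵐ t : ℝ, innerw (u t) ψ' = ∫ s in Iio t, ϕ s * innerw (Γ t s ψ) ψ'

/-- Separate weak continuity of `Γ(t, s)` on `{t ≥ s}`. The conditions of
`IsFundamentalSolution` are insensitive to changes of `Γ` on null sets of pairs `(t, s)`; this
continuity selects the representative for which statements about every `t ≥ s` make sense. -/
structure IsSeparatelyWeaklyContinuous {n : ℕ} {ω : Space n → ℝ}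
    (Γ : ℝ → ℝ → L2w ω →L[ℂ] L2w ω) : Prop where
  left : ∀ (s : ℝ) (ψ ψ' : L2w ω), ContinuousOn (fun t => innerw (Γ t s ψ) ψ') (Ici s)
  right : ∀ (t : ℝ) (ψ ψ' : L2w ω), ContinuousOn (fun s => innerw (Γ t s ψ) ψ') (Iic t)

/-- The element `f` of `L²_ω(ℝⁿ)` is real-valued and nonnegative almost everywhere. -/
def IsRealNonneg {n : ℕ} {ω : Space n → ℝ} (f : L2w ω) : Prop :=
  ∀ᵐ x ∂(wMeasure ω), (f x).im = 0 ∧ 0 ≤ (f x).re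

end DegenerateParabolic

end

/-! The argument rests on existence, not uniqueness. The representation property of `Γ` applies to
every energy solution of `ℋu = ϕ ⊗ ψ`, so it suffices to construct one solution that is nonnegative
when `ϕ` and `ψ` are. This gives `∫ ϕ(s) ⟨Γ(t,s)ψ, ψ'⟩ ds ≥ 0` for almost every `t` and every
nonnegative test function `ψ'`. Letting `ϕ` concentrate at `s`, continuity in `s` yields `⟨Γ(t,s)ψ,
ψ'⟩ ≥ 0` for almost every `t > s`, and continuity in `t` yields it for all `t ≥ s`
(`innerw_fundamentalSolution_of_tests`). Nonnegative test functions are dense in the nonnegative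
cone of `L²_ω` (`nonnegCone_subset_closure`), which is self-dual, so `Γ(t,s)` preserves it.

The solution comes from the implicit Euler (Rothe) scheme. Since `A` is real, the scheme runs in
real Hilbert spaces, with the closure of the test functions in the graph norm of the gradient as
form domain. Its elements have distributional gradients, so density of test functions in all of
`H¹_ω` is never needed. Each step is a Lax–Milgram problem (`exists_step`) and preserves
nonnegativity (`euler_step_nonneg`): let `F ≤ 0` be smooth, zero exactly on `[0, ∞)`, with `0 ≤ F' ≤
1`. Formally, testing with `F(u)` gives `A∇u · ∇F(u) = F'(u) A∇u · ∇u ≥ 0`, hence `∫ u F(u) dω ≤ 0`,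
while `x F(x) > 0` for `x < 0`.

The energy bounds do not depend on the mesh. The equation is linear and nonnegativity is a family of
linear inequalities `⟨u, y⟩ ≥ 0`, so both pass to weak limits (`exists_weak_solution`); neither
strong compactness nor regularity in time is required.

Beyond positivity and measurability of `ω`, the `A₂` condition serves only to make `ω` and `ω⁻¹`
locally integrable. The first puts test functions into `L²_ω`; the second makes Lebesgue pairings
with test functions continuous on `L²_ω`. -/

noncomputable section

namespace DegenerateParabolic

open Filter Topology

/-! ### Weak limits, time-dependent bilinear forms, and Lax–Milgram -/

section Abstract

/-- A bounded sequence in a Hilbert space converges weakly along every ultrafilter. -/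
theorem exists_weak_limit_of_bounded {E : Type*} [NormedAddCommGroup E] [InnerProductSpace ℝ E]
    [CompleteSpace E] {x : ℕ → E} {C : ℝ} (hx : ∀ m, ‖x m‖ ≤ C) (U : Ultrafilter ℕ) :
    ∃ z : E, ∀ ℓ : StrongDual ℝ E, Tendsto (fun m => ℓ (x m)) U (𝓝 (ℓ z)) := by
  have hC : 0 ≤ C := (norm_nonneg _).trans (hx 0)
  -- The scalars `⟨x m, y⟩` stay in a compact ball, so they converge along `U` with no subsequence
  -- or separability argument. The limit is linear and bounded in `y`, and Riesz represents it.
  have key : ∀ y : E, ∃ l : ℝ, ‖l‖ ≤ C * ‖y‖ ∧ Tendsto (fun m => inner ℝ (x m) y) U (𝓝 l) := by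
    intro y
    have hcomp : IsCompact (Metric.closedBall (0 : ℝ) (C * ‖y‖)) := isCompact_closedBall _ _
    obtain ⟨l, hl, hle⟩ := hcomp.ultrafilter_le_nhds (U.map fun m => inner ℝ (x m) y) (by
      rw [Filter.le_principal_iff]
      change ∀ᶠ m in (U : Filter ℕ), inner ℝ (x m) y ∈ Metric.closedBall 0 (C * ‖y‖)
      refine Filter.Eventually.of_forall fun m => ?_
      rw [mem_closedBall_zero_iff]
      exact (norm_inner_le_norm _ _).trans (by gcongr; exact hx m))
    exact ⟨l, by simpa using hl, hle⟩
  choose l hlb hl using key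
  let L : E →ₗ[ℝ] ℝ :=
    { toFun := l
      map_add' := fun y y' => tendsto_nhds_unique (hl (y + y')) (by
        simpa only [inner_add_right] using (hl y).add (hl y'))
      map_smul' := fun r y => tendsto_nhds_unique (hl (r • y)) (by
        simpa only [inner_smul_right, smul_eq_mul, RingHom.id_apply] using (hl y).const_mul r) }
  let L' : StrongDual ℝ E := L.mkContinuous C hlb
  refine ⟨(InnerProductSpace.toDual ℝ E).symm L', fun ℓ => ?_⟩
  obtain ⟨y, rfl⟩ := (InnerProductSpace.toDual ℝ E).surjective ℓ
  simp only [InnerProductSpace.toDual_apply_apply, real_inner_comm _ y]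
  rw [InnerProductSpace.toDual_symm_apply]
  exact hl y

variable {H W V : Type*} [NormedAddCommGroup H] [InnerProductSpace ℝ H]
  [NormedAddCommGroup W] [InnerProductSpace ℝ W]
  [NormedAddCommGroup V] [InnerProductSpace ℝ V]

/-- A weakly measurable family of bounded bilinear forms, evaluated along strongly measurable
arguments, is measurable. -/
theorem aestronglyMeasurable_apply₂ {α : Type*} [MeasurableSpace α] {μ : Measure α}
    {b : α → W →L[ℝ] W →L[ℝ] ℝ}
    (hbm : ∀ w w', AEStronglyMeasurable (fun t => b t w w') μ) {G P : α → W}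
    (hG : AEStronglyMeasurable G μ) (hP : AEStronglyMeasurable P μ) :
    AEStronglyMeasurable (fun t => b t (G t) (P t)) μ := by
  -- For simple arguments the function is a finite sum of the maps `t ↦ b t w w'` cut off to level
  -- sets. The general case follows because each `b t` is continuous.
  have hsimple : ∀ s : SimpleFunc α (W × W),
      AEStronglyMeasurable (fun t => b t (s t).1 (s t).2) μ := by
    intro s
    have heq : (fun t => b t (s t).1 (s t).2) =
        fun t => ∑ y ∈ s.range, (s ⁻¹' {y}).indicator (fun t => b t y.1 y.2) t := by
      funext t
      rw [Finset.sum_eq_single (s t)]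
      · simp
      · intro y _ hy
        exact indicator_of_notMem (by simpa using hy.symm) _
      · intro h
        exact absurd (s.mem_range_self t) h
    rw [heq]
    refine Finset.aestronglyMeasurable_fun_sum _ fun y _ => ?_
    exact (hbm y.1 y.2).indicator (s.measurableSet_preimage _)
  have hGP : AEStronglyMeasurable (fun t => (G t, P t)) μ := hG.prodMk hP
  obtain ⟨g, hg, hge⟩ := hGP
  have hg' : AEStronglyMeasurable (fun t => b t (g t).1 (g t).2) μ := by
    refine aestronglyMeasurable_of_tendsto_ae atTop (fun m => hsimple (hg.approx m)) ?_
    refine Eventually.of_forall fun t => ?_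
    have h1 := hg.tendsto_approx t
    have hcont : Continuous fun y : W × W => b t y.1 y.2 := by fun_prop
    exact (hcont.tendsto _).comp h1
  refine hg'.congr ?_
  filter_upwards [hge] with t ht
  rw [← ht]

theorem intervalIntegrable_form {b : ℝ → W →L[ℝ] W →L[ℝ] ℝ} {M : ℝ}
    (hbm : ∀ w w', AEStronglyMeasurable (fun t => b t w w') volume)
    (hbM : ∀ t w w', |b t w w'| ≤ M * ‖w‖ * ‖w'‖)
    (α β : ℝ) (w w' : W) : IntervalIntegrable (fun t => b t w w') volume α β := by
  have : ∀ t, ‖b t w w'‖ ≤ M * ‖w‖ * ‖w'‖ := fun t =>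
    hbM t w w'
  exact (intervalIntegrable_const (c := M * ‖w‖ * ‖w'‖)).mono_fun' (hbm w w').restrict
    (Eventually.of_forall this)

/-- The time integral of a bounded family of bilinear forms. -/
theorem exists_integral_form {b : ℝ → W →L[ℝ] W →L[ℝ] ℝ} {M : ℝ}
    (hbm : ∀ w w', AEStronglyMeasurable (fun t => b t w w') volume)
    (hbM : ∀ t w w', |b t w w'| ≤ M * ‖w‖ * ‖w'‖)
    (α β : ℝ) : ∃ B : W →L[ℝ] W →L[ℝ] ℝ, ∀ w w', B w w' = ∫ t in α..β, b t w w' := by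
  have hint := intervalIntegrable_form hbm hbM α β
  let B₀ : W →ₗ[ℝ] W →ₗ[ℝ] ℝ := LinearMap.mk₂ ℝ (fun w w' => ∫ t in α..β, b t w w')
    (fun w₁ w₂ w' => by
      simp only [map_add, _root_.add_apply]
      exact intervalIntegral.integral_add (hint _ _) (hint _ _))
    (fun r w w' => by
      simp only [map_smul, _root_.smul_apply]
      exact intervalIntegral.integral_smul _ _)
    (fun w w₁ w₂ => by
      simp only [map_add]
      exact intervalIntegral.integral_add (hint _ _) (hint _ _))
    (fun r w w' => by
      simp only [map_smul]
      exact intervalIntegral.integral_smul _ _)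
  refine ⟨B₀.mkContinuous₂ (M * |β - α|) fun w w' => ?_, fun w w' => rfl⟩
  have := intervalIntegral.norm_integral_le_of_norm_le_const (a := α) (b := β)
    (f := fun t => b t w w') (C := M * ‖w‖ * ‖w'‖) (fun t _ =>
      hbM t w w')
  calc ‖∫ t in α..β, b t w w'‖ ≤ M * ‖w‖ * ‖w'‖ * |β - α| := this
    _ = _ := by ring

/-- Solvability of one implicit Euler step. -/
theorem exists_step [CompleteSpace V] (j : V →L[ℝ] H) (D : V →L[ℝ] W)
    (hV : ∀ v, ‖v‖ ^ 2 ≤ ‖j v‖ ^ 2 + ‖D v‖ ^ 2) (B : W →L[ℝ] W →L[ℝ] ℝ) {κ : ℝ} (hκ : 0 < κ)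
    (hB : ∀ w, κ * ‖w‖ ^ 2 ≤ B w w) (g : H) :
    ∃ u : V, ∀ v, inner ℝ (j u) (j v) + B (D u) (D v) = inner ℝ g (j v) := by
  let I : H →L[ℝ] H →L[ℝ] ℝ := isBoundedBilinearMap_inner.toContinuousLinearMap
  let Q : V →L[ℝ] V →L[ℝ] ℝ := I.bilinearComp j j + B.bilinearComp D D
  have hQ : ∀ u v, Q u v = inner ℝ (j u) (j v) + B (D u) (D v) := fun u v => rfl
  -- The zeroth-order term `‖j u‖²` and `κ‖D u‖²` together control the full norm by `hV`, with
  -- constant `min 1 κ`.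
  have hco : IsCoercive Q := by
    refine ⟨min 1 κ, lt_min one_pos hκ, fun u => ?_⟩
    rw [hQ, real_inner_self_eq_norm_sq]
    have h1 := hV u
    have h2 := hB (D u)
    have h3 : min 1 κ * ‖j u‖ ^ 2 ≤ 1 * ‖j u‖ ^ 2 := by gcongr; exact min_le_left _ _
    have h4 : min 1 κ * ‖D u‖ ^ 2 ≤ κ * ‖D u‖ ^ 2 := by gcongr; exact min_le_right _ _
    have h5 : min 1 κ * ‖u‖ ^ 2 ≤ min 1 κ * (‖j u‖ ^ 2 + ‖D u‖ ^ 2) := by gcongr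
    nlinarith
  let ℓ : StrongDual ℝ V := (innerSL ℝ g).comp j
  let r := (InnerProductSpace.toDual ℝ V).symm ℓ
  refine ⟨hco.continuousLinearEquivOfBilin.symm r, fun v => ?_⟩
  rw [← hQ, ← hco.continuousLinearEquivOfBilin_apply, ContinuousLinearEquiv.apply_symm_apply,
    InnerProductSpace.toDual_symm_apply]
  rfl

end Abstract

/-! ### The implicit Euler scheme and its energy estimates -/

section Rothe

variable {H W V : Type*} [NormedAddCommGroup H] [InnerProductSpace ℝ H]
  [NormedAddCommGroup W] [InnerProductSpace ℝ W]
  [NormedAddCommGroup V] [InnerProductSpace ℝ V]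

/-- The implicit Euler equations for the form `b`, the right-hand side `c ⊗ ψ` and the time
grid `τ`, started from `0`. -/
structure IsEulerSequence (j : V →L[ℝ] H) (D : V →L[ℝ] W) (b : ℝ → W →L[ℝ] W →L[ℝ] ℝ)
    (c : ℝ → ℝ) (ψ : H) (τ : ℕ → ℝ) (u : ℕ → V) : Prop where
  zero : u 0 = 0
  step : ∀ k v, inner ℝ (j (u (k + 1))) (j v) +
      ∫ t in τ k..τ (k + 1), b t (D (u (k + 1))) (D v) =
    inner ℝ (j (u k)) (j v) + (∫ t in τ k..τ (k + 1), c t) * inner ℝ ψ (j v)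

theorem le_integral_form {b : ℝ → W →L[ℝ] W →L[ℝ] ℝ} {M ν : ℝ}
    (hbm : ∀ w w', AEStronglyMeasurable (fun t => b t w w') volume)
    (hbM : ∀ t w w', |b t w w'| ≤ M * ‖w‖ * ‖w'‖)
    (hbν : ∀ᵐ t, ∀ w, ν * ‖w‖ ^ 2 ≤ b t w w) {α β : ℝ} (h : α ≤ β) (w : W) :
    (β - α) * ν * ‖w‖ ^ 2 ≤ ∫ t in α..β, b t w w := by
  have := intervalIntegral.integral_mono_ae h
    (intervalIntegrable_const (c := ν * ‖w‖ ^ 2)) (intervalIntegrable_form hbm hbM α β w w)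
    (hbν.mono fun t ht => ht w)
  rw [intervalIntegral.integral_const, smul_eq_mul] at this
  linarith

/-- The form is averaged over each time interval rather than sampled, since it is only measurable in
time. Positivity is phrased by duality with `Y`, a condition stable under weak limits; `hY` is its
invariance under one step, and the data `j (u k) + (∫ c) • ψ` of the next step inherit it because `c
≥ 0`. -/
theorem exists_eulerSequence [CompleteSpace V] (j : V →L[ℝ] H) (D : V →L[ℝ] W)
    (hV : ∀ v, ‖v‖ ^ 2 ≤ ‖j v‖ ^ 2 + ‖D v‖ ^ 2) {b : ℝ → W →L[ℝ] W →L[ℝ] ℝ} {M ν : ℝ}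
    (hν : 0 < ν) (hbm : ∀ w w', AEStronglyMeasurable (fun t => b t w w') volume)
    (hbM : ∀ t w w', |b t w w'| ≤ M * ‖w‖ * ‖w'‖) (hbν : ∀ᵐ t, ∀ w, ν * ‖w‖ ^ 2 ≤ b t w w)
    {c : ℝ → ℝ} (hc0 : ∀ t, 0 ≤ c t) {ψ : H} {Y : Set H} (hψ : ∀ y ∈ Y, 0 ≤ inner ℝ ψ y)
    (hY : ∀ α β : ℝ, α < β → ∀ (u : V) (g : H), (∀ y ∈ Y, 0 ≤ inner ℝ g y) →
      (∀ v, inner ℝ (j u) (j v) + ∫ t in α..β, b t (D u) (D v) = inner ℝ g (j v)) →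
      ∀ y ∈ Y, 0 ≤ inner ℝ (j u) y)
    {τ : ℕ → ℝ} (hτ : ∀ k, τ k < τ (k + 1)) :
    ∃ u : ℕ → V, IsEulerSequence j D b c ψ τ u ∧ ∀ k, ∀ y ∈ Y, 0 ≤ inner ℝ (j (u k)) y := by
  have hex : ∀ (k : ℕ) (u : V), ∃ u' : V, ∀ v, inner ℝ (j u') (j v) +
      ∫ t in τ k..τ (k + 1), b t (D u') (D v) =
        inner ℝ (j u + (∫ t in τ k..τ (k + 1), c t) • ψ) (j v) := by
    intro k u
    obtain ⟨B, hB⟩ := exists_integral_form hbm hbM (τ k) (τ (k + 1))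
    obtain ⟨u', hu'⟩ := exists_step j D hV B (κ := (τ (k + 1) - τ k) * ν)
      (mul_pos (sub_pos.2 (hτ k)) hν)
      (fun w => by rw [hB]; exact le_integral_form hbm hbM hbν (hτ k).le w)
      (j u + (∫ t in τ k..τ (k + 1), c t) • ψ)
    exact ⟨u', fun v => by rw [← hu' v, hB]⟩
  choose S hS using hex
  let u : ℕ → V := fun k => Nat.rec 0 (fun k v => S k v) k
  have hu : ∀ k, u (k + 1) = S k (u k) := fun k => rfl
  refine ⟨u, ⟨rfl, fun k v => ?_⟩, fun k => ?_⟩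
  · rw [hu, hS, inner_add_left, real_inner_smul_left]
  · induction k with
    | zero => intro y _; simp [u]
    | succ k ih =>
      refine hY _ _ (hτ k) (u (k + 1)) _ (fun y hy => ?_) (hS k (u k))
      rw [inner_add_left, real_inner_smul_left]
      exact add_nonneg (ih y hy) (mul_nonneg
        (intervalIntegral.integral_nonneg (hτ k).le fun t _ => hc0 t) (hψ y hy))

namespace IsEulerSequence

variable {j : V →L[ℝ] H} {D : V →L[ℝ] W} {b : ℝ → W →L[ℝ] W →L[ℝ] ℝ} {M ν : ℝ}
  {c : ℝ → ℝ} {ψ : H} {τ : ℕ → ℝ} {u : ℕ → V}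

/-- The step equation tested with its own solution `u (k + 1)`, followed by Cauchy–Schwarz. -/
theorem energy_step (hu : IsEulerSequence j D b c ψ τ u)
    (hbm : ∀ w w', AEStronglyMeasurable (fun t => b t w w') volume)
    (hbM : ∀ t w w', |b t w w'| ≤ M * ‖w‖ * ‖w'‖) (hbν : ∀ᵐ t, ∀ w, ν * ‖w‖ ^ 2 ≤ b t w w)
    (hc0 : ∀ t, 0 ≤ c t) (hτ : ∀ k, τ k < τ (k + 1)) (k : ℕ) :
    ‖j (u (k + 1))‖ ^ 2 + (τ (k + 1) - τ k) * ν * ‖D (u (k + 1))‖ ^ 2 ≤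
      ‖j (u k)‖ * ‖j (u (k + 1))‖ +
        (∫ t in τ k..τ (k + 1), c t) * ‖ψ‖ * ‖j (u (k + 1))‖ := by
  have h1 := hu.step k (u (k + 1))
  rw [real_inner_self_eq_norm_sq] at h1
  have h2 := le_integral_form hbm hbM hbν (hτ k).le (D (u (k + 1)))
  have h3 := real_inner_le_norm (j (u k)) (j (u (k + 1)))
  have h4 := mul_le_mul_of_nonneg_left (real_inner_le_norm ψ (j (u (k + 1))))
    (intervalIntegral.integral_nonneg (hτ k).le (fun t _ => hc0 t) :
      0 ≤ ∫ t in τ k..τ (k + 1), c t)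
  linarith

theorem norm_le (hu : IsEulerSequence j D b c ψ τ u) (hν : 0 ≤ ν)
    (hbm : ∀ w w', AEStronglyMeasurable (fun t => b t w w') volume)
    (hbM : ∀ t w w', |b t w w'| ≤ M * ‖w‖ * ‖w'‖) (hbν : ∀ᵐ t, ∀ w, ν * ‖w‖ ^ 2 ≤ b t w w)
    (hc0 : ∀ t, 0 ≤ c t) (hτ : ∀ k, τ k < τ (k + 1)) (k : ℕ) :
    ‖j (u k)‖ ≤ (∑ i ∈ Finset.range k, ∫ t in τ i..τ (i + 1), c t) * ‖ψ‖ := by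
  induction k with
  | zero => simp [hu.zero]
  | succ k ih =>
    have h := hu.energy_step hbm hbM hbν hc0 hτ k
    have h0 : 0 ≤ (τ (k + 1) - τ k) * ν * ‖D (u (k + 1))‖ ^ 2 :=
      mul_nonneg (mul_nonneg (sub_pos.2 (hτ k)).le hν) (sq_nonneg _)
    rw [Finset.sum_range_succ, add_mul]
    -- After the gradient term is dropped, the energy inequality is divided by `‖j (u (k + 1))‖`, so
    -- the zero case is separate.
    rcases (norm_nonneg (j (u (k + 1)))).eq_or_lt with h' | h'
    · rw [← h']
      refine add_nonneg ((norm_nonneg _).trans ih) (mul_nonneg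
        (intervalIntegral.integral_nonneg (hτ k).le fun t _ => hc0 t) (norm_nonneg _))
    · have : ‖j (u (k + 1))‖ ≤ ‖j (u k)‖ + (∫ t in τ k..τ (k + 1), c t) * ‖ψ‖ := by
        refine le_of_mul_le_mul_right ?_ h'
        nlinarith
      linarith

/-- The gradient term is kept this time: `ab ≤ (a² + b²)/2` makes the energy inequalities telescope,
and the uniform bound on `‖j (u k)‖` absorbs the source. -/
theorem sum_norm_sq_le (hu : IsEulerSequence j D b c ψ τ u) (hν : 0 ≤ ν)
    (hbm : ∀ w w', AEStronglyMeasurable (fun t => b t w w') volume)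
    (hbM : ∀ t w w', |b t w w'| ≤ M * ‖w‖ * ‖w'‖) (hbν : ∀ᵐ t, ∀ w, ν * ‖w‖ ^ 2 ≤ b t w w)
    (hc0 : ∀ t, 0 ≤ c t) (hτ : ∀ k, τ k < τ (k + 1)) {m : ℝ}
    (hm : ∀ k, ∑ i ∈ Finset.range k, ∫ t in τ i..τ (i + 1), c t ≤ m) (k : ℕ) :
    ∑ i ∈ Finset.range k, (τ (i + 1) - τ i) * ν * ‖D (u (i + 1))‖ ^ 2 ≤ (m * ‖ψ‖) ^ 2 := by
  have hK : ∀ k, ‖j (u k)‖ ≤ m * ‖ψ‖ := fun k =>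
    (hu.norm_le hν hbm hbM hbν hc0 hτ k).trans (by gcongr; exact hm k)
  have key : ‖j (u k)‖ ^ 2 / 2 +
      ∑ i ∈ Finset.range k, (τ (i + 1) - τ i) * ν * ‖D (u (i + 1))‖ ^ 2 ≤
      (m * ‖ψ‖) * ((∑ i ∈ Finset.range k, ∫ t in τ i..τ (i + 1), c t) * ‖ψ‖) := by
    induction k with
    | zero => simp [hu.zero]
    | succ k ih =>
      have h := hu.energy_step hbm hbM hbν hc0 hτ k
      have hc : 0 ≤ ∫ t in τ k..τ (k + 1), c t :=
        intervalIntegral.integral_nonneg (hτ k).le fun t _ => hc0 t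
      have h1 : (∫ t in τ k..τ (k + 1), c t) * ‖ψ‖ * ‖j (u (k + 1))‖ ≤
          (∫ t in τ k..τ (k + 1), c t) * ‖ψ‖ * (m * ‖ψ‖) :=
        mul_le_mul_of_nonneg_left (hK _) (mul_nonneg hc (norm_nonneg _))
      rw [Finset.sum_range_succ, Finset.sum_range_succ]
      nlinarith [sq_nonneg (‖j (u k)‖ - ‖j (u (k + 1))‖)]
  have hm0 : 0 ≤ m * ‖ψ‖ := (norm_nonneg _).trans (hK 0)
  have h2 : (m * ‖ψ‖) * ((∑ i ∈ Finset.range k, ∫ t in τ i..τ (i + 1), c t) * ‖ψ‖) ≤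
      (m * ‖ψ‖) * (m * ‖ψ‖) :=
    mul_le_mul_of_nonneg_left (mul_le_mul_of_nonneg_right (hm k) (norm_nonneg _)) hm0
  nlinarith [sq_nonneg ‖j (u k)‖]

/-- Summed Euler equations, after an Abel summation in the time difference. -/
theorem sum_eq (hu : IsEulerSequence j D b c ψ τ u) (p : ℕ → V) {N : ℕ} (hN : p (N + 1) = 0) :
    (∑ k ∈ Finset.range N, -inner ℝ (j (u (k + 1))) (j (p (k + 2)) - j (p (k + 1)))) +
      ∑ k ∈ Finset.range N, ∫ t in τ k..τ (k + 1), b t (D (u (k + 1))) (D (p (k + 1))) =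
    ∑ k ∈ Finset.range N, (∫ t in τ k..τ (k + 1), c t) * inner ℝ ψ (j (p (k + 1))) := by
  -- Telescoping between `u 0 = 0` and `p (N + 1) = 0`. Subtracting this sum moves the time
  -- difference onto `p`, one index later: `p (k + 2) - p (k + 1)` appears against `u (k + 1)`.
  have h1 : ∑ k ∈ Finset.range N,
      (inner ℝ (j (u (k + 1))) (j (p (k + 2))) - inner ℝ (j (u k)) (j (p (k + 1)))) = 0 := by
    rw [Finset.sum_range_sub (fun k => inner ℝ (j (u k)) (j (p (k + 1))))]
    simp [hN, hu.zero]
  rw [← sub_eq_zero, ← neg_eq_zero.2 h1, ← Finset.sum_neg_distrib, ← Finset.sum_add_distrib,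
    ← Finset.sum_sub_distrib]
  refine Finset.sum_congr rfl fun k _ => ?_
  have h2 := hu.step k (p (k + 1))
  rw [inner_sub_right]
  linarith

end IsEulerSequence

end Rothe

/-! ### Piecewise constant interpolation in time -/

section Interpolation

/-- The index `k` with `t ∈ (t₀ + (k - 1) h, t₀ + k h]`, and `0` for `t ≤ t₀`. -/
def gridIndex (t₀ h t : ℝ) : ℕ := ⌈(t - t₀) / h⌉₊

/-- The right end of the grid interval containing `t`. -/
def gridPoint (t₀ h t : ℝ) : ℝ := t₀ + gridIndex t₀ h t * h

variable {t₀ h : ℝ}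

theorem measurable_gridIndex : Measurable (gridIndex t₀ h) :=
  Nat.measurable_ceil.comp ((measurable_id.sub_const t₀).div_const h)

theorem gridIndex_of_le (hh : 0 < h) {t : ℝ} (ht : t ≤ t₀) : gridIndex t₀ h t = 0 :=
  Nat.ceil_eq_zero.2 (div_nonpos_of_nonpos_of_nonneg (sub_nonpos.2 ht) hh.le)

theorem gridIndex_eq_succ_iff (hh : 0 < h) {t : ℝ} {k : ℕ} :
    gridIndex t₀ h t = k + 1 ↔ t ∈ Ioc (t₀ + k * h) (t₀ + (k + 1 : ℕ) * h) := by
  rw [gridIndex, Nat.ceil_eq_iff k.succ_ne_zero, mem_Ioc, lt_div_iff₀ hh, div_le_iff₀ hh]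
  simp only [Nat.succ_eq_add_one, add_tsub_cancel_right]
  constructor <;> rintro ⟨h1, h2⟩ <;> constructor <;> linarith

theorem le_gridPoint (hh : 0 < h) (t : ℝ) : t ≤ gridPoint t₀ h t := by
  have := Nat.le_ceil ((t - t₀) / h)
  rw [div_le_iff₀ hh] at this
  rw [gridPoint, gridIndex]
  linarith

theorem gridPoint_le (hh : 0 < h) {t : ℝ} (ht : t₀ ≤ t) : gridPoint t₀ h t ≤ t + h := by
  have := (Nat.ceil_lt_add_one (div_nonneg (sub_nonneg.2 ht) hh.le)).le
  have h2 := mul_le_mul_of_nonneg_right this hh.le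
  rw [add_mul, div_mul_cancel₀ _ hh.ne'] at h2
  rw [gridPoint, gridIndex]
  linarith

theorem measurable_gridPoint : Measurable (gridPoint t₀ h) :=
  ((measurable_from_top (f := fun k : ℕ => (k : ℝ))).comp measurable_gridIndex).mul_const h
    |>.const_add t₀

variable {H W V : Type*} [NormedAddCommGroup H] [InnerProductSpace ℝ H]
  [NormedAddCommGroup W] [InnerProductSpace ℝ W]
  [NormedAddCommGroup V] [InnerProductSpace ℝ V]
  {j : V →L[ℝ] H} {D : V →L[ℝ] W} {b : ℝ → W →L[ℝ] W →L[ℝ] ℝ} {M ν : ℝ}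
  {c : ℝ → ℝ} {ψ : H} {u : ℕ → V}

/-- Lebesgue measure is pushed forward to `ℕ`: the fibre over `k + 1` has length `h`, while that
over `0` is a half-line, whence the requirement `f 0 = 0`. -/
theorem lintegral_gridIndex_le (hh : 0 < h) (f : ℕ → ℝ) (hf0 : ∀ k, 0 ≤ f k) (hf : f 0 = 0)
    {C : ℝ} (hC : ∀ N, ∑ k ∈ Finset.range N, h * f (k + 1) ≤ C) :
    ∫⁻ t, ENNReal.ofReal (f (gridIndex t₀ h t)) ≤ ENNReal.ofReal C := by
  rw [← lintegral_map (f := fun k : ℕ => ENNReal.ofReal (f k)) (measurable_from_top)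
    measurable_gridIndex, lintegral_countable']
  refine ENNReal.tsum_le_of_sum_range_le fun N => ?_
  rcases N with _ | N
  · simp
  rw [Finset.sum_range_succ', hf, ENNReal.ofReal_zero, zero_mul, add_zero]
  have : ∀ k ∈ Finset.range N, ENNReal.ofReal (f (k + 1)) *
      (Measure.map (gridIndex t₀ h) volume) {k + 1} = ENNReal.ofReal (h * f (k + 1)) := by
    intro k _
    rw [Measure.map_apply measurable_gridIndex (measurableSet_singleton _)]
    have : gridIndex t₀ h ⁻¹' {k + 1} = Ioc (t₀ + k * h) (t₀ + (k + 1 : ℕ) * h) := by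
      ext t
      exact gridIndex_eq_succ_iff hh
    rw [this, Real.volume_Ioc, ← ENNReal.ofReal_mul (hf0 _)]
    congr 1
    push_cast
    ring
  rw [Finset.sum_congr rfl this, ← ENNReal.ofReal_sum_of_nonneg fun k _ =>
    mul_nonneg hh.le (hf0 _)]
  exact ENNReal.ofReal_le_ofReal (hC N)

/-- The weak form of the Euler equations for the piecewise constant interpolation. -/
theorem IsEulerSequence.integral_eq (hh : 0 < h)
    (hu : IsEulerSequence j D b c ψ (fun k => t₀ + k * h) u)
    (hbm : ∀ w w', AEStronglyMeasurable (fun t => b t w w') volume)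
    (hbM : ∀ t w w', |b t w w'| ≤ M * ‖w‖ * ‖w'‖) (hc : Continuous c) (hct : ∀ t ≤ t₀, c t = 0)
    {p : ℝ → V} {q : ℝ → H} {T : ℝ} (hq : Continuous q)
    (hpq : ∀ t, HasDerivAt (fun t => j (p t)) (q t) t)
    (hpT : ∀ t, T ≤ t → p t = 0) (hqT : ∀ t, T ≤ t → q t = 0) :
    ∫ t, (-inner ℝ (j (u (gridIndex t₀ h t))) (q (t + h)) +
      b t (D (u (gridIndex t₀ h t))) (D (p (gridPoint t₀ h t)))) =
    ∫ t, c t * inner ℝ ψ (j (p (gridPoint t₀ h t))) := by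
  set τ : ℕ → ℝ := fun k => t₀ + k * h with hτ
  have hτs : ∀ k, τ k < τ (k + 1) := fun k => by
    simp only [hτ]; push_cast; linarith
  obtain ⟨N, hN⟩ := exists_nat_ge ((T - t₀) / h)
  have hTN : T ≤ τ N := by
    rw [div_le_iff₀ hh] at hN
    simp only [hτ]; linarith
  have hτ0 : τ 0 = t₀ := by simp [hτ]
  have hidx : ∀ k t, t ∈ uIoc (τ k) (τ (k + 1)) → gridIndex t₀ h t = k + 1 := by
    intro k t ht
    rw [uIoc_of_le (hτs k).le] at ht
    exact (gridIndex_eq_succ_iff hh).2 ht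
  have hpt : ∀ k t, t ∈ uIoc (τ k) (τ (k + 1)) → gridPoint t₀ h t = τ (k + 1) := by
    intro k t ht
    rw [gridPoint, hidx k t ht]
  set F : ℝ → ℝ := fun t => -inner ℝ (j (u (gridIndex t₀ h t))) (q (t + h)) +
      b t (D (u (gridIndex t₀ h t))) (D (p (gridPoint t₀ h t))) with hF
  -- Both integrands vanish outside `(τ 0, τ N]`: to the left because `u 0 = 0` and `c = 0`, to the
  -- right because `p` and `q` vanish after `T`.
  set R : ℝ → ℝ := fun t => c t * inner ℝ ψ (j (p (gridPoint t₀ h t))) with hR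
  have hFk : ∀ k t, t ∈ uIoc (τ k) (τ (k + 1)) → -inner ℝ (j (u (k + 1))) (q (t + h)) +
      b t (D (u (k + 1))) (D (p (τ (k + 1)))) = F t := by
    intro k t ht
    simp only [hF, hidx k t ht, hpt k t ht]
  have hRk : ∀ k t, t ∈ uIoc (τ k) (τ (k + 1)) → c t * inner ℝ ψ (j (p (τ (k + 1)))) = R t := by
    intro k t ht
    simp only [hR, hpt k t ht]
  have hqi : ∀ k, IntervalIntegrable (fun t => -inner ℝ (j (u (k + 1))) (q (t + h))) volume
      (τ k) (τ (k + 1)) := fun k => Continuous.intervalIntegrable (by fun_prop) _ _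
  have hbi : ∀ k, IntervalIntegrable (fun t => b t (D (u (k + 1))) (D (p (τ (k + 1))))) volume
      (τ k) (τ (k + 1)) := fun k => intervalIntegrable_form hbm hbM _ _ _ _
  have hFi : ∀ k, IntervalIntegrable F volume (τ k) (τ (k + 1)) := fun k =>
    ((hqi k).add (hbi k)).congr (fun t ht => hFk k t ht)
  have hRi : ∀ k, IntervalIntegrable R volume (τ k) (τ (k + 1)) := fun k =>
    IntervalIntegrable.congr (fun t ht => hRk k t ht)
      (Continuous.intervalIntegrable (by fun_prop) _ _)
  have hFs : Function.support F ⊆ Ioc (τ 0) (τ N) := by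
    intro t ht
    by_contra hcon
    apply ht
    rw [hτ0, mem_Ioc, not_and_or, not_lt, not_le] at hcon
    rcases hcon with hcon | hcon
    · simp [hF, gridIndex_of_le hh hcon, hu.zero]
    · have h1 := hqT (t + h) (by linarith)
      have h2 := hpT (gridPoint t₀ h t) (by have := le_gridPoint (t₀ := t₀) hh t; linarith)
      simp [hF, h1, h2]
  have hRs : Function.support R ⊆ Ioc (τ 0) (τ N) := by
    intro t ht
    by_contra hcon
    apply ht
    rw [hτ0, mem_Ioc, not_and_or, not_lt, not_le] at hcon
    rcases hcon with hcon | hcon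
    · simp [hR, hct t hcon]
    · have h2 := hpT (gridPoint t₀ h t) (by have := le_gridPoint (t₀ := t₀) hh t; linarith)
      simp [hR, h2]
  rw [← intervalIntegral.integral_eq_integral_of_support_subset hFs,
    ← intervalIntegral.integral_eq_integral_of_support_subset hRs,
    ← intervalIntegral.sum_integral_adjacent_intervals (fun k _ => hFi k),
    ← intervalIntegral.sum_integral_adjacent_intervals (fun k _ => hRi k)]
  have hsum := hu.sum_eq (fun k => p (τ k)) (N := N) (hpT _ (hTN.trans (hτs N).le))
  rw [← Finset.sum_add_distrib] at hsum
  refine Eq.trans (Finset.sum_congr rfl fun k _ => ?_) (hsum.trans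
    (Finset.sum_congr rfl fun k _ => ?_))
  · rw [← intervalIntegral.integral_congr_ae (Eventually.of_forall (hFk k)),
      intervalIntegral.integral_add (hqi k) (hbi k)]
    congr 1
    -- The index shift from Abel summation becomes the time shift in `q (t + h)`: the difference `j
    -- (p (τ (k + 2))) - j (p (τ (k + 1)))` is the integral of `q (t + h)` over the `k`-th interval.
    have hd : ∀ t, HasDerivAt (fun t => inner ℝ (j (u (k + 1))) (j (p (t + h))))
        (inner ℝ (j (u (k + 1))) (q (t + h))) t := by
      intro t
      have h1 : HasDerivAt (fun t => j (p (t + h))) (q (t + h)) t :=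
        (hpq (t + h)).comp_add_const t h
      simpa using (hasDerivAt_const t (j (u (k + 1)))).inner ℝ h1
    rw [intervalIntegral.integral_neg,
      intervalIntegral.integral_eq_sub_of_hasDerivAt (fun t _ => hd t)
        (Continuous.intervalIntegrable (by fun_prop) _ _)]
    rw [inner_sub_right]
    have e1 : τ (k + 1) + h = τ (k + 2) := by simp only [hτ]; push_cast; ring
    have e2 : τ k + h = τ (k + 1) := by simp only [hτ]; push_cast; ring
    rw [e1, e2]
  · rw [← intervalIntegral.integral_congr_ae (Eventually.of_forall (hRk k)),
      intervalIntegral.integral_mul_const]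

end Interpolation

/-! ### Bilinear forms on Bochner spaces and mesh-independent approximations -/

section Limit

theorem norm_toLp_sq {α E : Type*} [MeasurableSpace α] {μ : Measure α} [NormedAddCommGroup E]
    [InnerProductSpace ℝ E] {f : α → E} (hf : MemLp f 2 μ) :
    ‖hf.toLp f‖ ^ 2 = ∫ x, ‖f x‖ ^ 2 ∂μ := by
  rw [← real_inner_self_eq_norm_sq, L2.inner_def]
  refine integral_congr_ae ?_
  filter_upwards [hf.coeFn_toLp] with x hx
  rw [hx, real_inner_self_eq_norm_sq]

variable {H W V : Type*} [NormedAddCommGroup H] [InnerProductSpace ℝ H]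
  [NormedAddCommGroup W] [InnerProductSpace ℝ W]
  [NormedAddCommGroup V] [InnerProductSpace ℝ V]
  {j : V →L[ℝ] H} {D : V →L[ℝ] W} {b : ℝ → W →L[ℝ] W →L[ℝ] ℝ} {M ν : ℝ}
  {c : ℝ → ℝ} {ψ : H}

section Form

variable {α : Type*} [MeasurableSpace α] {μ : Measure α}

theorem integrable_form_apply {b : α → W →L[ℝ] W →L[ℝ] ℝ}
    (hbm : ∀ w w', AEStronglyMeasurable (fun t => b t w w') μ)
    (hbM : ∀ t w w', |b t w w'| ≤ M * ‖w‖ * ‖w'‖) {G R : α → W}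
    (hG : MemLp G 2 μ) (hR : MemLp R 2 μ) :
    Integrable (fun t => b t (G t) (R t)) μ := by
  have h1 : Integrable (fun t => M * (‖G t‖ * ‖R t‖)) μ :=
    (MemLp.integrable_mul hG.norm hR.norm).const_mul M
  refine h1.mono' (aestronglyMeasurable_apply₂ hbm hG.1 hR.1) (Eventually.of_forall fun t => ?_)
  rw [← mul_assoc]
  exact hbM t _ _

theorem abs_integral_form_apply_le {b : α → W →L[ℝ] W →L[ℝ] ℝ} (hM : 0 ≤ M)
    (hbM : ∀ t w w', |b t w w'| ≤ M * ‖w‖ * ‖w'‖) {G R : α → W}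
    (hG : MemLp G 2 μ) (hR : MemLp R 2 μ) :
    |∫ t, b t (G t) (R t) ∂μ| ≤ M * (‖hG.toLp G‖ * ‖hR.toLp R‖) := by
  have h1 : Integrable (fun t => ‖G t‖ * ‖R t‖) μ := MemLp.integrable_mul hG.norm hR.norm
  calc |∫ t, b t (G t) (R t) ∂μ| ≤ ∫ t, M * (‖G t‖ * ‖R t‖) ∂μ := by
        rw [← Real.norm_eq_abs]
        refine norm_integral_le_of_norm_le (h1.const_mul M) (Eventually.of_forall fun t => ?_)
        rw [← mul_assoc]
        exact hbM t _ _
    _ = M * inner ℝ (hG.norm.toLp _) (hR.norm.toLp _) := by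
        rw [integral_const_mul, L2.inner_def]
        congr 1
        refine integral_congr_ae ?_
        filter_upwards [hG.norm.coeFn_toLp, hR.norm.coeFn_toLp] with t h1 h2
        rw [h1, h2]
        simp [mul_comm]
    _ ≤ M * (‖hG.norm.toLp _‖ * ‖hR.norm.toLp _‖) := by
        gcongr
        exact real_inner_le_norm _ _
    _ = M * (‖hG.toLp G‖ * ‖hR.toLp R‖) := by
        simp only [Lp.norm_toLp, eLpNorm_norm]

/-- The functional `G ↦ ∫ b_t(G(t), R(t)) dt` on `L²(μ; W)`. -/
theorem exists_form_functional {b : α → W →L[ℝ] W →L[ℝ] ℝ}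
    (hbm : ∀ w w', AEStronglyMeasurable (fun t => b t w w') μ) (hM : 0 ≤ M)
    (hbM : ∀ t w w', |b t w w'| ≤ M * ‖w‖ * ‖w'‖) {R : α → W} (hR : MemLp R 2 μ) :
    ∃ ℓ : StrongDual ℝ (Lp W 2 μ), ∀ G, ℓ G = ∫ t, b t (G t) (R t) ∂μ := by
  have hi := fun G : Lp W 2 μ =>
    integrable_form_apply hbm hbM (Lp.memLp G) hR
  let L : Lp W 2 μ →ₗ[ℝ] ℝ :=
    { toFun := fun G => ∫ t, b t (G t) (R t) ∂μ
      map_add' := fun G G' => by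
        rw [← integral_add (hi G) (hi G')]
        refine integral_congr_ae ?_
        filter_upwards [Lp.coeFn_add G G'] with t ht
        rw [ht, Pi.add_apply, map_add, _root_.add_apply]
      map_smul' := fun r G => by
        rw [RingHom.id_apply, ← integral_smul]
        refine integral_congr_ae ?_
        filter_upwards [Lp.coeFn_smul r G] with t ht
        rw [ht, Pi.smul_apply, map_smul, _root_.smul_apply] }
  refine ⟨L.mkContinuous (M * ‖hR.toLp R‖) fun G => ?_, fun G => rfl⟩
  have := abs_integral_form_apply_le hM hbM (Lp.memLp G) hR
  rw [Lp.toLp_coeFn] at this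
  calc ‖L G‖ ≤ M * (‖G‖ * ‖hR.toLp R‖) := this
    _ = _ := by ring

/-- A bounded measurable field of bilinear forms induces a bilinear form on `L²`. -/
theorem exists_integrated_form {b : α → W →L[ℝ] W →L[ℝ] ℝ}
    (hbm : ∀ w w', AEStronglyMeasurable (fun t => b t w w') μ) (hM : 0 ≤ M)
    (hbM : ∀ t w w', |b t w w'| ≤ M * ‖w‖ * ‖w'‖) :
    ∃ B : Lp W 2 μ →L[ℝ] Lp W 2 μ →L[ℝ] ℝ, (∀ G R, |B G R| ≤ M * ‖G‖ * ‖R‖) ∧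
      ∀ G R, B G R = ∫ t, b t (G t) (R t) ∂μ := by
  have hi := fun G R : Lp W 2 μ => integrable_form_apply hbm hbM (Lp.memLp G) (Lp.memLp R)
  let B₀ : Lp W 2 μ →ₗ[ℝ] Lp W 2 μ →ₗ[ℝ] ℝ :=
    LinearMap.mk₂ ℝ (fun G R => ∫ t, b t (G t) (R t) ∂μ)
    (fun G G' R => by
      rw [← integral_add (hi G R) (hi G' R)]
      refine integral_congr_ae ?_
      filter_upwards [Lp.coeFn_add G G'] with t ht
      rw [ht, Pi.add_apply, map_add, _root_.add_apply])
    (fun r G R => by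
      rw [← integral_smul]
      refine integral_congr_ae ?_
      filter_upwards [Lp.coeFn_smul r G] with t ht
      rw [ht, Pi.smul_apply, map_smul, _root_.smul_apply])
    (fun G R R' => by
      rw [← integral_add (hi G R) (hi G R')]
      refine integral_congr_ae ?_
      filter_upwards [Lp.coeFn_add R R'] with t ht
      rw [ht, Pi.add_apply, map_add])
    (fun r G R => by
      rw [← integral_smul]
      refine integral_congr_ae ?_
      filter_upwards [Lp.coeFn_smul r R] with t ht
      rw [ht, Pi.smul_apply, map_smul])
  have hB₀ : ∀ G R, |B₀ G R| ≤ M * ‖G‖ * ‖R‖ := fun G R => by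
    have := abs_integral_form_apply_le hM hbM (Lp.memLp G) (Lp.memLp R)
    rw [Lp.toLp_coeFn, Lp.toLp_coeFn, ← mul_assoc] at this
    exact this
  exact ⟨B₀.mkContinuous₂ M hB₀, hB₀, fun G R => rfl⟩

end Form

/-- Mesh size of the `m`-th time grid. -/
def mesh (m : ℕ) : ℝ := 1 / ((m : ℝ) + 1)

theorem mesh_pos (m : ℕ) : 0 < mesh m := Nat.one_div_pos_of_nat

theorem tendsto_mesh : Tendsto mesh atTop (𝓝 0) := tendsto_one_div_add_atTop_nhds_zero_nat

theorem mesh_le_one (m : ℕ) : mesh m ≤ 1 := by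
  rw [mesh, div_le_one (by positivity)]
  have : (0 : ℝ) ≤ m := m.cast_nonneg
  linarith

theorem tendsto_gridPoint {t₀ t : ℝ} (ht : t₀ ≤ t) :
    Tendsto (fun m => gridPoint t₀ (mesh m) t) atTop (𝓝 t) := by
  refine tendsto_of_tendsto_of_tendsto_of_le_of_le tendsto_const_nhds ?_
    (fun m => le_gridPoint (mesh_pos m) t) (fun m => gridPoint_le (mesh_pos m) ht)
  simpa using tendsto_mesh.const_add t

/-- Uniformly bounded solutions of the time-discretized equations. -/
structure IsApproximation (j : V →L[ℝ] H) (D : V →L[ℝ] W) (b : ℝ → W →L[ℝ] W →L[ℝ] ℝ)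
    (c : ℝ → ℝ) (ψ : H) (Y : Set H) (t₀ h K C : ℝ) (Z : ℝ → V) : Prop where
  meas : StronglyMeasurable Z
  norm_le : ∀ t, ‖j (Z t)‖ ≤ K
  memLp : MemLp (fun t => D (Z t)) 2 volume
  integral_le : ∫ t, ‖D (Z t)‖ ^ 2 ≤ C
  eq_zero : ∀ t ≤ t₀, Z t = 0
  nonneg : ∀ t, ∀ y ∈ Y, 0 ≤ inner ℝ (j (Z t)) y
  weak : ∀ (p : ℝ → V) (q : ℝ → H) (T : ℝ), Continuous q →
    (∀ t, HasDerivAt (fun t => j (p t)) (q t) t) →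
    (∀ t, T ≤ t → p t = 0) → (∀ t, T ≤ t → q t = 0) →
    ∫ t, (-inner ℝ (j (Z t)) (q (t + h)) + b t (D (Z t)) (D (p (gridPoint t₀ h t)))) =
      ∫ t, c t * inner ℝ ψ (j (p (gridPoint t₀ h t)))

/-- The bounds `(∫ c) * ‖ψ‖` and `((∫ c) * ‖ψ‖) ^ 2 / ν` come from the two energy estimates and do
not involve `h`, which is what permits a limit as the mesh shrinks. -/
theorem exists_approximation [CompleteSpace V]
    (hV : ∀ v, ‖v‖ ^ 2 ≤ ‖j v‖ ^ 2 + ‖D v‖ ^ 2)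
    (hν : 0 < ν) (hbm : ∀ w w', AEStronglyMeasurable (fun t => b t w w') volume)
    (hbM : ∀ t w w', |b t w w'| ≤ M * ‖w‖ * ‖w'‖) (hbν : ∀ᵐ t, ∀ w, ν * ‖w‖ ^ 2 ≤ b t w w)
    (hc : Continuous c) (hcs : HasCompactSupport c) (hc0 : ∀ t, 0 ≤ c t)
    {Y : Set H} (hψ : ∀ y ∈ Y, 0 ≤ inner ℝ ψ y)
    (hY : ∀ α β : ℝ, α < β → ∀ (u : V) (g : H), (∀ y ∈ Y, 0 ≤ inner ℝ g y) →
      (∀ v, inner ℝ (j u) (j v) + ∫ t in α..β, b t (D u) (D v) = inner ℝ g (j v)) →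
      ∀ y ∈ Y, 0 ≤ inner ℝ (j u) y)
    {t₀ : ℝ} (hct : ∀ t ≤ t₀, c t = 0) {h : ℝ} (hh : 0 < h) :
    ∃ Z, IsApproximation j D b c ψ Y t₀ h ((∫ t, c t) * ‖ψ‖) (((∫ t, c t) * ‖ψ‖) ^ 2 / ν) Z := by
  have hτs : ∀ k : ℕ, t₀ + k * h < t₀ + (k + 1 : ℕ) * h := fun k => by push_cast; linarith
  have hci : Integrable c := hc.integrable_of_hasCompactSupport hcs
  have hm : ∀ k, ∑ i ∈ Finset.range k, ∫ t in (t₀ + i * h)..(t₀ + (i + 1 : ℕ) * h), c t ≤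
      ∫ t, c t := by
    intro k
    rw [intervalIntegral.sum_integral_adjacent_intervals (a := fun i : ℕ => t₀ + i * h)
      (fun i _ => hc.intervalIntegrable _ _), intervalIntegral.integral_of_le (by
        simp only [CharP.cast_eq_zero, zero_mul, add_zero, le_add_iff_nonneg_right]
        positivity)]
    exact setIntegral_le_integral hci (Eventually.of_forall hc0)
  obtain ⟨u, hu, hpos⟩ := exists_eulerSequence j D hV hν hbm hbM hbν hc0 hψ hY hτs
  have hmeas : StronglyMeasurable fun t => u (gridIndex t₀ h t) :=
    (StronglyMeasurable.of_discrete (f := u)).comp_measurable measurable_gridIndex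
  have hDm : AEStronglyMeasurable (fun t => D (u (gridIndex t₀ h t))) volume :=
    (D.continuous.comp_stronglyMeasurable hmeas).aestronglyMeasurable
  have hsum := hu.sum_norm_sq_le hν.le hbm hbM hbν hc0 hτs hm
  have hlin : ∫⁻ t, ENNReal.ofReal (‖D (u (gridIndex t₀ h t))‖ ^ 2) ≤
      ENNReal.ofReal (((∫ t, c t) * ‖ψ‖) ^ 2 / ν) := by
    refine lintegral_gridIndex_le hh (fun k => ‖D (u k)‖ ^ 2) (fun k => sq_nonneg _)
      (by simp [hu.zero]) fun N => ?_
    rw [le_div_iff₀ hν, Finset.sum_mul]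
    refine le_trans (le_of_eq (Finset.sum_congr rfl fun k _ => ?_)) (hsum N)
    push_cast
    ring
  have hint : Integrable fun t => ‖D (u (gridIndex t₀ h t))‖ ^ 2 := by
    refine ⟨hDm.norm.pow 2, ?_⟩
    rw [hasFiniteIntegral_iff_ofReal (Eventually.of_forall fun t => sq_nonneg _)]
    exact hlin.trans_lt ENNReal.ofReal_lt_top
  refine ⟨fun t => u (gridIndex t₀ h t), hmeas, fun t => ?_,
    (memLp_two_iff_integrable_sq_norm hDm).2 hint, ?_, fun t ht => ?_, fun t => hpos _,
    fun p q T hq hpq hpT hqT => hu.integral_eq hh hbm hbM hc hct hq hpq hpT hqT⟩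
  · exact (hu.norm_le hν.le hbm hbM hbν hc0 hτs _).trans (by gcongr; exact hm _)
  · rw [integral_eq_lintegral_of_nonneg_ae (Eventually.of_forall fun t => sq_nonneg _) hint.1]
    exact ENNReal.toReal_le_of_le_ofReal (by positivity) hlin
  · simp [gridIndex_of_le hh ht, hu.zero]

end Limit

/-! ### Weak limits of the approximations -/

section WeakSolution

/-- The weight in time used to make bounded functions square integrable. -/
def timeWeight (t : ℝ) : ℝ := (1 + t ^ 2)⁻¹

theorem timeWeight_pos (t : ℝ) : 0 < timeWeight t := by
  have : 0 < 1 + t ^ 2 := by positivity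
  exact inv_pos.2 this

theorem timeWeight_le_one (t : ℝ) : timeWeight t ≤ 1 :=
  inv_le_one_of_one_le₀ (by nlinarith [sq_nonneg t])

theorem continuous_timeWeight : Continuous timeWeight := by
  refine Continuous.inv₀ (by fun_prop) fun t => ?_
  positivity

theorem continuous_inv_timeWeight : Continuous fun t => (timeWeight t)⁻¹ :=
  continuous_timeWeight.inv₀ fun t => (timeWeight_pos t).ne'

theorem memLp_timeWeight : MemLp timeWeight 2 (volume : Measure ℝ) := by
  rw [memLp_two_iff_integrable_sq_norm continuous_timeWeight.aestronglyMeasurable]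
  have h0 : Integrable timeWeight (volume : Measure ℝ) := integrable_inv_one_add_sq
  refine h0.mono'
    (continuous_timeWeight.norm.pow 2).aestronglyMeasurable (Eventually.of_forall fun t => ?_)
  have h1 := timeWeight_pos t
  have h2 := timeWeight_le_one t
  rw [norm_pow, norm_norm, Real.norm_of_nonneg h1.le]
  nlinarith

variable {H W V : Type*} [NormedAddCommGroup H] [InnerProductSpace ℝ H]
  [NormedAddCommGroup W] [InnerProductSpace ℝ W]
  [NormedAddCommGroup V] [InnerProductSpace ℝ V]
  {j : V →L[ℝ] H} {D : V →L[ℝ] W} {b : ℝ → W →L[ℝ] W →L[ℝ] ℝ} {M ν : ℝ}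
  {c : ℝ → ℝ} {ψ : H} {Y : Set H} {t₀ K C : ℝ}

theorem memLp_timeWeight_smul {E : Type*} [NormedAddCommGroup E] [NormedSpace ℝ E] {f : ℝ → E}
    (hf : MemLp f 2 volume) : MemLp (fun t => timeWeight t • f t) 2 volume := by
  refine hf.of_le (continuous_timeWeight.aestronglyMeasurable.smul hf.1)
    (Eventually.of_forall fun t => ?_)
  rw [norm_smul, Real.norm_of_nonneg (timeWeight_pos t).le]
  exact mul_le_of_le_one_left (norm_nonneg _) (timeWeight_le_one t)

/-- The values of `j ∘ Z` are only bounded in time, without decay at infinity; the weight places `Z`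
in a fixed ball of the Hilbert space `L²(ℝ; V)`, where weak limits exist. -/
theorem IsApproximation.norm_weighted_le {h : ℝ} {Z : ℝ → V}
    (hV : ∀ v, ‖v‖ ^ 2 ≤ ‖j v‖ ^ 2 + ‖D v‖ ^ 2)
    (hZ : IsApproximation j D b c ψ Y t₀ h K C Z) :
    ∃ hm : MemLp (fun t => timeWeight t • Z t) 2 volume,
      ‖hm.toLp _‖ ^ 2 ≤ K ^ 2 * (∫ t, ‖timeWeight t‖ ^ 2) + C := by
  have hmeas : AEStronglyMeasurable (fun t => timeWeight t • Z t) volume :=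
    continuous_timeWeight.aestronglyMeasurable.smul hZ.meas.aestronglyMeasurable
  have hw := (memLp_two_iff_integrable_sq_norm
    continuous_timeWeight.aestronglyMeasurable).1 memLp_timeWeight
  have hD := (memLp_two_iff_integrable_sq_norm hZ.memLp.1).1 hZ.memLp
  have hle : ∀ t, ‖timeWeight t • Z t‖ ^ 2 ≤
      K ^ 2 * ‖timeWeight t‖ ^ 2 + ‖D (Z t)‖ ^ 2 := by
    intro t
    have h1 : ‖timeWeight t‖ ^ 2 ≤ 1 := by
      rw [Real.norm_of_nonneg (timeWeight_pos t).le]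
      exact pow_le_one₀ (timeWeight_pos t).le (timeWeight_le_one t)
    have h2 : ‖j (Z t)‖ ^ 2 ≤ K ^ 2 := pow_le_pow_left₀ (norm_nonneg _) (hZ.norm_le t) 2
    rw [norm_smul, mul_pow]
    calc ‖timeWeight t‖ ^ 2 * ‖Z t‖ ^ 2
        ≤ ‖timeWeight t‖ ^ 2 * (‖j (Z t)‖ ^ 2 + ‖D (Z t)‖ ^ 2) := by gcongr; exact hV _
      _ ≤ K ^ 2 * ‖timeWeight t‖ ^ 2 + ‖D (Z t)‖ ^ 2 := by
        nlinarith [sq_nonneg ‖timeWeight t‖, sq_nonneg ‖D (Z t)‖]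
  have hint : Integrable fun t => K ^ 2 * ‖timeWeight t‖ ^ 2 + ‖D (Z t)‖ ^ 2 :=
    (hw.const_mul _).add hD
  have hsq : Integrable fun t => ‖timeWeight t • Z t‖ ^ 2 :=
    hint.mono' (hmeas.norm.pow 2) (Eventually.of_forall fun t => by
      rw [Real.norm_of_nonneg (sq_nonneg _)]
      exact hle t)
  refine ⟨(memLp_two_iff_integrable_sq_norm hmeas).2 hsq, ?_⟩
  rw [norm_toLp_sq]
  refine (integral_mono hsq hint hle).trans ?_
  rw [integral_add (hw.const_mul _) hD, integral_const_mul]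
  exact add_le_add le_rfl hZ.integral_le

/-- Two weak limits are taken, of the weighted functions and of the unweighted gradients. They match
because `D` commutes with the scalar weight and multiplication by it is symmetric on `L²`. The
unweighted limit is what keeps the gradient globally square integrable. -/
theorem weak_limit_gradient [CompleteSpace W] [CompleteSpace V] {U : Filter ℕ} [U.NeBot]
    {Z : ℕ → ℝ → V}
    (hZ : ∀ m, MemLp (fun t => timeWeight t • Z m t) 2 volume)
    (hG : ∀ m, MemLp (fun t => D (Z m t)) 2 volume)
    {ζ : Lp V 2 (volume : Measure ℝ)} {g : Lp W 2 (volume : Measure ℝ)}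
    (hζ : ∀ ℓ : StrongDual ℝ (Lp V 2 (volume : Measure ℝ)),
      Tendsto (fun m => ℓ ((hZ m).toLp _)) U (𝓝 (ℓ ζ)))
    (hg : ∀ ℓ : StrongDual ℝ (Lp W 2 (volume : Measure ℝ)),
      Tendsto (fun m => ℓ ((hG m).toLp _)) U (𝓝 (ℓ g))) :
    ∀ᵐ t, D (ζ t) = timeWeight t • g t := by
  let DL := D.compLpL 2 (volume : Measure ℝ)
  have hwg := memLp_timeWeight_smul (Lp.memLp g)
  have key : DL ζ = hwg.toLp _ := by
    refine ext_inner_left ℝ fun y => ?_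
    have hwy := memLp_timeWeight_smul (Lp.memLp y)
    have h1 := hζ ((innerSL ℝ y).comp DL)
    have h2 := hg (innerSL ℝ (hwy.toLp _))
    have h3 : (fun m => ((innerSL ℝ y).comp DL) ((hZ m).toLp _)) =
        fun m => (innerSL ℝ (hwy.toLp _)) ((hG m).toLp _) := by
      funext m
      change inner ℝ y (DL ((hZ m).toLp _)) = inner ℝ (hwy.toLp _) ((hG m).toLp _)
      rw [L2.inner_def, L2.inner_def]
      refine integral_congr_ae ?_
      filter_upwards [D.coeFn_compLpL ((hZ m).toLp _), (hZ m).coeFn_toLp, (hG m).coeFn_toLp,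
        hwy.coeFn_toLp] with t e1 e2 e3 e4
      rw [e1, e2, e3, e4, map_smul, real_inner_smul_left, real_inner_smul_right]
    rw [h3] at h1
    have h4 := tendsto_nhds_unique h1 h2
    change inner ℝ y (DL ζ) = inner ℝ (hwy.toLp _) g at h4
    rw [h4, L2.inner_def, L2.inner_def]
    refine integral_congr_ae ?_
    filter_upwards [hwg.coeFn_toLp, hwy.coeFn_toLp] with t e1 e2
    rw [e1, e2, real_inner_smul_left, real_inner_smul_right]
  filter_upwards [D.coeFn_compLpL ζ, hwg.coeFn_toLp] with t e1 e2
  rw [← e1, ← e2]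
  change (DL ζ) t = _
  rw [key]

/-- Pairing with `1_s ⊗ j* y` for sets `s` of finite measure makes nonnegativity a family of weakly
closed conditions. -/
theorem weak_limit_nonneg [CompleteSpace H] [CompleteSpace V] {U : Filter ℕ} [U.NeBot]
    {Z : ℕ → ℝ → V}
    (hZ : ∀ m, MemLp (fun t => timeWeight t • Z m t) 2 volume)
    {ζ : Lp V 2 (volume : Measure ℝ)}
    (hζ : ∀ ℓ : StrongDual ℝ (Lp V 2 (volume : Measure ℝ)),
      Tendsto (fun m => ℓ ((hZ m).toLp _)) U (𝓝 (ℓ ζ)))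
    {y : H} (hy : ∀ m t, 0 ≤ inner ℝ (j (Z m t)) y) :
    ∀ᵐ t, 0 ≤ inner ℝ (j (ζ t)) y := by
  have hmem : MemLp (fun t => inner ℝ (j (ζ t)) y) 2 (volume : Measure ℝ) :=
    ((innerSL ℝ y).comp j).comp_memLp' (Lp.memLp ζ) |>.congr_norm
      ((j.continuous.comp_aestronglyMeasurable (Lp.memLp ζ).1).inner aestronglyMeasurable_const)
      (Eventually.of_forall fun t => by simp [real_inner_comm])
  refine ae_nonneg_of_forall_setIntegral_nonneg_of_sigmaFinite (fun s hs hμ => ?_)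
    fun s hs hμ => ?_
  · have : Fact (volume s < ∞) := ⟨hμ⟩
    exact (hmem.restrict s).integrable (by norm_num)
  · let e := indicatorConstLp 2 hs hμ.ne (j.adjoint y)
    have h1 := hζ (innerSL ℝ e)
    have h2 : ∀ f : Lp V 2 (volume : Measure ℝ),
        innerSL ℝ e f = ∫ t in s, inner ℝ (j (f t)) y := by
      intro f
      rw [innerSL_apply_apply, L2.inner_indicatorConstLp_eq_setIntegral_inner]
      refine integral_congr_ae (Eventually.of_forall fun t => ?_)
      simp only [ContinuousLinearMap.adjoint_inner_left, real_inner_comm]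
    rw [← h2]
    refine ge_of_tendsto' h1 fun m => ?_
    rw [h2]
    refine integral_nonneg_of_ae (ae_restrict_of_ae ?_)
    filter_upwards [(hZ m).coeFn_toLp] with t ht
    rw [ht, map_smul, real_inner_smul_left]
    exact mul_nonneg (timeWeight_pos t).le (hy m t)

end WeakSolution

/-! ### Passage to the limit in the discrete equation -/

section Existence

variable {H W V : Type*} [NormedAddCommGroup H] [InnerProductSpace ℝ H]
  [NormedAddCommGroup W] [InnerProductSpace ℝ W]
  [NormedAddCommGroup V] [InnerProductSpace ℝ V]
  {j : V →L[ℝ] H} {D : V →L[ℝ] W} {b : ℝ → W →L[ℝ] W →L[ℝ] ℝ} {M ν : ℝ}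
  {c : ℝ → ℝ} {ψ : H} {Y : Set H} {t₀ K C : ℝ}

theorem exists_forall_eq_zero_of_le_abs {E : Type*} [Zero E] {p : ℝ → E}
    (hp : HasCompactSupport p) : ∃ T : ℝ, 0 < T ∧ ∀ t, T ≤ |t| → p t = 0 := by
  obtain ⟨R, hR⟩ := hp.isCompact.isBounded.subset_ball (0 : ℝ)
  refine ⟨max R 1, lt_max_of_lt_right one_pos, fun t ht => ?_⟩
  by_contra hne
  have := hR (subset_tsupport p hne)
  rw [mem_ball_zero_iff, Real.norm_eq_abs] at this
  exact absurd this (not_lt.2 ((le_max_left _ _).trans ht))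

theorem tendsto_integral_gridPoint (hc : Continuous c) (hci : Integrable c)
    (hct : ∀ t ≤ t₀, c t = 0) {r : ℝ → ℝ} (hr : Continuous r) (hrs : HasCompactSupport r) :
    Tendsto (fun m => ∫ t, c t * r (gridPoint t₀ (mesh m) t)) atTop (𝓝 (∫ t, c t * r t)) := by
  obtain ⟨A, hA⟩ := hrs.exists_bound_of_continuous hr
  refine tendsto_integral_of_dominated_convergence (fun t => ‖c t‖ * A) (fun m => ?_)
    (hci.norm.mul_const A) (fun m => Eventually.of_forall fun t => ?_)
    (Eventually.of_forall fun t => ?_)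
  · exact hc.aestronglyMeasurable.mul
      (hr.measurable.comp measurable_gridPoint).aestronglyMeasurable
  · rw [norm_mul]
    gcongr
    exact hA _
  · rcases le_or_gt t t₀ with h | h
    · simp [hct t h]
    · exact ((hr.tendsto t).comp (tendsto_gridPoint h.le)).const_mul (c t)

/-- No convergence of `Z m` is used: the uniform bound `K` suffices, since `q (t + mesh m) - q t`
tends to zero pointwise, with supports in `[-T - 1, T]` because the mesh is at most one. -/
theorem tendsto_integral_shift {Z : ℕ → ℝ → V} (hZm : ∀ m, StronglyMeasurable (Z m))
    (hZK : ∀ m t, ‖j (Z m t)‖ ≤ K) {q : ℝ → H} (hq : Continuous q) (hqs : HasCompactSupport q) :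
    Tendsto (fun m => ∫ t, inner ℝ (j (Z m t)) (q (t + mesh m) - q t)) atTop (𝓝 0) := by
  obtain ⟨A, hA⟩ := hqs.exists_bound_of_continuous hq
  obtain ⟨T, hT, hqT⟩ := exists_forall_eq_zero_of_le_abs hqs
  have hK : 0 ≤ K := (norm_nonneg _).trans (hZK 0 0)
  have hA0 : 0 ≤ A := (norm_nonneg _).trans (hA 0)
  rw [show (0 : ℝ) = ∫ _ : ℝ, (0 : ℝ) by simp]
  refine tendsto_integral_of_dominated_convergence
    ((Icc (-T - 1) T).indicator fun _ => K * (A + A)) (fun m => ?_)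
    ((integrable_indicator_iff measurableSet_Icc).2 (integrableOn_const (by simp)))
    (fun m => Eventually.of_forall fun t => ?_) (Eventually.of_forall fun t => ?_)
  · exact ((j.continuous.comp_stronglyMeasurable (hZm m)).aestronglyMeasurable).inner
      (Continuous.aestronglyMeasurable (by fun_prop))
  · by_cases ht : t ∈ Icc (-T - 1) T
    · rw [indicator_of_mem ht]
      refine (norm_inner_le_norm _ _).trans ?_
      gcongr
      · exact hZK m t
      · exact (norm_sub_le _ _).trans (add_le_add (hA _) (hA _))
    · rw [indicator_of_notMem ht]
      have h1 := mesh_pos m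
      have h2 := mesh_le_one m
      have h3 : T ≤ |t| ∧ T ≤ |t + mesh m| := by
        rw [mem_Icc, not_and_or, not_le, not_le] at ht
        rcases ht with ht | ht
        · exact ⟨le_abs.2 (Or.inr (by linarith)), le_abs.2 (Or.inr (by linarith))⟩
        · exact ⟨le_abs.2 (Or.inl (by linarith)), le_abs.2 (Or.inl (by linarith))⟩
      simp [hqT _ h3.1, hqT _ h3.2]
  · have h1 : Tendsto (fun m => K * ‖q (t + mesh m) - q t‖) atTop (𝓝 0) := by
      have h2 : Tendsto (fun m => t + mesh m) atTop (𝓝 t) := by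
        simpa using tendsto_mesh.const_add t
      have h3 := (((hq.tendsto t).comp h2).sub_const (q t)).norm.const_mul K
      simpa using h3
    refine squeeze_zero_norm (fun m => ?_) h1
    refine (norm_inner_le_norm _ _).trans ?_
    gcongr
    exact hZK m t

/-- The error made when a test curve is frozen at the grid points tends to zero. -/
theorem tendsto_norm_grid_error {r : ℝ → W} (hr : Continuous r) (hrs : HasCompactSupport r) :
    ∃ hm : ∀ m, MemLp ((Ioi t₀).indicator fun t => r (gridPoint t₀ (mesh m) t) - r t) 2 volume,
      Tendsto (fun m => ‖(hm m).toLp _‖) atTop (𝓝 0) := by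
  obtain ⟨A, hA⟩ := hrs.exists_bound_of_continuous hr
  obtain ⟨T, hT, hrT⟩ := exists_forall_eq_zero_of_le_abs hrs
  have hA0 : 0 ≤ A := (norm_nonneg _).trans (hA 0)
  -- The cutoff is needed since for `t ≤ t₀` the grid point is `t₀` for every mesh, so the error
  -- need not vanish there. It costs nothing: the approximations are zero up to `t₀`.
  set e : ℕ → ℝ → W := fun m =>
    (Ioi t₀).indicator fun t => r (gridPoint t₀ (mesh m) t) - r t with he
  have hmeas : ∀ m, AEStronglyMeasurable (e m) volume := fun m =>
    ((hr.stronglyMeasurable.comp_measurable measurable_gridPoint).aestronglyMeasurable.sub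
      hr.aestronglyMeasurable).indicator measurableSet_Ioi
  have hbd : ∀ m t, ‖‖e m t‖ ^ 2‖ ≤ (Icc t₀ T).indicator (fun _ => (A + A) ^ 2) t := by
    intro m t
    rw [norm_pow, norm_norm]
    by_cases ht : t ∈ Icc t₀ T
    · rw [indicator_of_mem ht]
      gcongr
      rw [he]
      refine (norm_indicator_le_norm_self _ _).trans ?_
      exact (norm_sub_le _ _).trans (add_le_add (hA _) (hA _))
    · rw [indicator_of_notMem ht]
      have : e m t = 0 := by
        by_cases h : t ∈ Ioi t₀
        · have h1 : T < t := by
            by_contra hcon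
            exact ht ⟨(mem_Ioi.1 h).le, not_lt.1 hcon⟩
          have h2 := le_gridPoint (t₀ := t₀) (mesh_pos m) t
          simp only [he, indicator_of_mem h]
          rw [hrT t (le_abs.2 (Or.inl h1.le)),
            hrT (gridPoint t₀ (mesh m) t) (le_abs.2 (Or.inl (h1.le.trans h2))), sub_zero]
        · exact indicator_of_notMem h _
      simp [this]
  have hbi : Integrable ((Icc t₀ T).indicator fun _ => (A + A) ^ 2) (volume : Measure ℝ) :=
    (integrable_indicator_iff measurableSet_Icc).2 (integrableOn_const (by simp))
  have hm : ∀ m, MemLp (e m) 2 volume := fun m =>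
    (memLp_two_iff_integrable_sq_norm (hmeas m)).2
      (hbi.mono' ((hmeas m).norm.pow 2) (Eventually.of_forall (hbd m)))
  refine ⟨hm, ?_⟩
  have hsq : Tendsto (fun m => ‖(hm m).toLp _‖ ^ 2) atTop (𝓝 0) := by
    simp only [norm_toLp_sq]
    rw [show (0 : ℝ) = ∫ _ : ℝ, (0 : ℝ) by simp]
    refine tendsto_integral_of_dominated_convergence _ (fun m => (hmeas m).norm.pow 2) hbi
      (fun m => Eventually.of_forall (hbd m)) (Eventually.of_forall fun t => ?_)
    by_cases h : t ∈ Ioi t₀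
    · simp only [he, indicator_of_mem h]
      have h1 := (((hr.tendsto t).comp (tendsto_gridPoint (mem_Ioi.1 h).le)).sub_const
        (r t)).norm.pow 2
      simpa using h1
    · simp only [he, indicator_of_notMem h]
      simp
  have := (Real.continuous_sqrt.tendsto 0).comp hsq
  simpa [Function.comp_def, Real.sqrt_sq] using this

/-- Existence of a weak solution of an abstract parabolic equation with right-hand side `c ⊗ ψ`,
in a cone that is preserved by the implicit Euler steps. -/
theorem exists_weak_solution [CompleteSpace H] [CompleteSpace W] [CompleteSpace V]
    (hV : ∀ v, ‖v‖ ^ 2 ≤ ‖j v‖ ^ 2 + ‖D v‖ ^ 2)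
    (hM : 0 ≤ M) (hν : 0 < ν) (hbm : ∀ w w', AEStronglyMeasurable (fun t => b t w w') volume)
    (hbM : ∀ t w w', |b t w w'| ≤ M * ‖w‖ * ‖w'‖) (hbν : ∀ᵐ t, ∀ w, ν * ‖w‖ ^ 2 ≤ b t w w)
    (hc : Continuous c) (hcs : HasCompactSupport c) (hc0 : ∀ t, 0 ≤ c t)
    (hψ : ∀ y ∈ Y, 0 ≤ inner ℝ ψ y)
    (hY : ∀ α β : ℝ, α < β → ∀ (u : V) (g : H), (∀ y ∈ Y, 0 ≤ inner ℝ g y) →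
      (∀ v, inner ℝ (j u) (j v) + ∫ t in α..β, b t (D u) (D v) = inner ℝ g (j v)) →
      ∀ y ∈ Y, 0 ≤ inner ℝ (j u) y) :
    ∃ z : ℝ → V, LocallyIntegrable z volume ∧ MemLp (fun t => D (z t)) 2 volume ∧
      (∀ y ∈ Y, ∀ᵐ t, 0 ≤ inner ℝ (j (z t)) y) ∧
      ∀ (p : ℝ → V) (q : ℝ → H), Continuous p → HasCompactSupport p → Continuous q →
        HasCompactSupport q → (∀ t, HasDerivAt (fun t => j (p t)) (q t) t) →
        Integrable (fun t => -inner ℝ (j (z t)) (q t) + b t (D (z t)) (D (p t))) ∧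
        ∫ t, (-inner ℝ (j (z t)) (q t) + b t (D (z t)) (D (p t))) =
          ∫ t, c t * inner ℝ ψ (j (p t)) := by
  obtain ⟨T₀, hT₀, hcT⟩ := exists_forall_eq_zero_of_le_abs hcs
  have hct : ∀ t ≤ -T₀, c t = 0 := fun t ht => hcT t (le_abs.2 (Or.inr (by linarith)))
  have happ := fun m => exists_approximation hV hν hbm hbM hbν hc hcs hc0 hψ hY hct (mesh_pos m)
  set K := (∫ t, c t) * ‖ψ‖
  set C := K ^ 2 / ν
  choose Z hZ using happ
  choose hZw hZwn using fun m => (hZ m).norm_weighted_le hV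
  -- One free ultrafilter serves both weak limits, so no common subsequence has to be extracted.
  obtain ⟨ζ, hζ⟩ := exists_weak_limit_of_bounded (fun m => Real.le_sqrt_of_sq_le (hZwn m))
    (hyperfilter ℕ)
  have hGn : ∀ m, ‖(hZ m).memLp.toLp _‖ ≤ √C := fun m =>
    Real.le_sqrt_of_sq_le (by rw [norm_toLp_sq]; exact (hZ m).integral_le)
  obtain ⟨g, hg⟩ := exists_weak_limit_of_bounded hGn (hyperfilter ℕ)
  have hDζ := weak_limit_gradient (D := D) hZw (fun m => (hZ m).memLp) hζ hg
  -- The weight is removed again. Its inverse is continuous, so `z` is still locally integrable, and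
  -- `D (z t)` is the unweighted limit `g`.
  set z : ℝ → V := fun t => (timeWeight t)⁻¹ • ζ t with hz
  have hζz : ∀ t, ζ t = timeWeight t • z t := fun t => by
    rw [hz, smul_inv_smul₀ (timeWeight_pos t).ne']
  have hDz : ∀ᵐ t, D (z t) = g t := by
    filter_upwards [hDζ] with t ht
    rw [hz, map_smul, ht, inv_smul_smul₀ (timeWeight_pos t).ne']
  have hDzm : MemLp (fun t => D (z t)) 2 volume :=
    (memLp_congr_ae hDz).2 (Lp.memLp g)
  have hzli : LocallyIntegrable z volume :=
    ((Lp.memLp ζ).locallyIntegrable (by norm_num)).continuous_smul continuous_inv_timeWeight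
  refine ⟨z, hzli, hDzm, fun y hy => ?_, fun p q hp hps hq hqs hpq => ?_⟩
  · filter_upwards [weak_limit_nonneg hZw hζ fun m t => (hZ m).nonneg t y hy] with t ht
    rw [hz, map_smul, real_inner_smul_left]
    exact mul_nonneg (inv_nonneg.2 (timeWeight_pos t).le) ht
  have hr : Continuous fun t => D (p t) := by fun_prop
  have hrs : HasCompactSupport fun t => D (p t) := hps.comp_left (map_zero D)
  have hrm : MemLp (fun t => D (p t)) 2 volume := hr.memLp_of_hasCompactSupport hrs
  -- the functional acting on the time-weighted function
  set Q : ℝ → V := fun t => (timeWeight t)⁻¹ • j.adjoint (q t) with hQ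
  have hQm : MemLp Q 2 volume := by
    refine Continuous.memLp_of_hasCompactSupport ?_ ?_
    · exact continuous_inv_timeWeight.smul (by fun_prop)
    · exact (hqs.comp_left (g := j.adjoint) (map_zero _)).smul_left
  have hQz : ∀ f : ℝ → V, ∀ t,
      inner ℝ (Q t) (timeWeight t • f t) = inner ℝ (j (f t)) (q t) := by
    intro f t
    rw [hQ, real_inner_smul_left, real_inner_smul_right, ← mul_assoc,
      inv_mul_cancel₀ (timeWeight_pos t).ne', one_mul, ContinuousLinearMap.adjoint_inner_left,
      real_inner_comm]
  have hQi : ∀ f : ℝ → V, MemLp (fun t => timeWeight t • f t) 2 volume →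
      Integrable fun t => inner ℝ (j (f t)) (q t) := by
    intro f hf
    have h1 := L2.integrable_inner (𝕜 := ℝ) (hQm.toLp _) (hf.toLp _)
    refine h1.congr ?_
    filter_upwards [hQm.coeFn_toLp, hf.coeFn_toLp] with t e1 e2
    rw [e1, e2, hQz f t]
  have hQint : ∀ f : ℝ → V, ∀ hf : MemLp (fun t => timeWeight t • f t) 2 volume,
      innerSL ℝ (hQm.toLp _) (hf.toLp _) = ∫ t, inner ℝ (j (f t)) (q t) := by
    intro f hf
    rw [innerSL_apply_apply, L2.inner_def]
    refine integral_congr_ae ?_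
    filter_upwards [hQm.coeFn_toLp, hf.coeFn_toLp] with t e1 e2
    rw [e1, e2, hQz f t]
  have hzw : MemLp (fun t => timeWeight t • z t) 2 volume :=
    (Lp.memLp ζ).congr_norm (by
      simpa only [← hζz] using (Lp.memLp ζ).1) (Eventually.of_forall fun t => by rw [hζz])
  have hζe : ζ = hzw.toLp _ := by
    refine Lp.ext ?_
    filter_upwards [hzw.coeFn_toLp] with t ht
    rw [ht, hζz]
  have hbi := integrable_form_apply hbm hbM hDzm hrm
  have hQn : Integrable fun t => -inner ℝ (j (z t)) (q t) := (hQi z hzw).neg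
  refine ⟨hQn.add hbi, ?_⟩
  rw [integral_add hQn hbi, integral_neg]
  have hU := Nat.hyperfilter_le_atTop
  -- first term
  have lim1 : Tendsto (fun m => ∫ t, inner ℝ (j (Z m t)) (q t)) (hyperfilter ℕ)
      (𝓝 (∫ t, inner ℝ (j (z t)) (q t))) := by
    have := hζ (innerSL ℝ (hQm.toLp _))
    rw [hζe, hQint z hzw] at this
    simpa only [hQint] using this
  have lim1e := (tendsto_integral_shift (K := K) (fun m => (hZ m).meas)
    (fun m => (hZ m).norm_le) hq hqs).mono_left hU
  -- second term
  obtain ⟨ℓ, hℓ⟩ := exists_form_functional hbm hM hbM hrm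
  have lim2 : Tendsto (fun m => ∫ t, b t (D (Z m t)) (D (p t))) (hyperfilter ℕ)
      (𝓝 (∫ t, b t (D (z t)) (D (p t)))) := by
    have h1 := hg ℓ
    simp only [hℓ] at h1
    have h2 : ∫ t, b t (g t) (D (p t)) = ∫ t, b t (D (z t)) (D (p t)) :=
      integral_congr_ae (hDz.mono fun t ht => by simp only [ht])
    rw [h2] at h1
    refine h1.congr fun m => integral_congr_ae ?_
    filter_upwards [(hZ m).memLp.coeFn_toLp] with t ht
    rw [ht]
  obtain ⟨hem, het⟩ := tendsto_norm_grid_error (t₀ := -T₀) hr hrs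
  set e : ℕ → ℝ → W := fun m => (Ioi (-T₀)).indicator fun t =>
    D (p (gridPoint (-T₀) (mesh m) t)) - D (p t) with he
  have lim2e : Tendsto (fun m => ∫ t, b t (D (Z m t)) (e m t)) (hyperfilter ℕ) (𝓝 0) := by
    refine squeeze_zero_norm (a := fun m => M * (√C * ‖(hem m).toLp _‖)) (fun m => ?_) ?_
    · refine (abs_integral_form_apply_le hM hbM (hZ m).memLp (hem m)).trans ?_
      gcongr
      exact hGn m
    · simpa using ((het.const_mul √C).const_mul M).mono_left hU
  -- right-hand side
  have lim3 := (tendsto_integral_gridPoint (t₀ := -T₀) (r := fun t => inner ℝ ψ (j (p t))) hc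
    (hc.integrable_of_hasCompactSupport hcs) hct (by fun_prop)
    (hps.comp_left (g := fun v => inner ℝ ψ (j v)) (by simp))).mono_left hU
  obtain ⟨T₁, -, hT₁⟩ := exists_forall_eq_zero_of_le_abs hps
  obtain ⟨T₂, -, hT₂⟩ := exists_forall_eq_zero_of_le_abs hqs
  -- The discrete equation, split into terms with fixed test curves, which converge weakly, and the
  -- errors due to the shift and to freezing at grid points, which tend to zero.
  have heq : ∀ m, -((∫ t, inner ℝ (j (Z m t)) (q t)) +
      ∫ t, inner ℝ (j (Z m t)) (q (t + mesh m) - q t)) +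
      ((∫ t, b t (D (Z m t)) (D (p t))) + ∫ t, b t (D (Z m t)) (e m t)) =
      ∫ t, c t * inner ℝ ψ (j (p (gridPoint (-T₀) (mesh m) t))) := by
    intro m
    have hi1 := hQi (Z m) (hZw m)
    have hi2 : Integrable fun t => inner ℝ (j (Z m t)) (q (t + mesh m) - q t) := by
      have hc1 : Continuous fun t => q (t + mesh m) - q t := by fun_prop
      have hc2 : HasCompactSupport fun t => q (t + mesh m) - q t :=
        (hqs.comp_homeomorph (Homeomorph.addRight (mesh m))).sub hqs
      refine ((hc1.integrable_of_hasCompactSupport hc2).norm.const_mul K).mono' ?_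
        (Eventually.of_forall fun t => ?_)
      · exact ((j.continuous.comp_stronglyMeasurable (hZ m).meas).aestronglyMeasurable).inner
          hc1.aestronglyMeasurable
      · refine (norm_inner_le_norm _ _).trans ?_
        gcongr
        exact (hZ m).norm_le t
    have hi3 := integrable_form_apply hbm hbM (hZ m).memLp hrm
    have hi4 := integrable_form_apply hbm hbM (hZ m).memLp (hem m)
    have hi5 : Integrable fun t => -(inner ℝ (j (Z m t)) (q t) +
        inner ℝ (j (Z m t)) (q (t + mesh m) - q t)) := (hi1.add hi2).neg
    have hi6 : Integrable fun t => b t (D (Z m t)) (D (p t)) + b t (D (Z m t)) (e m t) :=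
      hi3.add hi4
    rw [← (hZ m).weak p q (max T₁ T₂) hq hpq
      (fun t ht => hT₁ t (le_abs.2 (Or.inl ((le_max_left _ _).trans ht))))
      (fun t ht => hT₂ t (le_abs.2 (Or.inl ((le_max_right _ _).trans ht)))),
      ← integral_add hi1 hi2, ← integral_add hi3 hi4, ← integral_neg,
      ← integral_add hi5 hi6]
    refine integral_congr_ae (Eventually.of_forall fun t => ?_)
    simp only
    rw [← inner_add_right, add_sub_cancel, ← map_add]
    by_cases ht : t ∈ Ioi (-T₀)
    · simp only [he, indicator_of_mem ht, add_sub_cancel]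
    · simp [(hZ m).eq_zero t (not_lt.1 ht)]
  have hlim := ((lim1.add lim1e).neg.add (lim2.add lim2e)).congr heq
  have := tendsto_nhds_unique hlim lim3
  simpa using this

end Existence

/-! ### Local integrability of the weight and its inverse -/

section Weight

variable {n : ℕ} {ω : Space n → ℝ}

theorem isCompact_cube (a : Space n) (r : ℝ) : IsCompact (cube a r) := by
  have h : cube a r = (EuclideanSpace.equiv (Fin n) ℝ).toHomeomorph ⁻¹'
      (Set.pi univ fun i => Icc (a i) (a i + r)) := by
    ext x
    simp only [cube, mem_ofPred_eq, mem_preimage, mem_univ_pi]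
    rfl
  rw [h, Homeomorph.isCompact_preimage]
  exact isCompact_univ_pi fun i => isCompact_Icc

theorem volume_cube_pos (a : Space n) {r : ℝ} (hr : 0 < r) : 0 < volume (cube a r) := by
  let x₀ : Space n := WithLp.toLp 2 fun i => a i + r / 2
  refine (Metric.measure_ball_pos volume x₀ (half_pos hr)).trans_le (measure_mono fun x hx i => ?_)
  have h1 : |x i - x₀ i| ≤ ‖x - x₀‖ := by simpa using PiLp.norm_apply_le (x - x₀) i
  rw [mem_ball_iff_norm] at hx
  have h2 : x₀ i = a i + r / 2 := rfl
  have h3 := abs_le.1 (h1.trans hx.le)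
  rw [h2] at h3
  constructor <;> linarith [h3.1, h3.2]

theorem exists_subset_cube {s : Set (Space n)} (hs : IsCompact s) :
    ∃ (a : Space n) (r : ℝ), 0 < r ∧ s ⊆ cube a r := by
  obtain ⟨R, hR⟩ := hs.isBounded.subset_ball (0 : Space n)
  refine ⟨WithLp.toLp 2 fun _ => -max R 1, 2 * max R 1, by positivity, fun x hx i => ?_⟩
  have h1 : |x i| ≤ ‖x‖ := by simpa using PiLp.norm_apply_le x i
  have h2 := hR hx
  rw [mem_ball_zero_iff] at h2
  have h3 := abs_le.1 (h1.trans (h2.le.trans (le_max_left R 1)))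
  change -max R 1 ≤ x i ∧ x i ≤ -max R 1 + 2 * max R 1
  constructor <;> linarith [h3.1, h3.2]

theorem setLIntegral_cube_pos {f : Space n → ℝ} (hf : AEMeasurable f volume) (hpos : ∀ x, 0 < f x)
    (a : Space n) {r : ℝ} (hr : 0 < r) : ∫⁻ x in cube a r, ENNReal.ofReal (f x) ≠ 0 := by
  intro h
  rw [lintegral_eq_zero_iff' hf.ennreal_ofReal.restrict] at h
  have h2 : ∀ᵐ x ∂(volume.restrict (cube a r)), False := by
    filter_upwards [h] with x hx
    exact (ENNReal.ofReal_pos.2 (hpos x)).ne' hx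
  rw [eventually_false_iff_eq_bot, ae_eq_bot, Measure.restrict_eq_zero] at h2
  exact (volume_cube_pos a hr).ne' h2

/-- A finite product in `[0, ∞]` has finite factors unless one of them is zero, and neither mean is
zero because `ω > 0`. -/
theorem IsMuckenhouptA2.setLIntegral_cube_lt_top (hω : IsMuckenhouptA2 ω) (a : Space n) {r : ℝ}
    (hr : 0 < r) : ∫⁻ x in cube a r, ENNReal.ofReal (ω x) < ∞ ∧
      ∫⁻ x in cube a r, ENNReal.ofReal (ω x)⁻¹ < ∞ := by
  have hlt : (⨍⁻ x in cube a r, ENNReal.ofReal (ω x) ∂volume) *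
      (⨍⁻ x in cube a r, ENNReal.ofReal (ω x)⁻¹ ∂volume) < ∞ := by
    refine lt_of_le_of_lt ?_ hω.const_lt_top
    exact le_iSup_of_le a (le_iSup_of_le r (le_iSup_of_le hr le_rfl))
  have hvol : volume (cube a r) ≠ ∞ := (isCompact_cube a r).measure_lt_top.ne
  have hvol0 := (volume_cube_pos a hr).ne'
  have h1 := setLIntegral_cube_pos hω.aemeasurable hω.pos a hr
  have h2 := setLIntegral_cube_pos hω.aemeasurable.inv (fun x => inv_pos.2 (hω.pos x)) a hr
  rw [setLAverage_eq, setLAverage_eq, ENNReal.mul_lt_top_iff] at hlt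
  have hne : ∀ I : ℝ≥0∞, I ≠ 0 → I / volume (cube a r) ≠ 0 := fun I hI =>
    (ENNReal.div_pos hI hvol).ne'
  have hfin : ∀ I : ℝ≥0∞, I / volume (cube a r) < ∞ → I < ∞ := fun I hI => by
    rw [← ENNReal.div_mul_cancel (b := I) hvol0 hvol]
    exact ENNReal.mul_lt_top hI hvol.lt_top
  rcases hlt with h | h | h
  · exact ⟨hfin _ h.1, hfin _ h.2⟩
  · exact absurd h (hne _ h1)
  · exact absurd h (hne _ h2)

theorem IsMuckenhouptA2.setLIntegral_lt_top (hω : IsMuckenhouptA2 ω) {s : Set (Space n)}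
    (hs : IsCompact s) : ∫⁻ x in s, ENNReal.ofReal (ω x) < ∞ ∧
      ∫⁻ x in s, ENNReal.ofReal (ω x)⁻¹ < ∞ := by
  obtain ⟨a, r, hr, hsub⟩ := exists_subset_cube hs
  have h := hω.setLIntegral_cube_lt_top a hr
  exact ⟨(lintegral_mono_set hsub).trans_lt h.1, (lintegral_mono_set hsub).trans_lt h.2⟩

theorem wMeasure_absolutelyContinuous : wMeasure ω ≪ volume :=
  withDensity_absolutelyContinuous _ _

theorem IsMuckenhouptA2.absolutelyContinuous (hω : IsMuckenhouptA2 ω) : volume ≪ wMeasure ω :=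
  withDensity_absolutelyContinuous' hω.aemeasurable.ennreal_ofReal
    (Eventually.of_forall fun x => (ENNReal.ofReal_pos.2 (hω.pos x)).ne')

variable [hω : Fact (IsMuckenhouptA2 ω)]

instance : IsFiniteMeasureOnCompacts (wMeasure ω) where
  lt_top_of_isCompact s hs := by
    rw [wMeasure, withDensity_apply _ hs.measurableSet]
    exact (hω.out.setLIntegral_lt_top hs).1

theorem ae_volume_of_ae_wMeasure {p : Space n → Prop} (h : ∀ᵐ x ∂(wMeasure ω), p x) :
    ∀ᵐ x, p x :=
  hω.out.absolutelyContinuous.ae_le h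

theorem aemeasurable_weight : AEMeasurable ω (wMeasure ω) :=
  hω.out.aemeasurable.mono_ac wMeasure_absolutelyContinuous

theorem integral_wMeasure {E : Type*} [NormedAddCommGroup E] [NormedSpace ℝ E]
    (g : Space n → E) : ∫ x, g x ∂(wMeasure ω) = ∫ x, ω x • g x := by
  rw [wMeasure, integral_withDensity_eq_integral_toReal_smul₀ hω.out.aemeasurable.ennreal_ofReal
    (Eventually.of_forall fun x => ENNReal.ofReal_lt_top)]
  refine integral_congr_ae (Eventually.of_forall fun x => ?_)
  simp only [ENNReal.toReal_ofReal (hω.out.pos x).le]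

/-- Continuous compactly supported functions divided by the weight lie in `L²_ω`. -/
theorem memLp_inv_weight_smul {E : Type*} [NormedAddCommGroup E] [NormedSpace ℝ E]
    {k : Space n → E} (hk : Continuous k) (hks : HasCompactSupport k) :
    MemLp (fun x => (ω x)⁻¹ • k x) 2 (wMeasure ω) := by
  obtain ⟨A, hA⟩ := hks.exists_bound_of_continuous hk
  have hmeas : AEStronglyMeasurable (fun x => (ω x)⁻¹ • k x) (wMeasure ω) :=
    (aemeasurable_weight.inv.aestronglyMeasurable).smul hk.aestronglyMeasurable
  rw [memLp_two_iff_integrable_sq_norm hmeas]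
  refine ⟨hmeas.norm.pow 2, ?_⟩
  have hmeas' : AEMeasurable (fun x => ENNReal.ofReal (‖(ω x)⁻¹ • k x‖ ^ 2)) (wMeasure ω) :=
    (hmeas.norm.pow 2).aemeasurable.ennreal_ofReal
  rw [hasFiniteIntegral_iff_ofReal (Eventually.of_forall fun x => sq_nonneg _), wMeasure,
    lintegral_withDensity_eq_lintegral_mul₀' hω.out.aemeasurable.ennreal_ofReal hmeas']
  -- The density is `ω · ω⁻² |k|² = ω⁻¹ |k|²`, so local integrability of `ω⁻¹` is exactly what is
  -- needed.
  have hle : ∀ x, (ENNReal.ofReal (ω x) * ENNReal.ofReal (‖(ω x)⁻¹ • k x‖ ^ 2)) ≤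
      (tsupport k).indicator (fun x => ENNReal.ofReal (A ^ 2) * ENNReal.ofReal (ω x)⁻¹) x := by
    intro x
    have hx := hω.out.pos x
    by_cases hxs : x ∈ tsupport k
    · rw [indicator_of_mem hxs, ← ENNReal.ofReal_mul hx.le, ← ENNReal.ofReal_mul (sq_nonneg _)]
      refine ENNReal.ofReal_le_ofReal ?_
      rw [norm_smul, norm_inv, Real.norm_of_nonneg hx.le, mul_pow]
      have h1 : ‖k x‖ ^ 2 ≤ A ^ 2 := pow_le_pow_left₀ (norm_nonneg _) (hA x) 2
      calc ω x * ((ω x)⁻¹ ^ 2 * ‖k x‖ ^ 2) = ‖k x‖ ^ 2 * (ω x)⁻¹ := by field_simp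
        _ ≤ A ^ 2 * (ω x)⁻¹ := by
          have := inv_pos.2 hx
          gcongr
    · simp [image_eq_zero_of_notMem_tsupport hxs]
  refine (lintegral_mono hle).trans_lt ?_
  rw [lintegral_indicator (isClosed_tsupport k).measurableSet,
    lintegral_const_mul' _ _ ENNReal.ofReal_ne_top]
  exact ENNReal.mul_lt_top ENNReal.ofReal_lt_top (hω.out.setLIntegral_lt_top hks).2

/-- Pairing with a continuous compactly supported function with respect to Lebesgue measure is a
bounded functional on `L²_ω`. -/
theorem continuous_integral_mul {k : Space n → ℂ} (hk : Continuous k)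
    (hks : HasCompactSupport k) : Continuous fun f : L2w ω => ∫ x, f x * k x := by
  have hm : MemLp (fun x => (ω x)⁻¹ • (starRingEnd ℂ) (k x)) 2 (wMeasure ω) :=
    memLp_inv_weight_smul (Complex.continuous_conj.comp hk) (hks.comp_left (map_zero _))
  -- The representing vector is `ω⁻¹` times the conjugate of `k`, the factor `ω⁻¹` cancelling the
  -- density of `dω`.
  have heq : (fun f : L2w ω => ∫ x, f x * k x) = fun f => inner ℂ (hm.toLp _) f := by
    funext f
    rw [L2.inner_def, integral_wMeasure]
    refine integral_congr_ae ?_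
    filter_upwards [ae_volume_of_ae_wMeasure hm.coeFn_toLp] with x hx
    have hx' : (ω x : ℂ) ≠ 0 := by exact_mod_cast (hω.out.pos x).ne'
    rw [hx]
    simp only [RCLike.inner_apply, Complex.real_smul, map_mul, Complex.conj_conj,
      Complex.conj_ofReal, Complex.ofReal_inv, map_inv₀]
    field_simp
  rw [heq]
  fun_prop

end Weight

/-! ### The real weighted Sobolev space as a closure of test functions -/

section SobolevSpace

/-- Real-valued test functions. -/
def IsRealTest {X : Type*} [NormedAddCommGroup X] [NormedSpace ℝ X] (φ : X → ℝ) : Prop :=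
  ContDiff ℝ ((⊤ : ℕ∞) : WithTop ℕ∞) φ ∧ HasCompactSupport φ

namespace IsRealTest

variable {X : Type*} [NormedAddCommGroup X] [NormedSpace ℝ X] {φ ψ : X → ℝ}

theorem continuous (h : IsRealTest φ) : Continuous φ := h.1.continuous

theorem differentiable (h : IsRealTest φ) : Differentiable ℝ φ :=
  h.1.differentiable (by simp)

theorem continuous_fderiv (h : IsRealTest φ) : Continuous (fderiv ℝ φ) :=
  h.1.continuous_fderiv (by simp)

theorem add (hφ : IsRealTest φ) (hψ : IsRealTest ψ) : IsRealTest (φ + ψ) :=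
  ⟨hφ.1.add hψ.1, hφ.2.add hψ.2⟩

theorem smul (hφ : IsRealTest φ) (r : ℝ) : IsRealTest (r • φ) :=
  ⟨contDiff_const.smul hφ.1, hφ.2.smul_left (f := fun _ => r)⟩

theorem zero : IsRealTest (0 : X → ℝ) := ⟨contDiff_const, HasCompactSupport.zero⟩

theorem comp_left (hφ : IsRealTest φ) {F : ℝ → ℝ} (hF : ContDiff ℝ ((⊤ : ℕ∞) : WithTop ℕ∞) F)
    (hF0 : F 0 = 0) : IsRealTest (F ∘ φ) :=
  ⟨hF.comp hφ.1, hφ.2.comp_left hF0⟩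

end IsRealTest

variable {n : ℕ} {ω : Space n → ℝ}

theorem gradient_apply (φ : Space n → ℝ) (x : Space n) (i : Fin n) :
    gradient φ x i = fderiv ℝ φ x (EuclideanSpace.single i 1) := by
  have h : inner ℝ (gradient φ x) (EuclideanSpace.single i (1 : ℝ)) =
      fderiv ℝ φ x (EuclideanSpace.single i 1) := InnerProductSpace.toDual_symm_apply
  rw [← h, EuclideanSpace.inner_single_right]
  simp

theorem IsRealTest.continuous_gradient {φ : Space n → ℝ} (h : IsRealTest φ) :
    Continuous (gradient φ) :=
  (InnerProductSpace.toDual ℝ (Space n)).symm.continuous.comp h.continuous_fderiv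

theorem IsRealTest.hasCompactSupport_gradient {φ : Space n → ℝ} (h : IsRealTest φ) :
    HasCompactSupport (gradient φ) :=
  (h.2.fderiv ℝ).comp_left (map_zero (InnerProductSpace.toDual ℝ (Space n)).symm)

theorem integral_mul_fderiv_test {φ : Space n → ℝ} (hφ : IsRealTest φ) {η : Space n → ℂ}
    (hη : IsTestFunction η) (v : Space n) :
    ∫ x, (φ x : ℂ) * fderiv ℝ η x v = -∫ x, ((fderiv ℝ φ x v : ℝ) : ℂ) * η x := by
  have hd : ∀ x, fderiv ℝ (fun x => (φ x : ℂ)) x v = ((fderiv ℝ φ x v : ℝ) : ℂ) := by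
    intro x
    have := (Complex.ofRealCLM.hasFDerivAt.comp x (hφ.differentiable x).hasFDerivAt).fderiv
    change fderiv ℝ (⇑Complex.ofRealCLM ∘ φ) x v = _
    rw [this]
    rfl
  have hηc : Continuous η := hη.1.continuous
  have hφc := hφ.continuous
  have hηd : Continuous fun x => fderiv ℝ η x v :=
    (hη.1.continuous_fderiv (by simp)).clm_apply continuous_const
  have hφd : Continuous fun x => fderiv ℝ φ x v :=
    hφ.continuous_fderiv.clm_apply continuous_const
  have hφs : HasCompactSupport fun x => (φ x : ℂ) := hφ.2.comp_left Complex.ofReal_zero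
  simp only [← hd]
  refine integral_mul_fderiv_eq_neg_fderiv_mul_of_integrable ?_ ?_ ?_ ?_ ?_
  · simp only [hd]
    exact Continuous.integrable_of_hasCompactSupport (by fun_prop) hη.2.mul_left
  · exact Continuous.integrable_of_hasCompactSupport (by fun_prop) hφs.mul_right
  · exact Continuous.integrable_of_hasCompactSupport (by fun_prop) hη.2.mul_left
  · exact fun x _ => Complex.ofRealCLM.differentiableAt.comp x (hφ.differentiable x)
  · exact fun x _ => hη.1.differentiable (by simp) x

/-- The real Hilbert space `L²_ω(ℝⁿ; ℝ)`. -/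
abbrev RealL2w (ω : Space n → ℝ) : Type := Lp ℝ 2 (wMeasure ω)

/-- The space of real square-integrable vector fields. -/
abbrev RealL2wVec (ω : Space n → ℝ) : Type := Lp (Space n) 2 (wMeasure ω)

/-- Complexification `L²_ω(ℝⁿ; ℝ) → L²_ω(ℝⁿ; ℂ)`. -/
def toComplex (ω : Space n → ℝ) : RealL2w ω →L[ℝ] L2w ω :=
  Complex.ofRealCLM.compLpL 2 (wMeasure ω)

theorem toComplex_ae (f : RealL2w ω) : ∀ᵐ x ∂(wMeasure ω), toComplex ω f x = (f x : ℂ) :=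
  Complex.ofRealCLM.coeFn_compLpL f

/-- The embedding of `ℝⁿ` in `ℂⁿ`. -/
def vecToComplex (n : ℕ) : Space n →L[ℝ] EuclideanSpace ℂ (Fin n) :=
  LinearMap.toContinuousLinearMap
    { toFun := fun ξ => WithLp.toLp 2 fun i => ((ξ i : ℝ) : ℂ)
      map_add' := fun ξ ζ => by ext i; simp
      map_smul' := fun r ξ => by ext i; simp }

@[simp]
theorem vecToComplex_apply (ξ : Space n) (i : Fin n) : vecToComplex n ξ i = ((ξ i : ℝ) : ℂ) := rfl

/-- Complexification of vector fields. -/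
def toComplexVec (ω : Space n → ℝ) : RealL2wVec ω →L[ℝ] L2wVec ω :=
  (vecToComplex n).compLpL 2 (wMeasure ω)

theorem toComplexVec_ae (g : RealL2wVec ω) :
    ∀ᵐ x ∂(wMeasure ω), toComplexVec ω g x = vecToComplex n (g x) :=
  (vecToComplex n).coeFn_compLpL g

variable [hω : Fact (IsMuckenhouptA2 ω)]

theorem IsRealTest.memLp {φ : Space n → ℝ} (h : IsRealTest φ) : MemLp φ 2 (wMeasure ω) :=
  h.continuous.memLp_of_hasCompactSupport h.2

theorem IsRealTest.memLp_gradient {φ : Space n → ℝ} (h : IsRealTest φ) :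
    MemLp (gradient φ) 2 (wMeasure ω) :=
  h.continuous_gradient.memLp_of_hasCompactSupport h.hasCompactSupport_gradient

/-- The pair `(φ, ∇φ)` of a test function. -/
def testPair (ω : Space n → ℝ) [Fact (IsMuckenhouptA2 ω)] {φ : Space n → ℝ} (h : IsRealTest φ) :
    WithLp 2 (RealL2w ω × RealL2wVec ω) :=
  WithLp.toLp 2 (h.memLp.toLp φ, h.memLp_gradient.toLp (gradient φ))

/-- The graph of the gradient on test functions. -/
def testGraph (ω : Space n → ℝ) [Fact (IsMuckenhouptA2 ω)] :
    Submodule ℝ (WithLp 2 (RealL2w ω × RealL2wVec ω)) where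
  carrier := {z | ∃ (φ : Space n → ℝ) (h : IsRealTest φ), z = testPair ω h}
  zero_mem' := by
    refine ⟨0, .zero, ?_⟩
    have h : gradient (0 : Space n → ℝ) = 0 := by
      funext x
      simp [gradient]
    simp only [testPair, h]
    rfl
  add_mem' := by
    rintro _ _ ⟨φ, hφ, rfl⟩ ⟨ψ, hψ, rfl⟩
    refine ⟨φ + ψ, hφ.add hψ, ?_⟩
    have h : gradient (φ + ψ) = gradient φ + gradient ψ := by
      funext x
      simp [gradient, fderiv_add (hφ.differentiable x) (hψ.differentiable x)]
    simp only [testPair, h]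
    rfl
  smul_mem' := by
    rintro r _ ⟨φ, hφ, rfl⟩
    refine ⟨r • φ, hφ.smul r, ?_⟩
    have h : gradient (r • φ) = r • gradient φ := by
      funext x
      simp [gradient, fderiv_const_smul (hφ.differentiable x)]
    simp only [testPair, h]
    rfl

/-- The closure of the test functions in the weighted Sobolev space. -/
abbrev Sobolev (ω : Space n → ℝ) [Fact (IsMuckenhouptA2 ω)] : Type :=
  (testGraph ω).topologicalClosure

/-- The function underlying an element of the Sobolev space. -/
def Sobolev.val (ω : Space n → ℝ) [Fact (IsMuckenhouptA2 ω)] : Sobolev ω →L[ℝ] RealL2w ω :=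
  (WithLp.fstL 2 ℝ (RealL2w ω) (RealL2wVec ω)).comp (testGraph ω).topologicalClosure.subtypeL

/-- The gradient of an element of the Sobolev space. -/
def Sobolev.grad (ω : Space n → ℝ) [Fact (IsMuckenhouptA2 ω)] : Sobolev ω →L[ℝ] RealL2wVec ω :=
  (WithLp.sndL 2 ℝ (RealL2w ω) (RealL2wVec ω)).comp (testGraph ω).topologicalClosure.subtypeL

theorem Sobolev.norm_sq (v : Sobolev ω) :
    ‖v‖ ^ 2 = ‖Sobolev.val ω v‖ ^ 2 + ‖Sobolev.grad ω v‖ ^ 2 :=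
  WithLp.prod_norm_sq_eq_of_L2 (v : WithLp 2 (RealL2w ω × RealL2wVec ω))

/-- A test function as an element of the Sobolev space. -/
def Sobolev.ofTest (ω : Space n → ℝ) [Fact (IsMuckenhouptA2 ω)] {φ : Space n → ℝ}
    (h : IsRealTest φ) : Sobolev ω :=
  ⟨testPair ω h, (testGraph ω).le_topologicalClosure ⟨φ, h, rfl⟩⟩

theorem Sobolev.val_ofTest {φ : Space n → ℝ} (h : IsRealTest φ) :
    Sobolev.val ω (Sobolev.ofTest ω h) = h.memLp.toLp φ := rfl

theorem Sobolev.grad_ofTest {φ : Space n → ℝ} (h : IsRealTest φ) :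
    Sobolev.grad ω (Sobolev.ofTest ω h) = h.memLp_gradient.toLp (gradient φ) := rfl

/-- Every element of the Sobolev space is a limit of test functions. -/
theorem Sobolev.exists_seq (v : Sobolev ω) :
    ∃ (φ : ℕ → Space n → ℝ) (h : ∀ k, IsRealTest (φ k)),
      Tendsto (fun k => Sobolev.ofTest ω (h k)) atTop (𝓝 v) := by
  have hv := v.2
  rw [← SetLike.mem_coe, Submodule.topologicalClosure_coe, mem_closure_iff_seq_limit] at hv
  obtain ⟨z, hz, hlim⟩ := hv
  choose φ h hφ using hz
  refine ⟨φ, h, ?_⟩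
  rw [tendsto_subtype_rng]
  refine hlim.congr fun k => ?_
  rw [hφ k]
  rfl

/-- Elements of the Sobolev space have a distributional gradient. -/
theorem Sobolev.isWeakGradient (v : Sobolev ω) :
    IsWeakGradient (toComplex ω (Sobolev.val ω v)) (toComplexVec ω (Sobolev.grad ω v)) := by
  intro η hη i
  let P : EuclideanSpace ℂ (Fin n) →L[ℂ] ℂ := EuclideanSpace.proj i
  let PL : L2wVec ω →L[ℂ] L2w ω := P.compLpL 2 (wMeasure ω)
  have hPL : ∀ g : L2wVec ω, ∫ x, g x i * η x = ∫ x, PL g x * η x := by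
    intro g
    refine integral_congr_ae ?_
    filter_upwards [ae_volume_of_ae_wMeasure (P.coeFn_compLpL g)] with x hx
    simp only [PL, hx]
    rfl
  have hηc : Continuous η := hη.1.continuous
  have hηd : Continuous fun x => fderiv ℝ η x (EuclideanSpace.single i 1) :=
    (hη.1.continuous_fderiv (by simp)).clm_apply continuous_const
  have hηs : HasCompactSupport fun x => fderiv ℝ η x (EuclideanSpace.single i 1) :=
    (hη.2.fderiv ℝ).comp_left (g := fun L : Space n →L[ℝ] ℂ => L (EuclideanSpace.single i 1)) rfl
  rw [hPL]
  -- Both sides depend continuously on `v`, so classical integration by parts for test functions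
  -- suffices.
  obtain ⟨φ, h, hlim⟩ := v.exists_seq
  have c1 : Continuous fun v : Sobolev ω => ∫ x, toComplex ω (Sobolev.val ω v) x *
      fderiv ℝ η x (EuclideanSpace.single i 1) :=
    (continuous_integral_mul hηd hηs).comp (by fun_prop)
  have c2 : Continuous fun v : Sobolev ω =>
      -∫ x, PL (toComplexVec ω (Sobolev.grad ω v)) x * η x :=
    ((continuous_integral_mul hηc hη.2).comp (by fun_prop)).neg
  refine tendsto_nhds_unique ((c1.tendsto v).comp hlim)
    (((c2.tendsto v).comp hlim).congr fun k => ?_)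
  simp only [Function.comp_apply]
  rw [← hPL]
  refine Eq.symm (Eq.trans ?_ ((integral_mul_fderiv_test (h k) hη
    (EuclideanSpace.single i 1)).trans ?_))
  · refine integral_congr_ae ?_
    filter_upwards [ae_volume_of_ae_wMeasure (toComplex_ae
      (Sobolev.val ω (Sobolev.ofTest ω (h k)))),
      ae_volume_of_ae_wMeasure ((h k).memLp (ω := ω)).coeFn_toLp] with x e1 e2
    rw [e1, Sobolev.val_ofTest, e2]
  · congr 1
    refine integral_congr_ae ?_
    filter_upwards [ae_volume_of_ae_wMeasure (toComplexVec_ae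
      (Sobolev.grad ω (Sobolev.ofTest ω (h k)))),
      ae_volume_of_ae_wMeasure ((h k).memLp_gradient (ω := ω)).coeFn_toLp] with x e1 e2
    rw [e1, vecToComplex_apply, Sobolev.grad_ofTest, e2, gradient_apply]

end SobolevSpace

/-! ### The real bilinear form of the coefficients -/

section Coefficients

variable {n : ℕ} {ω : Space n → ℝ} {A : ℝ → Space n → Matrix (Fin n) (Fin n) ℂ} {M ν : ℝ}

/-- The bilinear form `(ξ, ζ) ↦ a ξ · ζ` of a real matrix. -/
def matrixForm (a : Matrix (Fin n) (Fin n) ℝ) : Space n →L[ℝ] Space n →L[ℝ] ℝ :=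
  (LinearMap.mk₂ ℝ (fun ξ ζ : Space n => (a *ᵥ ξ.ofLp) ⬝ᵥ ζ.ofLp)
    (fun ξ ξ' ζ => by simp [Matrix.mulVec_add, add_dotProduct])
    (fun r ξ ζ => by simp [Matrix.mulVec_smul, smul_dotProduct])
    (fun ξ ζ ζ' => by simp [dotProduct_add])
    (fun r ξ ζ => by simp [dotProduct_smul])).toContinuousBilinearMap

theorem matrixForm_eq_sum (a : Matrix (Fin n) (Fin n) ℝ) (ξ ζ : Space n) :
    matrixForm a ξ ζ = ∑ i, (∑ j, a i j * ξ j) * ζ i := rfl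

/-- The normalized real coefficient matrix `ω⁻¹ Re A`. -/
def realCoeff (ω : Space n → ℝ) (A : ℝ → Space n → Matrix (Fin n) (Fin n) ℂ) (t : ℝ)
    (x : Space n) : Matrix (Fin n) (Fin n) ℝ :=
  Matrix.of fun i j => (A t x i j).re / ω x

/-- This is where reality of `A` is exploited: the form is real on real vectors, so the problem
reduces to real Hilbert spaces. Dividing by `ω` leaves the constants `M` and `ν` for integrals
against `dω`. -/
theorem mulVec_dotProduct_vecToComplex (hω : ∀ x, 0 < ω x)
    (hreal : ∀ t x i j, (A t x i j).im = 0) (t : ℝ) (x ξ ζ : Space n) :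
    (A t x *ᵥ (vecToComplex n ξ).ofLp) ⬝ᵥ (vecToComplex n ζ).ofLp =
      ((ω x * matrixForm (realCoeff ω A t x) ξ ζ : ℝ) : ℂ) := by
  have hA : ∀ i j, A t x i j = ((ω x * realCoeff ω A t x i j : ℝ) : ℂ) := by
    intro i j
    rw [realCoeff, Matrix.of_apply, mul_div_cancel₀ _ (hω x).ne']
    exact Complex.ext rfl (hreal t x i j)
  rw [matrixForm_eq_sum]
  simp only [dotProduct, Matrix.mulVec, hA, vecToComplex_apply]
  push_cast
  rw [Finset.mul_sum]
  refine Finset.sum_congr rfl fun i _ => ?_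
  rw [← mul_assoc, Finset.mul_sum]
  congr 1
  exact Finset.sum_congr rfl fun j _ => by ring

theorem norm_vecToComplex (ξ : Space n) : ‖vecToComplex n ξ‖ = ‖ξ‖ := by
  simp [EuclideanSpace.norm_eq]

theorem abs_realCoeff_le (hω : ∀ x, 0 < ω x) (hA : IsDegenerateElliptic ω A M ν)
    (hreal : ∀ t x i j, (A t x i j).im = 0) (t : ℝ) (x ξ ζ : Space n) :
    |matrixForm (realCoeff ω A t x) ξ ζ| ≤ M * ‖ξ‖ * ‖ζ‖ := by
  have h := hA.bounded t x (vecToComplex n ξ) (vecToComplex n ζ)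
  rw [mulVec_dotProduct_vecToComplex hω hreal, Complex.norm_real, Real.norm_eq_abs, abs_mul,
    abs_of_pos (hω x), norm_vecToComplex, norm_vecToComplex] at h
  refine le_of_mul_le_mul_left ?_ (hω x)
  linarith

theorem le_realCoeff (hω : ∀ x, 0 < ω x) (hA : IsDegenerateElliptic ω A M ν)
    (hreal : ∀ t x i j, (A t x i j).im = 0) (t : ℝ) (x ξ : Space n) :
    ν * ‖ξ‖ ^ 2 ≤ matrixForm (realCoeff ω A t x) ξ ξ := by
  have h := hA.coercive t x (vecToComplex n ξ)
  have hstar : star (vecToComplex n ξ).ofLp = (vecToComplex n ξ).ofLp := by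
    funext i
    exact Complex.conj_ofReal _
  rw [hstar, mulVec_dotProduct_vecToComplex hω hreal, Complex.ofReal_re, norm_vecToComplex] at h
  refine le_of_mul_le_mul_left ?_ (hω x)
  linarith

theorem aestronglyMeasurable_realCoeff [hω : Fact (IsMuckenhouptA2 ω)]
    (hA : IsDegenerateElliptic ω A M ν) (i j : Fin n) :
    AEStronglyMeasurable (fun p : ℝ × Space n => realCoeff ω A p.1 p.2 i j)
      ((volume : Measure ℝ).prod (wMeasure ω)) := by
  have hac : (volume : Measure ℝ).prod (wMeasure ω) ≪ (volume : Measure (ℝ × Space n)) :=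
    Measure.AbsolutelyContinuous.rfl.prod wMeasure_absolutelyContinuous
  have h1 := ((hA.aemeasurable i j).mono_ac hac)
  have h2 : AEMeasurable (fun p : ℝ × Space n => ω p.2)
      ((volume : Measure ℝ).prod (wMeasure ω)) :=
    (aemeasurable_weight (ω := ω)).comp_quasiMeasurePreserving
      Measure.quasiMeasurePreserving_snd
  exact ((Complex.measurable_re.comp_aemeasurable h1).div h2).aestronglyMeasurable

theorem aestronglyMeasurable_matrixForm {α : Type*} [MeasurableSpace α] {μ : Measure α}
    {a : α → Matrix (Fin n) (Fin n) ℝ} (ha : ∀ i j, AEStronglyMeasurable (fun x => a x i j) μ)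
    {w w' : α → Space n} (hw : AEStronglyMeasurable w μ) (hw' : AEStronglyMeasurable w' μ) :
    AEStronglyMeasurable (fun x => matrixForm (a x) (w x) (w' x)) μ := by
  have hcoord : ∀ {f : α → Space n}, AEStronglyMeasurable f μ → ∀ i,
      AEStronglyMeasurable (fun x => f x i) μ := fun hf i =>
    (EuclideanSpace.proj (𝕜 := ℝ) i).continuous.comp_aestronglyMeasurable hf
  simp only [matrixForm_eq_sum]
  refine Finset.aestronglyMeasurable_fun_sum _ fun i _ => ?_
  refine AEStronglyMeasurable.mul ?_ (hcoord hw' i)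
  exact Finset.aestronglyMeasurable_fun_sum _ fun j _ => (ha i j).mul (hcoord hw j)

/-- The family of bilinear forms of the operator `-ω⁻¹ div(A(t) ∇)` on vector fields. -/
theorem exists_coefficient_form [hω : Fact (IsMuckenhouptA2 ω)] (hM : 0 ≤ M)
    (hA : IsDegenerateElliptic ω A M ν) (hreal : ∀ t x i j, (A t x i j).im = 0) :
    ∃ b : ℝ → RealL2wVec ω →L[ℝ] RealL2wVec ω →L[ℝ] ℝ,
      (∀ w w', AEStronglyMeasurable (fun t => b t w w') volume) ∧
      (∀ t w w', |b t w w'| ≤ M * ‖w‖ * ‖w'‖) ∧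
      (∀ᵐ t, ∀ w, ν * ‖w‖ ^ 2 ≤ b t w w) ∧
      ∀ᵐ t, ∀ w w' : RealL2wVec ω,
        Integrable (fun x => matrixForm (realCoeff ω A t x) (w x) (w' x)) (wMeasure ω) ∧
        b t w w' = ∫ x, matrixForm (realCoeff ω A t x) (w x) (w' x) ∂(wMeasure ω) := by
  have hpos := hω.out.pos
  have hae : ∀ᵐ t : ℝ, ∀ i j,
      AEStronglyMeasurable (fun x => realCoeff ω A t x i j) (wMeasure ω) :=
    ae_all_iff.2 fun i => ae_all_iff.2 fun j =>
      (aestronglyMeasurable_realCoeff hA i j).prodMk_left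
  -- Only almost every time slice of `A` is known to be measurable. On the exceptional times the
  -- form is set to zero, so the upper bound holds for all `t` and coercivity for almost every `t`.
  have hex : ∀ t : ℝ, ∃ B : RealL2wVec ω →L[ℝ] RealL2wVec ω →L[ℝ] ℝ,
      (∀ w w', |B w w'| ≤ M * ‖w‖ * ‖w'‖) ∧
      ((∀ i j, AEStronglyMeasurable (fun x => realCoeff ω A t x i j) (wMeasure ω)) →
        ∀ w w', B w w' = ∫ x, matrixForm (realCoeff ω A t x) (w x) (w' x) ∂(wMeasure ω)) := by
    intro t
    by_cases ht : ∀ i j, AEStronglyMeasurable (fun x => realCoeff ω A t x i j) (wMeasure ω)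
    · obtain ⟨B, hB, hB'⟩ := exists_integrated_form (μ := wMeasure ω)
        (b := fun x => matrixForm (realCoeff ω A t x))
        (fun w w' => aestronglyMeasurable_matrixForm ht aestronglyMeasurable_const
          aestronglyMeasurable_const) hM (abs_realCoeff_le hpos hA hreal t)
      exact ⟨B, hB, fun _ => hB'⟩
    · refine ⟨0, fun w w' => ?_, fun h => absurd h ht⟩
      simp only [_root_.zero_apply, abs_zero]
      positivity
  choose b hbM hb using hex
  have hint : ∀ᵐ t, ∀ w w' : RealL2wVec ω,
      Integrable (fun x => matrixForm (realCoeff ω A t x) (w x) (w' x)) (wMeasure ω) := by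
    filter_upwards [hae] with t ht w w'
    exact integrable_form_apply (b := fun x => matrixForm (realCoeff ω A t x))
      (fun w w' => aestronglyMeasurable_matrixForm ht aestronglyMeasurable_const
        aestronglyMeasurable_const) (abs_realCoeff_le hpos hA hreal t) (Lp.memLp w) (Lp.memLp w')
  refine ⟨b, fun w w' => ?_, hbM, ?_, ?_⟩
  · have h1 : AEStronglyMeasurable (fun p : ℝ × Space n =>
        matrixForm (realCoeff ω A p.1 p.2) (w p.2) (w' p.2))
        ((volume : Measure ℝ).prod (wMeasure ω)) :=
      aestronglyMeasurable_matrixForm (aestronglyMeasurable_realCoeff hA)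
        (Lp.memLp w).1.comp_snd (Lp.memLp w').1.comp_snd
    refine h1.integral_prod_right'.congr ?_
    filter_upwards [hae] with t ht
    rw [hb t ht]
  · filter_upwards [hae, hint] with t ht hi w
    rw [hb t ht]
    have hw : Integrable (fun x => ‖w x‖ ^ 2) (wMeasure ω) :=
      (memLp_two_iff_integrable_sq_norm (Lp.memLp w).1).1 (Lp.memLp w)
    have h1 := norm_toLp_sq (Lp.memLp w)
    rw [Lp.toLp_coeFn] at h1
    rw [h1, ← integral_const_mul]
    exact integral_mono (hw.const_mul ν) (hi w w) fun x => le_realCoeff hpos hA hreal t x _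
  · filter_upwards [hae, hint] with t ht hi w w'
    exact ⟨hi w w', hb t ht w w'⟩

end Coefficients

/-! ### Smooth truncation and positivity of the Euler step -/

section Positivity

/-- A smooth nondecreasing function that vanishes exactly on `[0, ∞)`. -/
def negTruncation (x : ℝ) : ℝ := ∫ s in (0 : ℝ)..x, Real.smoothTransition (-s)

theorem hasDerivAt_negTruncation (x : ℝ) :
    HasDerivAt negTruncation (Real.smoothTransition (-x)) x := by
  have hc : Continuous fun s : ℝ => Real.smoothTransition (-s) :=
    Real.smoothTransition.continuous.comp continuous_neg
  exact (hc.integral_hasStrictDerivAt 0 x).hasDerivAt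

theorem deriv_negTruncation : deriv negTruncation = fun x => Real.smoothTransition (-x) :=
  funext fun x => (hasDerivAt_negTruncation x).deriv

theorem contDiff_negTruncation : ContDiff ℝ ((⊤ : ℕ∞) : WithTop ℕ∞) negTruncation := by
  rw [contDiff_infty_iff_deriv, deriv_negTruncation]
  exact ⟨fun x => (hasDerivAt_negTruncation x).differentiableAt,
    Real.smoothTransition.contDiff.comp contDiff_neg⟩

theorem lipschitzWith_negTruncation : LipschitzWith 1 negTruncation := by
  refine lipschitzWith_of_nnnorm_deriv_le
    (fun x => (hasDerivAt_negTruncation x).differentiableAt) fun x => ?_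
  rw [deriv_negTruncation, ← NNReal.coe_le_coe, coe_nnnorm, Real.norm_of_nonneg
    (Real.smoothTransition.nonneg _)]
  exact Real.smoothTransition.le_one _

theorem negTruncation_zero : negTruncation 0 = 0 := by simp [negTruncation]

theorem negTruncation_of_nonneg {x : ℝ} (hx : 0 ≤ x) : negTruncation x = 0 := by
  rw [negTruncation, intervalIntegral.integral_congr (g := fun _ => 0)]
  · simp
  · intro s hs
    rw [uIcc_of_le hx] at hs
    exact Real.smoothTransition.zero_of_nonpos (by linarith [hs.1])

theorem negTruncation_of_neg {x : ℝ} (hx : x < 0) : negTruncation x < 0 := by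
  rw [negTruncation, intervalIntegral.integral_symm, neg_lt_zero]
  refine intervalIntegral.intervalIntegral_pos_of_pos_on ?_ (fun s hs => ?_) hx
  · exact Continuous.intervalIntegrable
      (Real.smoothTransition.continuous.comp continuous_neg) _ _
  · exact Real.smoothTransition.pos_of_pos (by linarith [hs.2])

theorem negTruncation_nonpos (x : ℝ) : negTruncation x ≤ 0 := by
  rcases lt_or_ge x 0 with h | h
  · exact (negTruncation_of_neg h).le
  · exact (negTruncation_of_nonneg h).le

theorem mul_negTruncation_nonneg (x : ℝ) : 0 ≤ x * negTruncation x := by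
  rcases lt_or_ge x 0 with h | h
  · exact (mul_pos_of_neg_of_neg h (negTruncation_of_neg h)).le
  · rw [negTruncation_of_nonneg h, mul_zero]

variable {n : ℕ} {ω : Space n → ℝ} {A : ℝ → Space n → Matrix (Fin n) (Fin n) ℂ} {M ν : ℝ}

theorem IsRealTest.negTruncation_comp {φ : Space n → ℝ} (h : IsRealTest φ) :
    IsRealTest (negTruncation ∘ φ) :=
  h.comp_left contDiff_negTruncation negTruncation_zero

theorem gradient_negTruncation_comp {φ : Space n → ℝ} (h : IsRealTest φ) (x : Space n) :
    gradient (negTruncation ∘ φ) x = Real.smoothTransition (-φ x) • gradient φ x := by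
  have hd := (hasDerivAt_negTruncation (φ x)).comp_hasFDerivAt x (h.differentiable x).hasFDerivAt
  rw [gradient, hd.fderiv, map_smul]
  rfl

/-- Nonnegative elements of `L²_ω`. -/
def nonnegCone (ω : Space n → ℝ) : Set (RealL2w ω) := {y | ∀ᵐ x ∂(wMeasure ω), 0 ≤ y x}

theorem inner_nonneg_of_ae {f y : RealL2w ω} (hf : ∀ᵐ x ∂(wMeasure ω), 0 ≤ f x)
    (hy : y ∈ nonnegCone ω) : 0 ≤ inner ℝ f y := by
  rw [L2.inner_def]
  refine integral_nonneg_of_ae ?_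
  filter_upwards [hf, hy] with x h1 h2
  simpa using mul_nonneg h2 h1

/-- With `F = negTruncation`, the integrand `f F(f)` is nonnegative and is zero only where `f ≥ 0`;
a nonpositive integral forces it to vanish almost everywhere. -/
theorem ae_nonneg_of_inner_negTruncation_nonpos (f : RealL2w ω)
    (hf : inner ℝ f (lipschitzWith_negTruncation.compLp negTruncation_zero f) ≤ 0) :
    ∀ᵐ x ∂(wMeasure ω), 0 ≤ f x := by
  have hco := lipschitzWith_negTruncation.coeFn_compLp negTruncation_zero f
  have hint := L2.integrable_inner (𝕜 := ℝ) f
    (lipschitzWith_negTruncation.compLp negTruncation_zero f)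
  have hnn : 0 ≤ᵐ[wMeasure ω] fun x => inner ℝ (f x)
      (lipschitzWith_negTruncation.compLp negTruncation_zero f x) := by
    filter_upwards [hco] with x hx
    rw [hx]
    simpa [mul_comm] using mul_negTruncation_nonneg (f x)
  rw [L2.inner_def] at hf
  have h0 := (integral_eq_zero_iff_of_nonneg_ae hnn hint).1
    (le_antisymm hf (integral_nonneg_of_ae hnn))
  filter_upwards [h0, hco] with x h1 h2
  by_contra hx
  rw [not_le] at hx
  rw [h2] at h1
  have h3 := mul_pos_of_neg_of_neg hx (negTruncation_of_neg hx)
  simp only [Function.comp_apply, RCLike.inner_apply, conj_trivial, Pi.zero_apply] at h1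
  linarith

variable [hω : Fact (IsMuckenhouptA2 ω)]

theorem norm_grad_negTruncation_le {φ : Space n → ℝ} (h : IsRealTest φ) :
    ‖Sobolev.grad ω (Sobolev.ofTest ω h.negTruncation_comp)‖ ≤
      ‖Sobolev.grad ω (Sobolev.ofTest ω h)‖ := by
  rw [Sobolev.grad_ofTest, Sobolev.grad_ofTest]
  refine Lp.norm_le_norm_of_ae_le ?_
  filter_upwards [h.negTruncation_comp.memLp_gradient.coeFn_toLp, h.memLp_gradient.coeFn_toLp]
    with x e1 e2
  rw [e1, e2, gradient_negTruncation_comp h, norm_smul, Real.norm_of_nonneg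
    (Real.smoothTransition.nonneg _)]
  exact mul_le_of_le_one_left (norm_nonneg _) (Real.smoothTransition.le_one _)

/-- By the chain rule the integrand is `F'(φ)` times the elliptic quadratic form at `∇φ`, and `F' ≥
0`. -/
theorem form_negTruncation_nonneg (hA : IsDegenerateElliptic ω A M ν) (hν : 0 ≤ ν)
    (hreal : ∀ t x i j, (A t x i j).im = 0) (t : ℝ) {φ : Space n → ℝ} (h : IsRealTest φ) :
    0 ≤ ∫ x, matrixForm (realCoeff ω A t x) (Sobolev.grad ω (Sobolev.ofTest ω h) x)
      (Sobolev.grad ω (Sobolev.ofTest ω h.negTruncation_comp) x) ∂(wMeasure ω) := by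
  refine integral_nonneg_of_ae ?_
  filter_upwards [h.negTruncation_comp.memLp_gradient.coeFn_toLp, h.memLp_gradient.coeFn_toLp]
    with x e1 e2
  rw [Sobolev.grad_ofTest, Sobolev.grad_ofTest, e1, e2, gradient_negTruncation_comp h, map_smul]
  exact mul_nonneg (Real.smoothTransition.nonneg _)
    (le_trans (by positivity) (le_realCoeff hω.out.pos hA hreal t x (gradient φ x)))

/-- The implicit Euler step preserves nonnegativity. -/
theorem euler_step_nonneg (hA : IsDegenerateElliptic ω A M ν) (hM : 0 ≤ M) (hν : 0 ≤ ν)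
    (hreal : ∀ t x i j, (A t x i j).im = 0)
    {b : ℝ → RealL2wVec ω →L[ℝ] RealL2wVec ω →L[ℝ] ℝ}
    (hbm : ∀ w w', AEStronglyMeasurable (fun t => b t w w') volume)
    (hbM : ∀ t w w', |b t w w'| ≤ M * ‖w‖ * ‖w'‖)
    (hb : ∀ᵐ t, ∀ w w' : RealL2wVec ω,
      b t w w' = ∫ x, matrixForm (realCoeff ω A t x) (w x) (w' x) ∂(wMeasure ω))
    {α β : ℝ} (hαβ : α < β) {u : Sobolev ω} {g : RealL2w ω}
    (hg : ∀ y ∈ nonnegCone ω, 0 ≤ inner ℝ g y)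
    (hu : ∀ v, inner ℝ (Sobolev.val ω u) (Sobolev.val ω v) +
      ∫ t in α..β, b t (Sobolev.grad ω u) (Sobolev.grad ω v) = inner ℝ g (Sobolev.val ω v)) :
    ∀ y ∈ nonnegCone ω, 0 ≤ inner ℝ (Sobolev.val ω u) y := by
  obtain ⟨B, hB⟩ := exists_integral_form hbm hbM α β
  have hBb : ∀ w w', |B w w'| ≤ M * |β - α| * ‖w‖ * ‖w'‖ := by
    intro w w'
    rw [hB, ← Real.norm_eq_abs]
    refine (intervalIntegral.norm_integral_le_of_norm_le_const
      fun t _ => hbM t w w').trans (le_of_eq (by ring))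
  -- The chain rule is used only on the approximating test functions: `F ∘ φ k` is again a test
  -- function because `F` is smooth with `F 0 = 0`.
  obtain ⟨φ, h, hlim⟩ := u.exists_seq
  have hBF : ∀ k, 0 ≤ B (Sobolev.grad ω (Sobolev.ofTest ω (h k)))
      (Sobolev.grad ω (Sobolev.ofTest ω (h k).negTruncation_comp)) := by
    intro k
    rw [hB]
    refine intervalIntegral.integral_nonneg_of_ae hαβ.le ?_
    filter_upwards [hb] with t ht
    rw [ht]
    exact form_negTruncation_nonneg hA hν hreal t (h k)
  have hgF : ∀ k, inner ℝ g (Sobolev.val ω (Sobolev.ofTest ω (h k).negTruncation_comp)) ≤ 0 := by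
    intro k
    have := hg (-Sobolev.val ω (Sobolev.ofTest ω (h k).negTruncation_comp)) (by
      change ∀ᵐ x ∂(wMeasure ω), _
      filter_upwards [Lp.coeFn_neg (Sobolev.val ω (Sobolev.ofTest ω (h k).negTruncation_comp)),
        ((h k).negTruncation_comp.memLp (ω := ω)).coeFn_toLp] with x e1 e2
      rw [e1, Pi.neg_apply, Sobolev.val_ofTest, e2]
      exact neg_nonneg.2 (negTruncation_nonpos _))
    rw [inner_neg_right] at this
    linarith
  -- Split `∇u = ∇φ k + ∇(u - φ k)` in the first slot: the first part contributes a nonnegative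
  -- form, and the second is small. The gradients of `F ∘ φ k` need only be bounded, not convergent.
  have hle : ∀ k, inner ℝ (Sobolev.val ω u)
      (Sobolev.val ω (Sobolev.ofTest ω (h k).negTruncation_comp)) ≤
      M * |β - α| * ‖Sobolev.grad ω (u - Sobolev.ofTest ω (h k))‖ *
        ‖Sobolev.grad ω (Sobolev.ofTest ω (h k))‖ := by
    intro k
    have h1 := hu (Sobolev.ofTest ω (h k).negTruncation_comp)
    rw [← hB] at h1
    have h2 := hBb (Sobolev.grad ω (u - Sobolev.ofTest ω (h k)))
      (Sobolev.grad ω (Sobolev.ofTest ω (h k).negTruncation_comp))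
    have h3 : M * |β - α| * ‖Sobolev.grad ω (u - Sobolev.ofTest ω (h k))‖ *
        ‖Sobolev.grad ω (Sobolev.ofTest ω (h k).negTruncation_comp)‖ ≤
        M * |β - α| * ‖Sobolev.grad ω (u - Sobolev.ofTest ω (h k))‖ *
        ‖Sobolev.grad ω (Sobolev.ofTest ω (h k))‖ := by
      gcongr
      exact norm_grad_negTruncation_le (h k)
    have h4 : B (Sobolev.grad ω (u - Sobolev.ofTest ω (h k)))
        (Sobolev.grad ω (Sobolev.ofTest ω (h k).negTruncation_comp)) =
        B (Sobolev.grad ω u) (Sobolev.grad ω (Sobolev.ofTest ω (h k).negTruncation_comp)) -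
        B (Sobolev.grad ω (Sobolev.ofTest ω (h k)))
          (Sobolev.grad ω (Sobolev.ofTest ω (h k).negTruncation_comp)) := by
      rw [map_sub, map_sub, _root_.sub_apply]
    have h5 := (abs_le.1 h2).1
    linarith [hBF k, hgF k]
  have hcomp : ∀ k, Sobolev.val ω (Sobolev.ofTest ω (h k).negTruncation_comp) =
      lipschitzWith_negTruncation.compLp negTruncation_zero
        (Sobolev.val ω (Sobolev.ofTest ω (h k))) := by
    intro k
    refine Lp.ext ?_
    filter_upwards [((h k).negTruncation_comp.memLp (ω := ω)).coeFn_toLp,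
      ((h k).memLp (ω := ω)).coeFn_toLp, lipschitzWith_negTruncation.coeFn_compLp
        negTruncation_zero (Sobolev.val ω (Sobolev.ofTest ω (h k)))] with x e1 e2 e3
    rw [e3, Sobolev.val_ofTest, e1, Function.comp_apply, Function.comp_apply,
      Sobolev.val_ofTest, e2]
  have hl1 : Tendsto (fun k => inner ℝ (Sobolev.val ω u)
      (Sobolev.val ω (Sobolev.ofTest ω (h k).negTruncation_comp))) atTop
      (𝓝 (inner ℝ (Sobolev.val ω u)
        (lipschitzWith_negTruncation.compLp negTruncation_zero (Sobolev.val ω u)))) := by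
    simp only [hcomp]
    have hc := (lipschitzWith_negTruncation.continuous_compLp (p := 2) (μ := wMeasure ω)
      negTruncation_zero).comp (Sobolev.val ω).continuous
    exact ((continuous_const.inner hc).tendsto u).comp hlim
  have hl2 : Tendsto (fun k => M * |β - α| * ‖Sobolev.grad ω (u - Sobolev.ofTest ω (h k))‖ *
        ‖Sobolev.grad ω (Sobolev.ofTest ω (h k))‖) atTop (𝓝 0) := by
    have hc : Continuous fun v : Sobolev ω => M * |β - α| * ‖Sobolev.grad ω (u - v)‖ *
        ‖Sobolev.grad ω v‖ := by fun_prop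
    simpa [Function.comp_def] using (hc.tendsto u).comp hlim
  have hnn := ae_nonneg_of_inner_negTruncation_nonpos _ (le_of_tendsto_of_tendsto' hl1 hl2 hle)
  exact fun y hy => inner_nonneg_of_ae hnn hy

end Positivity

/-! ### Space-time test functions as curves in the Sobolev space -/

section TestCurves

variable {n : ℕ} {ω : Space n → ℝ} {E : Type*} [NormedAddCommGroup E]

theorem hasCompactSupport_slice {Ψ : ℝ × Space n → E} (hs : HasCompactSupport Ψ) (t : ℝ) :
    HasCompactSupport fun x => Ψ (t, x) := by
  refine HasCompactSupport.intro (hs.isCompact.image continuous_snd) fun x hx => ?_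
  by_contra hne
  exact hx ⟨(t, x), subset_tsupport _ hne, rfl⟩

theorem IsRealTest.slice {Φ : ℝ × Space n → ℝ} (h : IsRealTest Φ) (t : ℝ) :
    IsRealTest fun x => Φ (t, x) :=
  ⟨h.1.comp (contDiff_prodMk_right t), hasCompactSupport_slice h.2 t⟩

variable [hω : Fact (IsMuckenhouptA2 ω)]

/-- Converts uniform estimates on a fixed compact set, which has finite weighted measure, into
`L²_ω` estimates. -/
theorem norm_toLp_le_of_bound [InnerProductSpace ℝ E] {S : Set (Space n)} (hS : IsCompact S)
    {f : Space n → E} (hf : MemLp f 2 (wMeasure ω)) (hfS : ∀ x ∉ S, f x = 0) {ε : ℝ}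
    (hε : 0 ≤ ε) (hfε : ∀ x, ‖f x‖ ≤ ε) :
    ‖hf.toLp f‖ ≤ ε * √((wMeasure ω).real S) := by
  refine (sq_le_sq₀ (norm_nonneg _) (by positivity)).1 ?_
  rw [norm_toLp_sq, mul_pow, Real.sq_sqrt measureReal_nonneg]
  have hi : Integrable (S.indicator fun _ => ε ^ 2) (wMeasure ω) :=
    (integrable_indicator_iff hS.measurableSet).2 (integrableOn_const hS.measure_lt_top.ne)
  refine (integral_mono ((memLp_two_iff_integrable_sq_norm hf.1).1 hf) hi fun x => ?_).trans ?_
  · by_cases hx : x ∈ S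
    · rw [indicator_of_mem hx]
      exact pow_le_pow_left₀ (norm_nonneg _) (hfε x) 2
    · rw [indicator_of_notMem hx, hfS x hx]
      simp
  · rw [integral_indicator hS.measurableSet, setIntegral_const, smul_eq_mul, mul_comm]

theorem memLp_slice {Ψ : ℝ × Space n → E} (hΨ : Continuous Ψ) (hs : HasCompactSupport Ψ)
    (t : ℝ) : MemLp (fun x => Ψ (t, x)) 2 (wMeasure ω) :=
  Continuous.memLp_of_hasCompactSupport (by fun_prop) (hasCompactSupport_slice hs t)

/-- The slice `Ψ(t, ·)` as an element of `L²_ω`. -/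
def lpSlice (ω : Space n → ℝ) [Fact (IsMuckenhouptA2 ω)] {Ψ : ℝ × Space n → E}
    (hΨ : Continuous Ψ) (hs : HasCompactSupport Ψ) (t : ℝ) : Lp E 2 (wMeasure ω) :=
  (memLp_slice hΨ hs t).toLp fun x => Ψ (t, x)

theorem lpSlice_ae {Ψ : ℝ × Space n → E} (hΨ : Continuous Ψ) (hs : HasCompactSupport Ψ) (t : ℝ) :
    ∀ᵐ x ∂(wMeasure ω), lpSlice ω hΨ hs t x = Ψ (t, x) :=
  (memLp_slice hΨ hs t).coeFn_toLp

theorem hasCompactSupport_lpSlice {Ψ : ℝ × Space n → E} (hΨ : Continuous Ψ)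
    (hs : HasCompactSupport Ψ) : HasCompactSupport (lpSlice ω hΨ hs) := by
  refine HasCompactSupport.intro (hs.isCompact.image continuous_fst) fun t ht => ?_
  refine Lp.ext ?_
  filter_upwards [lpSlice_ae (ω := ω) hΨ hs t, Lp.coeFn_zero E 2 (wMeasure ω)] with x h1 h2
  rw [h1, h2]
  by_contra hne
  exact ht ⟨(t, x), subset_tsupport _ hne, rfl⟩

theorem exists_slice_modulus {Ψ : ℝ × Space n → E} (hΨ : Continuous Ψ)
    (hs : HasCompactSupport Ψ) {ε : ℝ} (hε : 0 < ε) :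
    ∃ δ > 0, ∀ s t, |s - t| < δ → ∀ x, ‖Ψ (s, x) - Ψ (t, x)‖ ≤ ε := by
  obtain ⟨δ, hδ, h⟩ := Metric.uniformContinuous_iff.1
    (hs.uniformContinuous_of_continuous hΨ) ε hε
  refine ⟨δ, hδ, fun s t hst x => ?_⟩
  rw [← dist_eq_norm]
  refine (h ?_).le
  rw [Prod.dist_eq, dist_self, Real.dist_eq]
  exact max_lt hst hδ

theorem slice_eq_zero {Ψ : ℝ × Space n → E} {x : Space n}
    (hx : x ∉ Prod.snd '' tsupport Ψ) (t : ℝ) : Ψ (t, x) = 0 := by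
  by_contra hne
  exact hx ⟨(t, x), subset_tsupport _ hne, rfl⟩

theorem continuous_lpSlice [InnerProductSpace ℝ E] {Ψ : ℝ × Space n → E} (hΨ : Continuous Ψ)
    (hs : HasCompactSupport Ψ) : Continuous (lpSlice ω hΨ hs) := by
  have hS := hs.isCompact.image continuous_snd
  set C := √((wMeasure ω).real (Prod.snd '' tsupport Ψ))
  refine Metric.continuous_iff.2 fun t ε hε => ?_
  obtain ⟨δ, hδ, h⟩ := exists_slice_modulus hΨ hs (ε := ε / (2 * (C + 1))) (by positivity)
  refine ⟨δ, hδ, fun s hst => ?_⟩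
  rw [dist_eq_norm, lpSlice, lpSlice, ← MemLp.toLp_sub]
  refine (norm_toLp_le_of_bound hS _ (fun x hx => ?_) (ε := ε / (2 * (C + 1))) (by positivity)
    (h s t (by rwa [← Real.dist_eq]))).trans_lt ?_
  · simp [slice_eq_zero hx]
  · have hC : 0 ≤ C := Real.sqrt_nonneg _
    rw [div_mul_eq_mul_div, div_lt_iff₀ (by positivity)]
    nlinarith

theorem hasDerivAt_lpSlice [InnerProductSpace ℝ E] {Φ Ψ : ℝ × Space n → E} (hΦ : Continuous Φ)
    (hΦs : HasCompactSupport Φ) (hΨ : Continuous Ψ) (hΨs : HasCompactSupport Ψ)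
    (hd : ∀ t x, HasDerivAt (fun s => Φ (s, x)) (Ψ (t, x)) t) (t : ℝ) :
    HasDerivAt (lpSlice ω hΦ hΦs) (lpSlice ω hΨ hΨs t) t := by
  have hS := (hΦs.isCompact.image continuous_snd).union (hΨs.isCompact.image continuous_snd)
  set S := Prod.snd '' tsupport Φ ∪ Prod.snd '' tsupport Ψ
  set C := √((wMeasure ω).real S)
  have hC : 0 ≤ C := Real.sqrt_nonneg _
  rw [hasDerivAt_iff_isLittleO, Asymptotics.isLittleO_iff]
  intro ε hε
  obtain ⟨δ, hδ, h⟩ := exists_slice_modulus hΨ hΨs (ε := ε / (C + 1)) (by positivity)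
  filter_upwards [Metric.ball_mem_nhds t hδ] with s hs
  have hpt : ∀ x, ‖Φ (s, x) - Φ (t, x) - (s - t) • Ψ (t, x)‖ ≤ ε / (C + 1) * ‖s - t‖ := by
    intro x
    -- Mean value inequality for `r ↦ Φ (r, x) - r • Ψ (t, x)`, whose derivative is at most `ε / (C
    -- + 1)` near `t`, uniformly in `x`.
    have h1 := Convex.norm_image_sub_le_of_norm_hasDerivWithin_le (𝕜 := ℝ)
      (f := fun r => Φ (r, x) - r • Ψ (t, x)) (f' := fun r => Ψ (r, x) - Ψ (t, x))
      (s := Metric.ball t δ) (C := ε / (C + 1)) (x := t) (y := s)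
      (fun r _ => by
        have h2 := (hd r x).sub ((hasDerivAt_id r).smul_const (Ψ (t, x)))
        rw [one_smul] at h2
        exact h2.hasDerivWithinAt)
      (fun r hr => h r t (by rwa [← Real.dist_eq]) x) (convex_ball t δ)
      (Metric.mem_ball_self hδ) hs
    refine le_trans (le_of_eq ?_) h1
    congr 1
    rw [sub_smul]
    abel
  rw [lpSlice, lpSlice, lpSlice, ← MemLp.toLp_sub, ← MemLp.toLp_const_smul, ← MemLp.toLp_sub]
  refine (norm_toLp_le_of_bound hS _ (fun x hx => ?_) (by positivity) hpt).trans ?_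
  · simp only [S, mem_union, not_or] at hx
    simp [slice_eq_zero hx.1, slice_eq_zero hx.2]
  · calc ε / (C + 1) * ‖s - t‖ * C = ε * ‖s - t‖ * (C / (C + 1)) := by ring
      _ ≤ ε * ‖s - t‖ * 1 := by
        gcongr
        rw [div_le_one (by positivity)]
        linarith
      _ = ε * ‖s - t‖ := mul_one _

theorem Sobolev.ext {v w : Sobolev ω} (h1 : Sobolev.val ω v = Sobolev.val ω w)
    (h2 : Sobolev.grad ω v = Sobolev.grad ω w) : v = w := by
  rw [← sub_eq_zero, ← norm_eq_zero, ← sq_eq_zero_iff, Sobolev.norm_sq, map_sub, map_sub, h1, h2]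
  simp

/-- The spatial gradient of a function on space-time. -/
def spatialGradient (Φ : ℝ × Space n → ℝ) (p : ℝ × Space n) : Space n :=
  gradient (fun x => Φ (p.1, x)) p.2

/-- The time derivative of a real function on space-time. -/
def realTimeDeriv (Φ : ℝ × Space n → ℝ) (p : ℝ × Space n) : ℝ := fderiv ℝ Φ p (1, 0)

theorem spatialGradient_apply {Φ : ℝ × Space n → ℝ} (h : IsRealTest Φ) (t : ℝ) (x : Space n)
    (i : Fin n) :
    spatialGradient Φ (t, x) i = fderiv ℝ Φ (t, x) (0, EuclideanSpace.single i 1) := by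
  have hd : HasFDerivAt (fun x => Φ (t, x))
      ((fderiv ℝ Φ (t, x)).comp (ContinuousLinearMap.inr ℝ ℝ (Space n))) x :=
    (h.differentiable (t, x)).hasFDerivAt.comp x (hasFDerivAt_prodMk_right t x)
  rw [spatialGradient, gradient_apply, hd.fderiv]
  rfl

theorem hasDerivAt_slice {Φ : ℝ × Space n → ℝ} (h : IsRealTest Φ) (t : ℝ) (x : Space n) :
    HasDerivAt (fun s => Φ (s, x)) (realTimeDeriv Φ (t, x)) t := by
  have hd : HasDerivAt (fun s : ℝ => (s, x)) (1, 0) t :=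
    (hasDerivAt_id t).prodMk (hasDerivAt_const t x)
  exact (h.differentiable (t, x)).hasFDerivAt.comp_hasDerivAt t hd

theorem IsRealTest.continuous_spatialGradient {Φ : ℝ × Space n → ℝ} (h : IsRealTest Φ) :
    Continuous (spatialGradient Φ) := by
  refine (PiLp.continuous_toLp 2 _).comp (continuous_pi fun i => ?_)
    |>.congr (f := fun p => WithLp.toLp 2 fun i =>
      fderiv ℝ Φ p (0, EuclideanSpace.single i 1)) fun p => ?_
  · exact h.continuous_fderiv.clm_apply continuous_const
  · ext i
    exact (spatialGradient_apply h p.1 p.2 i).symm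

theorem IsRealTest.hasCompactSupport_spatialGradient {Φ : ℝ × Space n → ℝ} (h : IsRealTest Φ) :
    HasCompactSupport (spatialGradient Φ) := by
  refine HasCompactSupport.intro (h.2.fderiv ℝ).isCompact fun p hp => ?_
  ext i
  rw [spatialGradient_apply h, image_eq_zero_of_notMem_tsupport hp]
  rfl

theorem IsRealTest.continuous_realTimeDeriv {Φ : ℝ × Space n → ℝ} (h : IsRealTest Φ) :
    Continuous (realTimeDeriv Φ) :=
  h.continuous_fderiv.clm_apply continuous_const

theorem IsRealTest.hasCompactSupport_realTimeDeriv {Φ : ℝ × Space n → ℝ} (h : IsRealTest Φ) :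
    HasCompactSupport (realTimeDeriv Φ) :=
  (h.2.fderiv ℝ).comp_left (g := fun L : ℝ × Space n →L[ℝ] ℝ => L (1, 0)) rfl

/-- A test function on space-time as a curve in the Sobolev space. -/
def testCurve (ω : Space n → ℝ) [Fact (IsMuckenhouptA2 ω)] {Φ : ℝ × Space n → ℝ}
    (h : IsRealTest Φ) (t : ℝ) : Sobolev ω := Sobolev.ofTest ω (h.slice t)

theorem val_testCurve {Φ : ℝ × Space n → ℝ} (h : IsRealTest Φ) (t : ℝ) :
    Sobolev.val ω (testCurve ω h t) = lpSlice ω h.continuous h.2 t := rfl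

theorem grad_testCurve {Φ : ℝ × Space n → ℝ} (h : IsRealTest Φ) (t : ℝ) :
    Sobolev.grad ω (testCurve ω h t) =
      lpSlice ω h.continuous_spatialGradient h.hasCompactSupport_spatialGradient t := rfl

theorem continuous_testCurve {Φ : ℝ × Space n → ℝ} (h : IsRealTest Φ) :
    Continuous (testCurve ω h) := by
  refine Continuous.subtype_mk ?_ _
  exact (WithLp.prod_continuous_toLp 2 _ _).comp
    ((continuous_lpSlice h.continuous h.2).prodMk
      (continuous_lpSlice h.continuous_spatialGradient h.hasCompactSupport_spatialGradient))

theorem hasCompactSupport_testCurve {Φ : ℝ × Space n → ℝ} (h : IsRealTest Φ) :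
    HasCompactSupport (testCurve ω h) := by
  have h1 := hasCompactSupport_lpSlice (ω := ω) h.continuous h.2
  have h2 := hasCompactSupport_lpSlice (ω := ω) h.continuous_spatialGradient
    h.hasCompactSupport_spatialGradient
  refine HasCompactSupport.intro (h1.isCompact.union h2.isCompact) fun t ht => ?_
  rw [mem_union, not_or] at ht
  refine Sobolev.ext ?_ ?_
  · rw [val_testCurve, image_eq_zero_of_notMem_tsupport ht.1, map_zero]
  · rw [grad_testCurve, image_eq_zero_of_notMem_tsupport ht.2, map_zero]

theorem hasDerivAt_val_testCurve {Φ : ℝ × Space n → ℝ} (h : IsRealTest Φ) (t : ℝ) :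
    HasDerivAt (fun t => Sobolev.val ω (testCurve ω h t))
      (lpSlice ω h.continuous_realTimeDeriv h.hasCompactSupport_realTimeDeriv t) t :=
  hasDerivAt_lpSlice h.continuous h.2 _ _ (hasDerivAt_slice h) t

end TestCurves

/-! ### From the real abstract solution to complex energy solutions -/

section EnergySolution

variable {n : ℕ} {ω : Space n → ℝ} {A : ℝ → Space n → Matrix (Fin n) (Fin n) ℂ} {M ν : ℝ}

theorem innerw_toComplex (f y : RealL2w ω) :
    innerw (toComplex ω f) (toComplex ω y) = ((inner ℝ f y : ℝ) : ℂ) := by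
  rw [innerw, L2.inner_def, L2.inner_def, ← integral_complex_ofReal]
  refine integral_congr_ae ?_
  filter_upwards [toComplex_ae f, toComplex_ae y] with x e1 e2
  rw [e1, e2]
  simp [mul_comm]

theorem integral_ofReal_add_ofReal_mul_I {α : Type*} [MeasurableSpace α] {μ : Measure α}
    {f g : α → ℝ} (hf : Integrable f μ) (hg : Integrable g μ) :
    ∫ x, ((f x : ℂ) + (g x : ℂ) * Complex.I) ∂μ =
      ((∫ x, f x ∂μ : ℝ) : ℂ) + ((∫ x, g x ∂μ : ℝ) : ℂ) * Complex.I := by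
  rw [integral_add hf.ofReal (hg.ofReal.mul_const _), integral_mul_const,
    integral_complex_ofReal,
    integral_complex_ofReal]

section Components

variable {X : Type*} [NormedAddCommGroup X] [NormedSpace ℝ X] {Φ : X → ℂ}

theorem IsTestFunction.re (h : IsTestFunction Φ) : IsRealTest fun x => (Φ x).re :=
  ⟨Complex.reCLM.contDiff.comp h.1, h.2.comp_left (g := Complex.re) rfl⟩

theorem IsTestFunction.im (h : IsTestFunction Φ) : IsRealTest fun x => (Φ x).im :=
  ⟨Complex.imCLM.contDiff.comp h.1, h.2.comp_left (g := Complex.im) rfl⟩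

theorem IsTestFunction.fderiv_eq (h : IsTestFunction Φ) (x v : X) :
    fderiv ℝ Φ x v = ((fderiv ℝ (fun x => (Φ x).re) x v : ℝ) : ℂ) +
      ((fderiv ℝ (fun x => (Φ x).im) x v : ℝ) : ℂ) * Complex.I := by
  have hd : HasFDerivAt Φ (fderiv ℝ Φ x) x := (h.1.differentiable (by simp) x).hasFDerivAt
  have h1 := (Complex.reCLM.hasFDerivAt.comp x hd).fderiv
  have h2 := (Complex.imCLM.hasFDerivAt.comp x hd).fderiv
  change fderiv ℝ (fun x => (Φ x).re) x = _ at h1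
  change fderiv ℝ (fun x => (Φ x).im) x = _ at h2
  rw [h1, h2]
  exact (Complex.re_add_im _).symm

end Components

variable [hω : Fact (IsMuckenhouptA2 ω)]

theorem inner_lpSlice (f : RealL2w ω) {Ψ : ℝ × Space n → ℝ} (hΨ : Continuous Ψ)
    (hs : HasCompactSupport Ψ) (t : ℝ) :
    Integrable (fun x => f x * Ψ (t, x)) (wMeasure ω) ∧
      ∫ x, f x * Ψ (t, x) ∂(wMeasure ω) = inner ℝ f (lpSlice ω hΨ hs t) := by
  have h1 := L2.integrable_inner (𝕜 := ℝ) f (lpSlice ω hΨ hs t)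
  have h2 : (fun x => inner ℝ (f x) (lpSlice ω hΨ hs t x)) =ᵐ[wMeasure ω]
      fun x => f x * Ψ (t, x) := by
    filter_upwards [lpSlice_ae (ω := ω) hΨ hs t] with x hx
    rw [hx]
    simp [mul_comm]
  exact ⟨h1.congr h2, by rw [L2.inner_def, integral_congr_ae h2]⟩

/-- For `L²`-fields `f`, `g`, the density of the weak formulation tested against `Φ`. -/
theorem integral_density_eq {b : RealL2wVec ω →L[ℝ] RealL2wVec ω →L[ℝ] ℝ} {t : ℝ}
    (hb : ∀ w w' : RealL2wVec ω,
      Integrable (fun x => matrixForm (realCoeff ω A t x) (w x) (w' x)) (wMeasure ω) ∧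
      b w w' = ∫ x, matrixForm (realCoeff ω A t x) (w x) (w' x) ∂(wMeasure ω))
    (hreal : ∀ t x i j, (A t x i j).im = 0) (f : RealL2w ω) (g : RealL2wVec ω)
    {Φ : ℝ × Space n → ℂ} (hΦ : IsTestFunction Φ) :
    ∫ x, (-(toComplex ω f x * timeDeriv Φ t x) + ((ω x)⁻¹ : ℂ) *
        ((A t x *ᵥ (toComplexVec ω g x).ofLp) ⬝ᵥ spaceGrad Φ t x)) ∂(wMeasure ω) =
      ((-inner ℝ f (lpSlice ω hΦ.re.continuous_realTimeDeriv
          hΦ.re.hasCompactSupport_realTimeDeriv t) +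
        b g (Sobolev.grad ω (testCurve ω hΦ.re t)) : ℝ) : ℂ) +
      ((-inner ℝ f (lpSlice ω hΦ.im.continuous_realTimeDeriv
          hΦ.im.hasCompactSupport_realTimeDeriv t) +
        b g (Sobolev.grad ω (testCurve ω hΦ.im t)) : ℝ) : ℂ) * Complex.I := by
  -- The pairing is bilinear, not sesquilinear, in the test function, so real and imaginary parts
  -- can be treated separately and recombined without conjugation.
  have key : ∀ {Ψ : ℝ × Space n → ℝ} (hΨ : IsRealTest Ψ),
      Integrable (fun x => -(f x * realTimeDeriv Ψ (t, x)) +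
        matrixForm (realCoeff ω A t x) (g x) (spatialGradient Ψ (t, x))) (wMeasure ω) ∧
      ∫ x, (-(f x * realTimeDeriv Ψ (t, x)) +
        matrixForm (realCoeff ω A t x) (g x) (spatialGradient Ψ (t, x))) ∂(wMeasure ω) =
      -inner ℝ f (lpSlice ω hΨ.continuous_realTimeDeriv hΨ.hasCompactSupport_realTimeDeriv t) +
        b g (Sobolev.grad ω (testCurve ω hΨ t)) := by
    intro Ψ hΨ
    have h1 := inner_lpSlice f hΨ.continuous_realTimeDeriv hΨ.hasCompactSupport_realTimeDeriv t
    have h2 := hb g (Sobolev.grad ω (testCurve ω hΨ t))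
    have h3 : (fun x => matrixForm (realCoeff ω A t x) (g x)
        (Sobolev.grad ω (testCurve ω hΨ t) x)) =ᵐ[wMeasure ω]
        fun x => matrixForm (realCoeff ω A t x) (g x) (spatialGradient Ψ (t, x)) := by
      filter_upwards [lpSlice_ae (ω := ω) hΨ.continuous_spatialGradient
        hΨ.hasCompactSupport_spatialGradient t] with x hx
      rw [grad_testCurve, hx]
    have h4 : Integrable (fun x => -(f x * realTimeDeriv Ψ (t, x))) (wMeasure ω) := h1.1.neg
    have h5 := h2.1.congr h3
    refine ⟨h4.add h5, ?_⟩
    rw [integral_add h4 h5, integral_neg, h1.2, h2.2, integral_congr_ae h3]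
  rw [← (key hΦ.re).2, ← (key hΦ.im).2,
    ← integral_ofReal_add_ofReal_mul_I (key hΦ.re).1 (key hΦ.im).1]
  refine integral_congr_ae ?_
  filter_upwards [toComplex_ae f, toComplexVec_ae g] with x e1 e2
  have hT : timeDeriv Φ t x = ((realTimeDeriv (fun p => (Φ p).re) (t, x) : ℝ) : ℂ) +
      ((realTimeDeriv (fun p => (Φ p).im) (t, x) : ℝ) : ℂ) * Complex.I :=
    hΦ.fderiv_eq (t, x) (1, 0)
  have hS : spaceGrad Φ t x =
      (vecToComplex n (spatialGradient (fun p => (Φ p).re) (t, x))).ofLp +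
      Complex.I • (vecToComplex n (spatialGradient (fun p => (Φ p).im) (t, x))).ofLp := by
    funext i
    rw [Pi.add_apply, Pi.smul_apply, vecToComplex_apply, vecToComplex_apply,
      spatialGradient_apply hΦ.re, spatialGradient_apply hΦ.im, smul_eq_mul, mul_comm]
    exact hΦ.fderiv_eq (t, x) (0, EuclideanSpace.single i 1)
  have hne : (ω x : ℂ) ≠ 0 := by exact_mod_cast (hω.out.pos x).ne'
  rw [e1, e2, hT, hS, dotProduct_add, dotProduct_smul,
    mulVec_dotProduct_vecToComplex hω.out.pos hreal,
    mulVec_dotProduct_vecToComplex hω.out.pos hreal, smul_eq_mul]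
  push_cast
  field_simp
  ring

theorem integral_source_eq (c : ℝ) (ψ : RealL2w ω) {Φ : ℝ × Space n → ℂ}
    (hΦ : IsTestFunction Φ) (t : ℝ) :
    ∫ x, (c : ℂ) * toComplex ω ψ x * Φ (t, x) ∂(wMeasure ω) =
      ((c * inner ℝ ψ (Sobolev.val ω (testCurve ω hΦ.re t)) : ℝ) : ℂ) +
      ((c * inner ℝ ψ (Sobolev.val ω (testCurve ω hΦ.im t)) : ℝ) : ℂ) * Complex.I := by
  have h1 := inner_lpSlice ψ hΦ.re.continuous hΦ.re.2 t
  have h2 := inner_lpSlice ψ hΦ.im.continuous hΦ.im.2 t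
  rw [val_testCurve, val_testCurve, ← h1.2, ← h2.2, ← integral_const_mul, ← integral_const_mul,
    ← integral_ofReal_add_ofReal_mul_I (h1.1.const_mul c) (h2.1.const_mul c)]
  refine integral_congr_ae ?_
  filter_upwards [toComplex_ae ψ] with x e1
  rw [e1]
  conv_lhs => rw [← Complex.re_add_im (Φ (t, x))]
  push_cast
  ring

/-- Existence of nonnegative energy solutions for nonnegative right-hand sides. -/
theorem exists_nonneg_energy_solution (hM : 0 ≤ M) (hν : 0 < ν)
    (hA : IsDegenerateElliptic ω A M ν) (hreal : ∀ t x i j, (A t x i j).im = 0)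
    {c : ℝ → ℝ} (hc : Continuous c) (hcs : HasCompactSupport c) (hc0 : ∀ t, 0 ≤ c t)
    {ψ : RealL2w ω} (hψ : ψ ∈ nonnegCone ω) :
    ∃ (f : ℝ → RealL2w ω) (G : ℝ → L2wVec ω),
      IsEnergyFunction (fun t => toComplex ω (f t)) G ∧
      IsDistributionalSolution A (fun t => toComplex ω (f t)) G (fun t => (c t : ℂ))
        (toComplex ω ψ) ∧
      ∀ y ∈ nonnegCone ω, ∀ᵐ t, 0 ≤ inner ℝ (f t) y := by
  obtain ⟨b, hbm, hbM, hbν, hb⟩ := exists_coefficient_form hM hA hreal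
  obtain ⟨z, hz, hDz, hpos, heq⟩ := exists_weak_solution (j := Sobolev.val ω)
    (D := Sobolev.grad ω) (ψ := ψ) (Y := nonnegCone ω) (fun v => (Sobolev.norm_sq v).le) hM hν
    hbm hbM hbν hc hcs hc0 (fun y hy => inner_nonneg_of_ae hψ hy)
    (fun α β hαβ u g hg hu => euler_step_nonneg hA hM hν.le hreal hbm hbM
      (hb.mono fun t ht w w' => (ht w w').2) hαβ hg hu)
  refine ⟨fun t => Sobolev.val ω (z t), fun t => toComplexVec ω (Sobolev.grad ω (z t)),
    ⟨?_, Eventually.of_forall fun t => (z t).isWeakGradient, ?_⟩, fun Φ hΦ => ?_, hpos⟩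
  · have := ((toComplex ω).comp (Sobolev.val ω)).locallyIntegrableOn_comp
      (locallyIntegrableOn_univ.2 hz)
    exact locallyIntegrableOn_univ.1 this
  · exact (toComplexVec ω).comp_memLp' hDz
  · have h1 := heq _ _ (continuous_testCurve (ω := ω) hΦ.re) (hasCompactSupport_testCurve hΦ.re)
      (continuous_lpSlice hΦ.re.continuous_realTimeDeriv hΦ.re.hasCompactSupport_realTimeDeriv)
      (hasCompactSupport_lpSlice _ _) (hasDerivAt_val_testCurve hΦ.re)
    have h2 := heq _ _ (continuous_testCurve (ω := ω) hΦ.im) (hasCompactSupport_testCurve hΦ.im)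
      (continuous_lpSlice hΦ.im.continuous_realTimeDeriv hΦ.im.hasCompactSupport_realTimeDeriv)
      (hasCompactSupport_lpSlice _ _) (hasDerivAt_val_testCurve hΦ.im)
    have hi : ∀ {Ψ : ℝ × Space n → ℝ} (hΨ : IsRealTest Ψ),
        Integrable fun t => c t * inner ℝ ψ (Sobolev.val ω (testCurve ω hΨ t)) := by
      intro Ψ hΨ
      have hcc := continuous_testCurve (ω := ω) hΨ
      exact Continuous.integrable_of_hasCompactSupport (by fun_prop) hcs.mul_right
    rw [integral_congr_ae (hb.mono fun t ht => integral_density_eq ht hreal (Sobolev.val ω (z t))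
      (Sobolev.grad ω (z t)) hΦ), integral_ofReal_add_ofReal_mul_I h1.1 h2.1, h1.2, h2.2]
    simp only [integral_source_eq _ ψ hΦ]
    rw [integral_ofReal_add_ofReal_mul_I (hi hΦ.re) (hi hΦ.im)]

end EnergySolution

/-! ### Positivity of the fundamental solution -/

section FundamentalSolution

/-- The nonnegative real half-line in `ℂ`. -/
def nonnegRay : Set ℂ := {z | z.im = 0 ∧ 0 ≤ z.re}

theorem isClosed_nonnegRay : IsClosed nonnegRay :=
  (isClosed_eq Complex.continuous_im continuous_const).inter
    (isClosed_le continuous_const Complex.continuous_re)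

theorem ofReal_mem_nonnegRay {r : ℝ} (hr : 0 ≤ r) : (r : ℂ) ∈ nonnegRay :=
  ⟨Complex.ofReal_im r, by simpa using hr⟩

/-- Smooth approximations of the identity on the line. -/
def lineBump (m : ℕ) : ContDiffBump (0 : ℝ) where
  rIn := mesh m / 2
  rOut := mesh m
  rIn_pos := half_pos (mesh_pos m)
  rIn_lt_rOut := half_lt_self (mesh_pos m)

/-- The smooth probability density `lineBump m`, centred at `s₀`. -/
def lineDensity (s₀ : ℝ) (m : ℕ) (s : ℝ) : ℝ := (lineBump m).normed volume (s₀ - s)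

theorem lineDensity_nonneg (s₀ : ℝ) (m : ℕ) (s : ℝ) : 0 ≤ lineDensity s₀ m s :=
  (lineBump m).nonneg_normed _

theorem isRealTest_lineDensity (s₀ : ℝ) (m : ℕ) : IsRealTest (lineDensity s₀ m) :=
  ⟨(lineBump m).contDiff_normed.comp (contDiff_const.sub contDiff_id),
    (lineBump m).hasCompactSupport_normed.comp_homeomorph (Homeomorph.subLeft s₀)⟩

/-- Strict inequality `s₀ < t` makes the truncated function `1_{(-∞, t)} g` continuous at `s₀`; its
convolution with the bumps then tends to its value there. -/
theorem tendsto_setIntegral_lineDensity {g : ℝ → ℂ} {s₀ t : ℝ} (hst : s₀ < t)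
    (hg : ContinuousOn g (Iic t)) :
    Tendsto (fun m => ∫ s in Iio t, (lineDensity s₀ m s : ℂ) * g s) atTop (𝓝 (g s₀)) := by
  have hgm : AEStronglyMeasurable ((Iio t).indicator g) volume := by
    rw [aestronglyMeasurable_indicator_iff measurableSet_Iio]
    exact (hg.mono Iio_subset_Iic_self).aestronglyMeasurable measurableSet_Iio
  have hgc : ContinuousAt ((Iio t).indicator g) s₀ := by
    refine (hg.continuousAt (Iic_mem_nhds hst)).congr ?_
    filter_upwards [Iio_mem_nhds hst] with s hs
    rw [indicator_of_mem hs]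
  have hlim := ContDiffBump.convolution_tendsto_right (φ := lineBump)
    (g := fun _ => (Iio t).indicator g) (k := fun _ => s₀) (x₀ := s₀)
    (z₀ := (Iio t).indicator g s₀) (l := atTop) (μ := volume) tendsto_mesh
    (Eventually.of_forall fun _ => hgm) (hgc.tendsto.comp tendsto_snd) tendsto_const_nhds
  rw [indicator_of_mem (mem_Iio.2 hst)] at hlim
  refine hlim.congr fun m => ?_
  rw [convolution_eq_swap, ← integral_indicator measurableSet_Iio]
  refine integral_congr_ae (Eventually.of_forall fun s => ?_)
  by_cases hs : s ∈ Iio t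
  · simp [indicator_of_mem hs, lineDensity]
  · simp [indicator_of_notMem hs]

variable {n : ℕ} {ω : Space n → ℝ} {A : ℝ → Space n → Matrix (Fin n) (Fin n) ℂ} {M ν : ℝ}

/-- Self-duality of the cone, seen by testing with `-F(f)`, which is a member of the cone. -/
theorem ae_nonneg_of_forall_inner_nonneg {f : RealL2w ω}
    (hf : ∀ y ∈ nonnegCone ω, 0 ≤ inner ℝ f y) : ∀ᵐ x ∂(wMeasure ω), 0 ≤ f x := by
  refine ae_nonneg_of_inner_negTruncation_nonpos f ?_
  have := hf (-lipschitzWith_negTruncation.compLp negTruncation_zero f) (by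
    change ∀ᵐ x ∂(wMeasure ω), _
    filter_upwards [Lp.coeFn_neg (lipschitzWith_negTruncation.compLp negTruncation_zero f),
      lipschitzWith_negTruncation.coeFn_compLp negTruncation_zero f] with x e1 e2
    rw [e1, Pi.neg_apply, e2]
    exact neg_nonneg.2 (negTruncation_nonpos _))
  rw [inner_neg_right] at this
  linarith

/-- Real part of an element of `L²_ω`. -/
def rePart (f : L2w ω) : RealL2w ω := Complex.reCLM.compLpL 2 (wMeasure ω) f

/-- Imaginary part of an element of `L²_ω`. -/
def imPart (f : L2w ω) : RealL2w ω := Complex.imCLM.compLpL 2 (wMeasure ω) f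

theorem rePart_ae (f : L2w ω) : ∀ᵐ x ∂(wMeasure ω), rePart f x = (f x).re :=
  Complex.reCLM.coeFn_compLpL f

theorem imPart_ae (f : L2w ω) : ∀ᵐ x ∂(wMeasure ω), imPart f x = (f x).im :=
  Complex.imCLM.coeFn_compLpL f

theorem eq_rePart_add_imPart (f : L2w ω) :
    f = toComplex ω (rePart f) + Complex.I • toComplex ω (imPart f) := by
  refine Lp.ext ?_
  filter_upwards [rePart_ae f, imPart_ae f, toComplex_ae (rePart f), toComplex_ae (imPart f),
    Lp.coeFn_add (toComplex ω (rePart f)) (Complex.I • toComplex ω (imPart f)),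
    Lp.coeFn_smul Complex.I (toComplex ω (imPart f))] with x e1 e2 e3 e4 e5 e6
  rw [e5, Pi.add_apply, e6, Pi.smul_apply, e3, e4, e1, e2, smul_eq_mul, mul_comm,
    Complex.re_add_im]

theorem IsRealNonneg.exists_toComplex {f : L2w ω} (hf : IsRealNonneg f) :
    ∃ g ∈ nonnegCone ω, f = toComplex ω g := by
  refine ⟨rePart f, ?_, Lp.ext ?_⟩
  · change ∀ᵐ x ∂(wMeasure ω), _
    filter_upwards [hf, rePart_ae f] with x h1 h2
    rw [h2]
    exact h1.2
  · filter_upwards [hf, rePart_ae f, toComplex_ae (rePart f)] with x h1 h2 h3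
    rw [h3, h2]
    exact Complex.ext (by simp) (by simpa using h1.1)

theorem isRealNonneg_of_forall_innerw {f : L2w ω}
    (hf : ∀ y ∈ nonnegCone ω, innerw f (toComplex ω y) ∈ nonnegRay) : IsRealNonneg f := by
  have key : ∀ y, innerw f (toComplex ω y) = ((inner ℝ (rePart f) y : ℝ) : ℂ) +
      Complex.I * ((inner ℝ (imPart f) y : ℝ) : ℂ) := by
    intro y
    rw [← innerw_toComplex, ← innerw_toComplex]
    conv_lhs => rw [eq_rePart_add_imPart f]
    rw [innerw, innerw, innerw, inner_add_right, inner_smul_right]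
  have hre : ∀ y ∈ nonnegCone ω, 0 ≤ inner ℝ (rePart f) y := fun y hy => by
    simpa [key] using (hf y hy).2
  -- Both the imaginary part and its negative thus pair nonnegatively with the cone, so the
  -- imaginary part vanishes.
  have him : ∀ y ∈ nonnegCone ω, inner ℝ (imPart f) y = 0 := fun y hy => by
    simpa [key] using (hf y hy).1
  filter_upwards [rePart_ae f, imPart_ae f, ae_nonneg_of_forall_inner_nonneg hre,
    ae_nonneg_of_forall_inner_nonneg fun y hy => (him y hy).ge,
    ae_nonneg_of_forall_inner_nonneg (f := -imPart f) fun y hy => by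
      rw [inner_neg_left, him y hy, neg_zero], Lp.coeFn_neg (imPart f)] with x h1 h2 h3 h4 h5 h6
  rw [h6, Pi.neg_apply] at h5
  rw [← h1, ← h2]
  exact ⟨by linarith, h3⟩

variable [hω : Fact (IsMuckenhouptA2 ω)]

theorem isTestClass_toComplex {φ : Space n → ℝ} (h : IsRealTest φ) :
    IsTestClass (toComplex ω (h.memLp.toLp φ)) := by
  refine ⟨fun x => (φ x : ℂ), ⟨Complex.ofRealCLM.contDiff.comp h.1,
    h.2.comp_left Complex.ofReal_zero⟩, ?_⟩
  filter_upwards [toComplex_ae (ω := ω) (h.memLp.toLp φ), h.memLp.coeFn_toLp] with x e1 e2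
  rw [e1, e2]

/-- Nonnegative test functions in `L²_ω`. -/
def nonnegTests (ω : Space n → ℝ) [Fact (IsMuckenhouptA2 ω)] : Set (RealL2w ω) :=
  {y | ∃ (φ : Space n → ℝ) (h : IsRealTest φ), (∀ x, 0 ≤ φ x) ∧ y = h.memLp.toLp φ}

theorem nonnegTests_subset : nonnegTests ω ⊆ nonnegCone ω := by
  rintro _ ⟨φ, h, hφ, rfl⟩
  change ∀ᵐ x ∂(wMeasure ω), _
  filter_upwards [h.memLp.coeFn_toLp] with x hx
  rw [hx]
  exact hφ x

/-- A smooth approximation of the absolute value. -/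
def smoothAbs (δ x : ℝ) : ℝ := √(x ^ 2 + δ ^ 2) - δ

theorem smoothAbs_zero {δ : ℝ} (hδ : 0 < δ) : smoothAbs δ 0 = 0 := by
  simp [smoothAbs, Real.sqrt_sq hδ.le]

theorem contDiff_smoothAbs {δ : ℝ} (hδ : 0 < δ) :
    ContDiff ℝ ((⊤ : ℕ∞) : WithTop ℕ∞) (smoothAbs δ) := by
  refine ContDiff.sub (ContDiff.sqrt (by fun_prop) fun x => ?_) contDiff_const
  positivity

theorem smoothAbs_nonneg (δ x : ℝ) : 0 ≤ smoothAbs δ x :=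
  sub_nonneg.2 (Real.le_sqrt_of_sq_le (by nlinarith [sq_nonneg x]))

theorem abs_smoothAbs_sub_le {δ : ℝ} (hδ : 0 < δ) (x : ℝ) : |smoothAbs δ x - (|x|)| ≤ δ := by
  have h1 : √(x ^ 2 + δ ^ 2) ≤ |x| + δ :=
    Real.sqrt_le_iff.2 ⟨by positivity, by nlinarith [abs_nonneg x, sq_abs x]⟩
  have h2 : |x| ≤ √(x ^ 2 + δ ^ 2) :=
    Real.le_sqrt_of_sq_le (by nlinarith [sq_abs x, sq_nonneg δ])
  rw [smoothAbs, abs_le]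
  constructor <;> linarith

theorem lipschitzWith_abs : LipschitzWith 1 (fun x : ℝ => |x|) := lipschitzWith_one_norm

/-- Although `|φ|` need not be smooth, `smoothAbs δ ∘ φ` is a nonnegative test function vanishing
off the support of `φ` and within `δ` of `|φ|` uniformly. -/
theorem abs_test_mem_closure {φ : Space n → ℝ} (h : IsRealTest φ) :
    lipschitzWith_abs.compLp abs_zero (h.memLp.toLp φ) ∈ closure (nonnegTests ω) := by
  refine Metric.mem_closure_iff.2 fun ε hε => ?_
  set C := √((wMeasure ω).real (tsupport φ))
  have hC : 0 ≤ C := Real.sqrt_nonneg _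
  have hδ : 0 < ε / (C + 1) := by positivity
  have hs : IsRealTest (smoothAbs (ε / (C + 1)) ∘ φ) :=
    h.comp_left (contDiff_smoothAbs hδ) (smoothAbs_zero hδ)
  refine ⟨hs.memLp.toLp _, ⟨_, hs, fun x => smoothAbs_nonneg _ _, rfl⟩, ?_⟩
  have habs : MemLp (fun x => |φ x|) 2 (wMeasure ω) := h.memLp.norm
  have he : lipschitzWith_abs.compLp abs_zero (h.memLp.toLp φ) =
      habs.toLp (fun x => |φ x|) := by
    refine Lp.ext ?_
    filter_upwards [lipschitzWith_abs.coeFn_compLp abs_zero (h.memLp.toLp φ),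
      h.memLp.coeFn_toLp, habs.coeFn_toLp] with x e1 e2 e3
    rw [e1, e3, Function.comp_apply, e2]
  rw [he, dist_comm, dist_eq_norm, ← MemLp.toLp_sub]
  refine (norm_toLp_le_of_bound h.2 _ (fun x hx => ?_) hδ.le
    fun x => abs_smoothAbs_sub_le hδ (φ x)).trans_lt ?_
  · simp [image_eq_zero_of_notMem_tsupport hx, smoothAbs_zero hδ]
  · rw [div_mul_eq_mul_div, div_lt_iff₀ (by positivity)]
    nlinarith

/-- The absolute value is continuous on `L²_ω` and fixes the cone, so approximating `f` by test
functions approximates `f = |f|` by their absolute values. -/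
theorem nonnegCone_subset_closure : nonnegCone ω ⊆ closure (nonnegTests ω) := by
  intro f hf
  have hdense := Lp.dense_hasCompactSupport_contDiff (E := Space n) (F := ℝ) (μ := wMeasure ω)
    (p := 2) (by norm_num)
  have hmaps : MapsTo (lipschitzWith_abs.compLp (p := 2) (μ := wMeasure ω) abs_zero)
      {f | ∃ g : Space n → ℝ, f =ᵐ[wMeasure ω] g ∧ HasCompactSupport g ∧
        ContDiff ℝ ((⊤ : ℕ∞) : WithTop ℕ∞) g} (closure (nonnegTests ω)) := by
    rintro y ⟨g, hyg, hgs, hg⟩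
    have hy : y = (IsRealTest.memLp (ω := ω) ⟨hg, hgs⟩).toLp g := by
      refine Lp.ext ?_
      filter_upwards [hyg, (IsRealTest.memLp (ω := ω) ⟨hg, hgs⟩).coeFn_toLp] with x e1 e2
      rw [e1, e2]
    rw [hy]
    exact abs_test_mem_closure ⟨hg, hgs⟩
  have h1 := (lipschitzWith_abs.continuous_compLp (p := 2) (μ := wMeasure ω)
    abs_zero).continuousWithinAt.mem_closure (hdense f) hmaps
  rw [closure_closure] at h1
  have h2 : lipschitzWith_abs.compLp abs_zero f = f := by
    refine Lp.ext ?_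
    filter_upwards [lipschitzWith_abs.coeFn_compLp abs_zero f, hf] with x e1 e2
    rw [e1, Function.comp_apply, abs_of_nonneg e2]
  rwa [h2] at h1

variable {Γ : ℝ → ℝ → L2w ω →L[ℂ] L2w ω}

theorem innerw_fundamentalSolution_of_tests (hM : 0 ≤ M) (hν : 0 < ν)
    (hA : IsDegenerateElliptic ω A M ν) (hreal : ∀ t x i j, (A t x i j).im = 0)
    (hΓ : IsFundamentalSolution A Γ) (hcont : IsSeparatelyWeaklyContinuous Γ)
    {ψ y : RealL2w ω} (hψ : ψ ∈ nonnegTests ω) (hy : y ∈ nonnegTests ω) {s t : ℝ} (hst : s ≤ t) :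
    innerw (Γ t s (toComplex ω ψ)) (toComplex ω y) ∈ nonnegRay := by
  have hψt : IsTestClass (toComplex ω ψ) := by
    obtain ⟨φ, h, -, rfl⟩ := hψ
    exact isTestClass_toComplex h
  have hyt : IsTestClass (toComplex ω y) := by
    obtain ⟨φ, h, -, rfl⟩ := hy
    exact isTestClass_toComplex h
  -- The exceptional null set of times depends on the density; countably many densities leave a
  -- single null set before `m → ∞`.
  have hae : ∀ᵐ r : ℝ, ∀ m : ℕ, ∫ q in Iio r, (lineDensity s m q : ℂ) *
      innerw (Γ r q (toComplex ω ψ)) (toComplex ω y) ∈ nonnegRay := by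
    refine ae_all_iff.2 fun m => ?_
    have hd := isRealTest_lineDensity s m
    obtain ⟨f, G, hE, hD, hpos⟩ := exists_nonneg_energy_solution hM hν hA hreal hd.continuous
      hd.2 (lineDensity_nonneg s m) (nonnegTests_subset hψ)
    have hrep := hΓ.represents (fun t => (lineDensity s m t : ℂ)) (toComplex ω ψ)
      ⟨Complex.ofRealCLM.contDiff.comp hd.1, hd.2.comp_left Complex.ofReal_zero⟩ hψt _ G hE hD
      (toComplex ω y) hyt
    filter_upwards [hrep, hpos y (nonnegTests_subset hy)] with r h1 h2
    rw [← h1, innerw_toComplex]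
    exact ofReal_mem_nonnegRay h2
  have hgood : ∀ᵐ r : ℝ, s < r → innerw (Γ r s (toComplex ω ψ)) (toComplex ω y) ∈ nonnegRay := by
    filter_upwards [hae] with r hr hsr
    exact isClosed_nonnegRay.mem_of_tendsto (tendsto_setIntegral_lineDensity hsr
      (hcont.right r (toComplex ω ψ) (toComplex ω y))) (Eventually.of_forall hr)
  have hdense := Measure.dense_of_ae hgood
  -- Good times have full measure, hence are dense, and `t` is approached by them strictly from the
  -- right. This also covers `t = s`, where the mollification argument does not apply.
  have hcl : t ∈ closure (Ioi t ∩ {r | s < r →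
      innerw (Γ r s (toComplex ω ψ)) (toComplex ω y) ∈ nonnegRay}) := by
    refine closure_minimal (hdense.open_subset_closure_inter isOpen_Ioi) isClosed_closure ?_
    rw [closure_Ioi]
    exact self_mem_Ici
  have hcw : ContinuousWithinAt (fun r => innerw (Γ r s (toComplex ω ψ)) (toComplex ω y))
      (Ioi t ∩ {r | s < r → innerw (Γ r s (toComplex ω ψ)) (toComplex ω y) ∈ nonnegRay}) t :=
    (hcont.left s (toComplex ω ψ) (toComplex ω y) t hst).mono
      fun r hr => hst.trans (mem_Ioi.1 hr.1).le
  have := hcw.mem_closure hcl (t := nonnegRay) fun r hr => hr.2 (hst.trans_lt hr.1)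
  rwa [isClosed_nonnegRay.closure_eq] at this

/-- The fundamental solution of an equation with real coefficients preserves nonnegativity. -/
theorem isRealNonneg_fundamentalSolution (hM : 0 ≤ M) (hν : 0 < ν)
    (hA : IsDegenerateElliptic ω A M ν) (hreal : ∀ t x i j, (A t x i j).im = 0)
    (hΓ : IsFundamentalSolution A Γ) (hcont : IsSeparatelyWeaklyContinuous Γ)
    {f : L2w ω} (hf : IsRealNonneg f) {s t : ℝ} (hst : s ≤ t) : IsRealNonneg (Γ t s f) := by
  obtain ⟨g, hg, rfl⟩ := hf.exists_toComplex
  refine isRealNonneg_of_forall_innerw fun y hy => ?_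
  have hc1 : ∀ y, Continuous fun ψ => innerw (Γ t s (toComplex ω ψ)) (toComplex ω y) :=
    fun y => continuous_const.inner (by fun_prop)
  have hc2 : Continuous fun y => innerw (Γ t s (toComplex ω g)) (toComplex ω y) :=
    Continuous.inner (by fun_prop) continuous_const
  -- Density is applied one variable at a time: first in the argument of `Γ t s`, then in the vector
  -- paired with it.
  have h1 : ∀ y ∈ nonnegTests ω,
      innerw (Γ t s (toComplex ω g)) (toComplex ω y) ∈ nonnegRay := fun y hy =>
    closure_minimal (fun ψ hψ => innerw_fundamentalSolution_of_tests hM hν hA hreal hΓ hcont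
      hψ hy hst) (isClosed_nonnegRay.preimage (hc1 y)) (nonnegCone_subset_closure hg)
  exact closure_minimal h1 (isClosed_nonnegRay.preimage hc2) (nonnegCone_subset_closure hy)

end FundamentalSolution

end DegenerateParabolic

end

open DegenerateParabolic in
theorem mainTheorem5 (n : ℕ) (hn : 1 ≤ n) (ω : Space n → ℝ) (hω : IsMuckenhouptA2 ω)
    (A : ℝ → Space n → Matrix (Fin n) (Fin n) ℂ) (M ν : ℝ) (hM : 0 < M) (hν : 0 < ν)
    (hA : IsDegenerateElliptic ω A M ν)
    (hreal : ∀ t x i j, (A t x i j).im = 0)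
    (Γ : ℝ → ℝ → L2w ω →L[ℂ] L2w ω)
    (hΓ : IsFundamentalSolution A Γ) (hcont : IsSeparatelyWeaklyContinuous Γ)
    (f : L2w ω) (hf : IsRealNonneg f) (s t : ℝ) (hst : s ≤ t) :
    IsRealNonneg (Γ t s f) := by
  have : Fact (IsMuckenhouptA2 ω) := ⟨hω⟩
  exact isRealNonneg_fundamentalSolution hM.le hν hA hreal hΓ hcont hf hst
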